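/- Let $B$ be a $\mathrm{C}^*$-algebra, $\sigma$ an automorphism of $B$, and $D\subseteq B$ a $\mathrm{C}^*$-subalgebra such that $(B,\sigma,D)$ is a Harnisch--Kirchberg system, i.e. (i) $D\sigma(D)=\sigma(D)$, (ii) $D\cap\sigma(D)=\{0\}$, and (iii) $D\cap\sigma(D)^{\perp}=\{0\}$, where $\sigma(D)^\perp=\{a\in B : ax=xa=0 \text{ for all } x\in\sigma(D)\}$. Ideals of $\mathrm{C}^*$-algebras are understood to be closed and two-sided, and sets of ideals are ordered by inclusion. An ideal $I$ of $D$ is called semi-invariant if $I\sigma(D)\subseteq\sigma(I)$, and cancellative if for all $a,b\in D$ the condition $(a+\sigma(b))\sigma(D)\subseteq\sigma(I)$ implies $a\in I$. For $E=D$, or $E=J$ a semi-invariant ideal of $D$, let $E_\sigma=\overline{\bigcup_{n\in\mathbb N}\big(\sigma^{-n-1}(E)+\dots+\sigma^{n-1}(E)\big)}$; this is a $\sigma$-invariant $\mathrm{C}^*$-subalgebra of $B$, so that the crossed product $E_\sigma\rtimes_\sigma\mathbb Z$ is defined. We regard $D\subseteq D_\sigma$ as contained in $D_\sigma\rtimes_\sigma\mathbb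 Z$, and identify $J_\sigma\rtimes_\sigma\mathbb Z$ with its natural image in $D_\sigma\rtimes_\sigma\mathbb Z$. Assume that every semi-invariant ideal of $D$ is cancellative. Then the maps $$\Delta(J)=J_\sigma\rtimes_\sigma\mathbb Z,\qquad \nabla(I)=I\cap D$$ are well-defined, mutually inverse order isomorphisms between the set of semi-invariant cancellative ideals $J$ of $D$ and the set of ideals $I$ of $D_\sigma\rtimes_\sigma\mathbb Z$. -/

import Mathlib

open scoped ENNReal Pointwise Topology

universe u

noncomputable section

/-! ### Closed two-sided ideals of a C⋆-algebra -/

/-- The ideals of a C⋆-algebra `A`: norm-closed linear subspaces `I` with `A I ⊆ I` and `I A ⊆ I`,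
ordered by inclusion. -/
abbrev ClosedIdeal (A : Type u) [NonUnitalCStarAlgebra A] : Type u :=
  {I : Submodule ℂ A // IsClosed (I : Set A) ∧ ∀ a : A, ∀ x ∈ I, a * x ∈ I ∧ x * a ∈ I}

namespace ClosedIdeal

/-- A closed two-sided ideal of a C⋆-algebra is self-adjoint. -/
theorem star_mem {A : Type u} [NonUnitalCStarAlgebra A] (I : ClosedIdeal A) {x : A}
    (hx : x ∈ I.1) : star x ∈ I.1 := by
  obtain ⟨I, hI, hmul⟩ := I
  change x ∈ I at hx
  change star x ∈ I
  let S : NonUnitalStarSubalgebra ℂ A :=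
    { carrier := {y | y ∈ I ∧ star y ∈ I}
      add_mem' := fun ha hb => ⟨I.add_mem ha.1 hb.1, by rw [star_add]; exact I.add_mem ha.2 hb.2⟩
      zero_mem' := ⟨I.zero_mem, by rw [star_zero]; exact I.zero_mem⟩
      mul_mem' := fun {a b} ha hb =>
        ⟨(hmul a b hb.1).1, by rw [star_mul]; exact (hmul _ _ ha.2).1⟩
      smul_mem' := fun c a ha =>
        ⟨I.smul_mem c ha.1, by rw [star_smul]; exact I.smul_mem _ ha.2⟩
      star_mem' := fun {a} ha => ⟨ha.2, by rw [star_star]; exact ha.1⟩ }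
  have hScl : IsClosed (S : Set A) := hI.inter (hI.preimage continuous_star)
  let _ : NonUnitalCStarAlgebra S :=
    NonUnitalStarSubalgebra.nonUnitalCStarAlgebra S (h_closed := hScl)
  let _ : PartialOrder S := CStarAlgebra.spectralOrder S
  have _ : StarOrderedRing S := CStarAlgebra.spectralOrderedRing S
  have hS : x * star x ∈ S :=
    ⟨(hmul _ _ hx).2, by rw [star_mul, star_star]; exact (hmul _ _ hx).2⟩
  have hau := CStarAlgebra.increasingApproximateUnit S
  have h1 : Filter.Tendsto (fun e : S => (e : A) * (x * star x))
      (CStarAlgebra.approximateUnit S) (𝓝 (x * star x)) :=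
    (continuous_subtype_val.tendsto _).comp (hau.tendsto_mul_right ⟨_, hS⟩)
  have h2 : Filter.Tendsto (fun e : S => 2 * ‖(x * star x) - (e : A) * (x * star x)‖)
      (CStarAlgebra.approximateUnit S) (𝓝 0) := by
    have := ((tendsto_const_nhds (x := x * star x)).sub h1).norm.const_mul 2
    simpa using this
  have h3 : Filter.Tendsto (fun e : S => x - (e : A) * x)
      (CStarAlgebra.approximateUnit S) (𝓝 0) := by
    rw [tendsto_zero_iff_norm_tendsto_zero]
    have h4 : Filter.Tendsto (fun e : S => ‖x - (e : A) * x‖ ^ 2)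
        (CStarAlgebra.approximateUnit S) (𝓝 0) := by
      refine squeeze_zero' (Filter.Eventually.of_forall fun _ => by positivity) ?_ h2
      filter_upwards [hau.eventually_norm] with e hn
      have e1 : ‖star (e : A)‖ ≤ 1 := by rw [norm_star]; exact hn
      set z := (x * star x) - (e : A) * (x * star x) with hz
      have hh : (x - (e : A) * x) * star (x - (e : A) * x) = z - z * star (e : A) := by
        simp only [hz, star_sub, star_mul]
        noncomm_ring
      rw [sq, ← CStarRing.norm_self_mul_star, hh]
      calc ‖z - z * star (e : A)‖ ≤ ‖z‖ + ‖z * star (e : A)‖ := norm_sub_le _ _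
        _ ≤ ‖z‖ + ‖z‖ * 1 := by
            gcongr
            exact (norm_mul_le _ _).trans (by gcongr)
        _ = 2 * ‖z‖ := by ring
    have := h4.sqrt
    simpa using this
  have h5 : Filter.Tendsto (fun e : S => star x * star (e : A))
      (CStarAlgebra.approximateUnit S) (𝓝 (star x)) := by
    have h6 : Filter.Tendsto (fun e : S => star (x - (x - (e : A) * x)))
        (CStarAlgebra.approximateUnit S) (𝓝 (star (x - 0))) :=
      (continuous_star.tendsto _).comp (tendsto_const_nhds.sub h3)
    simpa using h6
  exact hI.mem_of_tendsto h5 (Filter.Eventually.of_forall fun e => (hmul _ _ e.2.2).1)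

variable {B : Type u} [NonUnitalCStarAlgebra B] {D : NonUnitalStarSubalgebra ℂ B}
  [IsClosed (D : Set B)]

/-- An ideal `J` of a C⋆-subalgebra `D ⊆ B`, viewed as a `⋆`-subalgebra of `B`. -/
def toSubalgebra (J : ClosedIdeal D) : NonUnitalStarSubalgebra ℂ B where
  carrier := ((↑) : D → B) '' (J.1 : Set D)
  add_mem' := by
    rintro _ _ ⟨a, ha, rfl⟩ ⟨b, hb, rfl⟩
    exact ⟨a + b, J.1.add_mem ha hb, rfl⟩
  zero_mem' := ⟨0, J.1.zero_mem, rfl⟩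
  mul_mem' := by
    rintro _ _ ⟨a, ha, rfl⟩ ⟨b, hb, rfl⟩
    exact ⟨a * b, (J.2.2 a b hb).1, rfl⟩
  smul_mem' := by
    rintro c _ ⟨a, ha, rfl⟩
    exact ⟨c • a, J.1.smul_mem c ha, rfl⟩
  star_mem' := by
    rintro _ ⟨a, ha, rfl⟩
    exact ⟨star a, J.star_mem ha, rfl⟩

end ClosedIdeal

/-! ### The crossed product of a C⋆-algebra by a single automorphism -/

section CrossedProduct

/-- A covariant representation `(π, U)` of `(A, α)` on a Hilbert space. -/
structure CovariantRep (A : Type u) [NonUnitalCStarAlgebra A] (α : A ≃⋆ₐ[ℂ] A) where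
  H : Type u
  [instNormed : NormedAddCommGroup H]
  [instInner : InnerProductSpace ℂ H]
  [instComplete : CompleteSpace H]
  π : A →⋆ₙₐ[ℂ] (H →L[ℂ] H)
  U : unitary (H →L[ℂ] H)
  covariant : ∀ a : A, (U : H →L[ℂ] H) * π a * star (U : H →L[ℂ] H) = π (α a)

attribute [instance] CovariantRep.instNormed CovariantRep.instInner CovariantRep.instComplete

variable {A : Type u} [NonUnitalCStarAlgebra A] {α : A ≃⋆ₐ[ℂ] A}
variable {A' : Type u} [NonUnitalCStarAlgebra A'] {α' : A' ≃⋆ₐ[ℂ] A'}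

/-- The element `π(a) Uⁿ`. -/
def CovariantRep.monomial (ρ : CovariantRep A α) (a : A) (n : ℤ) : ρ.H →L[ℂ] ρ.H :=
  ρ.π a * ((ρ.U ^ n : unitary (ρ.H →L[ℂ] ρ.H)) : ρ.H →L[ℂ] ρ.H)

theorem CovariantRep.norm_monomial_le (ρ : CovariantRep A α) (a : A) (n : ℤ) :
    ‖ρ.monomial a n‖ ≤ ‖a‖ := by
  rw [CovariantRep.monomial, CStarRing.norm_mul_coe_unitary]
  exact NonUnitalStarAlgHom.norm_apply_le ρ.π a

variable (α) in
/-- The bounded families of operators indexed by the covariant representations of `(A, α)`, with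
pointwise operations and the supremum norm. -/
def CovariantFamilies : Type (u + 1) :=
  lp (fun ρ : CovariantRep A α => ρ.H →L[ℂ] ρ.H) ∞

instance : NonUnitalCStarAlgebra (CovariantFamilies α) :=
  inferInstanceAs (NonUnitalCStarAlgebra (lp (fun ρ : CovariantRep A α => ρ.H →L[ℂ] ρ.H) ∞))

/-- The component of a family at a covariant representation. -/
def CovariantFamilies.apply (x : CovariantFamilies α) (ρ : CovariantRep A α) : ρ.H →L[ℂ] ρ.H :=
  x.1 ρ

variable (α) in
/-- The element `a uⁿ` in the universal representation, i.e. the family of all `π(a) Uⁿ`. -/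
def universalMonomial (a : A) (n : ℤ) : CovariantFamilies α :=
  ⟨fun ρ => ρ.monomial a n, memℓp_infty ⟨‖a‖, by
    rintro _ ⟨ρ, rfl⟩
    exact ρ.norm_monomial_le a n⟩⟩

variable (α) in
/-- The (full) crossed product `A ⋊_α ℤ`: the C⋆-algebra generated by the elements `a uⁿ`,
`a ∈ A`, `n ∈ ℤ`, in the universal representation. Equivalently, the completion of the convolution
algebra of finitely supported `f : ℤ → A` in the norm
`‖f‖ = sup ‖∑ n, π (f n) Uⁿ‖` over all covariant representations `(π, U)`.
Hilbert spaces in the universe of `A` suffice for this supremum: the norm is determined by the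
cyclic subrepresentations, whose Hilbert spaces are completions of quotients of the algebra of
finitely supported functions `ℤ → A`. -/
def crossedProduct : NonUnitalStarSubalgebra ℂ (CovariantFamilies α) :=
  (NonUnitalStarAlgebra.adjoin ℂ
    {x : CovariantFamilies α | ∃ (a : A) (n : ℤ), x = universalMonomial α a n}).topologicalClosure

instance crossedProduct_isClosed : IsClosed (crossedProduct α : Set (CovariantFamilies α)) :=
  NonUnitalStarSubalgebra.isClosed_topologicalClosure _

variable (α) in
/-- The crossed product `A ⋊_α ℤ` as a type. -/
def CrossedProduct : Type (u + 1) := crossedProduct α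

instance : NonUnitalCStarAlgebra (CrossedProduct α) :=
  NonUnitalStarSubalgebra.nonUnitalCStarAlgebra (crossedProduct α)

theorem universalMonomial_mem (a : A) (n : ℤ) : universalMonomial α a n ∈ crossedProduct α :=
  NonUnitalStarSubalgebra.le_topologicalClosure _
    (NonUnitalStarAlgebra.subset_adjoin ℂ _ ⟨a, n, rfl⟩)

variable (α) in
/-- The canonical map `A → A ⋊_α ℤ`, through which `A` is regarded as a subalgebra. -/
def crossedProductCoe (a : A) : CrossedProduct α :=
  ⟨universalMonomial α a 0, universalMonomial_mem a 0⟩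

/-- Restriction of a covariant representation of `(A', α')` along an equivariant
`⋆`-homomorphism `φ : A → A'`. -/
def CovariantRep.pullback (φ : A →⋆ₙₐ[ℂ] A') (hφ : ∀ a, φ (α a) = α' (φ a))
    (ρ : CovariantRep A' α') : CovariantRep A α where
  H := ρ.H
  π := ρ.π.comp φ
  U := ρ.U
  covariant a := by
    simpa [hφ] using ρ.covariant (φ a)

/-- The map on bounded families induced by an equivariant `⋆`-homomorphism. -/
def familiesMap (φ : A →⋆ₙₐ[ℂ] A') (hφ : ∀ a, φ (α a) = α' (φ a)) :
    CovariantFamilies α →⋆ₙₐ[ℂ] CovariantFamilies α' where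
  toFun x := ⟨fun ρ => x.apply (ρ.pullback φ hφ), memℓp_infty ⟨‖x‖, by
    rintro _ ⟨ρ, rfl⟩
    exact lp.norm_apply_le_norm
      (E := fun ρ : CovariantRep A α => ρ.H →L[ℂ] ρ.H) ENNReal.top_ne_zero x (ρ.pullback φ hφ)⟩⟩
  map_smul' _ _ := rfl
  map_zero' := rfl
  map_add' _ _ := rfl
  map_mul' _ _ := rfl
  map_star' _ := rfl

theorem familiesMap_mem (φ : A →⋆ₙₐ[ℂ] A') (hφ : ∀ a, φ (α a) = α' (φ a))
    {x : CovariantFamilies α} (hx : x ∈ crossedProduct α) :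
    familiesMap φ hφ x ∈ crossedProduct α' := by
  have hcont : Continuous (familiesMap φ hφ) :=
    AddMonoidHomClass.continuous_of_bound (familiesMap φ hφ) 1 fun x => by
      simpa using NonUnitalStarAlgHom.norm_apply_le (familiesMap φ hφ) x
  have hle : crossedProduct α ≤
      NonUnitalStarSubalgebra.comap (familiesMap φ hφ) (crossedProduct α') := by
    refine NonUnitalStarSubalgebra.topologicalClosure_minimal _ ?_
      (crossedProduct_isClosed.preimage hcont)
    refine NonUnitalStarAlgebra.adjoin_le ?_
    rintro _ ⟨a, n, rfl⟩
    exact universalMonomial_mem (α := α') (φ a) n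
  exact hle hx

/-- The natural map `A ⋊_α ℤ → A' ⋊_α' ℤ`, `a uⁿ ↦ φ(a) uⁿ`, induced by an equivariant
`⋆`-homomorphism `φ : A → A'`. -/
def crossedProductMap (φ : A →⋆ₙₐ[ℂ] A') (hφ : ∀ a, φ (α a) = α' (φ a)) :
    CrossedProduct α →⋆ₙₐ[ℂ] CrossedProduct α' where
  toFun x := ⟨familiesMap φ hφ x.1, familiesMap_mem φ hφ x.2⟩
  map_smul' c x := Subtype.ext (map_smul (familiesMap φ hφ) c x.1)
  map_zero' := Subtype.ext (map_zero (familiesMap φ hφ))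
  map_add' x y := Subtype.ext (map_add (familiesMap φ hφ) x.1 y.1)
  map_mul' x y := Subtype.ext (map_mul (familiesMap φ hφ) x.1 y.1)
  map_star' x := Subtype.ext (map_star (familiesMap φ hφ) x.1)

end CrossedProduct

/-! ### Harnisch–Kirchberg systems -/

section Systems

variable {B : Type u} [NonUnitalCStarAlgebra B] (σ : B ≃⋆ₐ[ℂ] B)

/-- `E_{k,ℓ} = σ^{k-1}(E) + ⋯ + σ^{ℓ-1}(E)`. -/
def shiftSum (E : NonUnitalStarSubalgebra ℂ B) (k l : ℤ) : Set B :=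
  {x | ∃ d : ℤ → B, (∀ i, d i ∈ E) ∧ x = ∑ i ∈ Finset.Icc (k - 1) (l - 1), (σ ^ i) (d i)}

/-- `σⁿ(E)` absorbs multiplication by `E`, for all `n ≥ 0`. -/
def AbsorbsShifts (E : NonUnitalStarSubalgebra ℂ B) : Prop :=
  ∀ n : ℕ, ∀ x ∈ E, ∀ y ∈ E, ∃ z ∈ E, x * (σ ^ n) y = (σ ^ n) z

/-- The triple `(B, σ, D)` is a Harnisch–Kirchberg system: `D σ(D) = σ(D)`, where the left side
is the set of products (the same as its closed linear span, by Cohen factorization),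
`D ∩ σ(D) = 0`, and `D ∩ σ(D)^⊥ = 0`, where `σ(D)^⊥` is the two-sided annihilator. -/
structure IsHarnischKirchbergSystem (D : NonUnitalStarSubalgebra ℂ B) : Prop where
  mul_eq : (D : Set B) * (σ '' (D : Set B)) = σ '' (D : Set B)
  inter_eq : (D : Set B) ∩ (σ '' (D : Set B)) = {0}
  inter_perp : (D : Set B) ∩ {a | ∀ x ∈ σ '' (D : Set B), a * x = 0 ∧ x * a = 0} = {0}

variable {σ}

theorem shiftSum_mono {E F : NonUnitalStarSubalgebra ℂ B} (h : E ≤ F) {m n : ℕ} (hmn : m ≤ n) :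
    shiftSum σ E (-m) m ⊆ shiftSum σ F (-n) n := by
  classical
  rintro _ ⟨d, hd, rfl⟩
  refine ⟨fun i => if i ∈ Finset.Icc (-(m : ℤ) - 1) (m - 1) then d i else 0, fun i => ?_, ?_⟩
  · dsimp only
    split_ifs
    · exact h (hd i)
    · exact F.zero_mem
  · have hsub : Finset.Icc (-(m : ℤ) - 1) (m - 1) ⊆ Finset.Icc (-(n : ℤ) - 1) (n - 1) :=
      Finset.Icc_subset_Icc (by omega) (by omega)
    rw [← Finset.sum_subset hsub (fun i _ hi => by dsimp only; rw [if_neg hi, map_zero])]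
    exact Finset.sum_congr rfl fun i hi => by dsimp only; rw [if_pos hi]

theorem single_mem_shiftSum {E : NonUnitalStarSubalgebra ℂ B} {x : B} (hx : x ∈ E) (i : ℤ) :
    ∃ n : ℕ, (σ ^ i) x ∈ shiftSum σ E (-n) n := by
  classical
  refine ⟨i.natAbs + 1, fun j => if j = i then x else 0, fun j => ?_, ?_⟩
  · dsimp only
    split_ifs
    · exact hx
    · exact E.zero_mem
  · rw [Finset.sum_eq_single i]
    · simp
    · intro j _ hj
      dsimp only
      rw [if_neg hj, map_zero]
    · intro hi
      exact absurd (Finset.mem_Icc.2 ⟨by omega, by omega⟩) hi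

variable (σ) in
/-- The linear space `⋃ n, E_{-n,n}`. -/
def finiteShiftSums (E : NonUnitalStarSubalgebra ℂ B) : Submodule ℂ B where
  carrier := ⋃ n : ℕ, shiftSum σ E (-n) n
  add_mem' := by
    intro x y hx hy
    obtain ⟨m, hm⟩ := Set.mem_iUnion.1 hx
    obtain ⟨n, hn⟩ := Set.mem_iUnion.1 hy
    obtain ⟨d, hd, h1⟩ := shiftSum_mono le_rfl (le_max_left m n) hm
    obtain ⟨e, he, h2⟩ := shiftSum_mono le_rfl (le_max_right m n) hn
    refine Set.mem_iUnion.2 ⟨max m n, fun i => d i + e i, fun i => E.add_mem (hd i) (he i), ?_⟩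
    rw [h1, h2, ← Finset.sum_add_distrib]
    exact Finset.sum_congr rfl fun i _ => (map_add _ _ _).symm
  zero_mem' := Set.mem_iUnion.2 ⟨0, fun _ => 0, fun _ => E.zero_mem, by simp⟩
  smul_mem' := by
    intro c x hx
    obtain ⟨n, d, hd, rfl⟩ := Set.mem_iUnion.1 hx
    refine Set.mem_iUnion.2 ⟨n, fun i => c • d i, fun i => E.smul_mem' c (hd i), ?_⟩
    rw [Finset.smul_sum]
    exact Finset.sum_congr rfl fun i _ => (map_smul _ _ _).symm

theorem single_mem_finiteShiftSums {E : NonUnitalStarSubalgebra ℂ B} {x : B} (hx : x ∈ E)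
    (i : ℤ) : (σ ^ i) x ∈ finiteShiftSums σ E :=
  Set.mem_iUnion.2 (single_mem_shiftSum hx i)

theorem map_mem_finiteShiftSums {E : NonUnitalStarSubalgebra ℂ B} {x : B}
    (hx : x ∈ finiteShiftSums σ E) (k : ℤ) : (σ ^ k) x ∈ finiteShiftSums σ E := by
  obtain ⟨n, d, hd, rfl⟩ := Set.mem_iUnion.1 hx
  rw [map_sum]
  refine Submodule.sum_mem _ fun i _ => ?_
  rw [← StarAlgEquiv.mul_apply, ← zpow_add]
  exact single_mem_finiteShiftSums (hd i) _

theorem AbsorbsShifts.single_mul_single_of_le {E : NonUnitalStarSubalgebra ℂ B}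
    (h : AbsorbsShifts σ E) {x y : B} (hx : x ∈ E) (hy : y ∈ E) {i j : ℤ} (hij : i ≤ j) :
    ∃ z ∈ E, (σ ^ i) x * (σ ^ j) y = (σ ^ j) z := by
  obtain ⟨n, rfl⟩ := Int.le.dest hij
  obtain ⟨z, hz, hxy⟩ := h n x hx y hy
  refine ⟨z, hz, ?_⟩
  rw [zpow_add, zpow_natCast, StarAlgEquiv.mul_apply, StarAlgEquiv.mul_apply, ← hxy, map_mul]

theorem AbsorbsShifts.single_mul_single_mem {E : NonUnitalStarSubalgebra ℂ B}
    (h : AbsorbsShifts σ E) {x y : B} (hx : x ∈ E) (hy : y ∈ E) (i j : ℤ) :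
    (σ ^ i) x * (σ ^ j) y ∈ finiteShiftSums σ E := by
  rcases le_total i j with hij | hij
  · obtain ⟨z, hz, e⟩ := h.single_mul_single_of_le hx hy hij
    rw [e]
    exact single_mem_finiteShiftSums hz _
  · obtain ⟨z, hz, e⟩ := h.single_mul_single_of_le (star_mem hy) (star_mem hx) hij
    have e' : (σ ^ i) x * (σ ^ j) y = (σ ^ i) (star z) := by
      rw [map_star, ← e, star_mul, map_star, map_star, star_star, star_star]
    rw [e']
    exact single_mem_finiteShiftSums (star_mem hz) _

variable (σ) in
/-- The C⋆-subalgebra `E_σ`, the closure of `⋃ n, E_{-n,n}`. -/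
def sigmaAlgebra (E : NonUnitalStarSubalgebra ℂ B) (h : AbsorbsShifts σ E) :
    NonUnitalStarSubalgebra ℂ B :=
  NonUnitalStarSubalgebra.topologicalClosure
    { finiteShiftSums σ E with
      mul_mem' := by
        intro x y hx hy
        obtain ⟨m, d, hd, rfl⟩ := Set.mem_iUnion.1 hx
        obtain ⟨n, e, he, rfl⟩ := Set.mem_iUnion.1 hy
        rw [Finset.sum_mul_sum]
        exact Submodule.sum_mem (finiteShiftSums σ E) fun i _ =>
          Submodule.sum_mem _ fun j _ => h.single_mul_single_mem (hd i) (he j) i j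
      star_mem' := by
        intro x hx
        obtain ⟨n, d, hd, rfl⟩ := Set.mem_iUnion.1 hx
        refine Set.mem_iUnion.2 ⟨n, fun i => star (d i), fun i => star_mem (hd i), ?_⟩
        rw [star_sum]
        exact Finset.sum_congr rfl fun i _ => (map_star _ _).symm }

theorem coe_sigmaAlgebra (E : NonUnitalStarSubalgebra ℂ B) (h : AbsorbsShifts σ E) :
    (sigmaAlgebra σ E h : Set B) = closure (⋃ n : ℕ, shiftSum σ E (-n) n) := rfl

instance sigmaAlgebra_isClosed (E : NonUnitalStarSubalgebra ℂ B) (h : AbsorbsShifts σ E) :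
    IsClosed (sigmaAlgebra σ E h : Set B) :=
  NonUnitalStarSubalgebra.isClosed_topologicalClosure _

theorem le_sigmaAlgebra (E : NonUnitalStarSubalgebra ℂ B) (h : AbsorbsShifts σ E) :
    E ≤ sigmaAlgebra σ E h := fun x hx =>
  subset_closure (show x ∈ finiteShiftSums σ E by
    simpa using single_mem_finiteShiftSums (σ := σ) hx 0)

theorem sigmaAlgebra_mono {E F : NonUnitalStarSubalgebra ℂ B} (hE : AbsorbsShifts σ E)
    (hF : AbsorbsShifts σ F) (h : E ≤ F) : sigmaAlgebra σ E hE ≤ sigmaAlgebra σ F hF :=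
  closure_mono (Set.iUnion_mono fun _ => shiftSum_mono h le_rfl)

theorem zpow_mem_sigmaAlgebra (E : NonUnitalStarSubalgebra ℂ B) (h : AbsorbsShifts σ E) {x : B}
    (hx : x ∈ sigmaAlgebra σ E h) (k : ℤ) : (σ ^ k) x ∈ sigmaAlgebra σ E h :=
  map_mem_closure (StarAlgEquiv.isometry (σ ^ k)).continuous hx
    fun _ hy => map_mem_finiteShiftSums hy k

/-- The restriction of `σ` to an automorphism of `E_σ`. -/
def sigmaAut (E : NonUnitalStarSubalgebra ℂ B) (h : AbsorbsShifts σ E) :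
    sigmaAlgebra σ E h ≃⋆ₐ[ℂ] sigmaAlgebra σ E h where
  toFun x := ⟨σ x, by simpa using zpow_mem_sigmaAlgebra E h x.2 1⟩
  invFun x := ⟨σ.symm x, by
    simpa [StarAlgEquiv.aut_inv] using zpow_mem_sigmaAlgebra E h x.2 (-1)⟩
  left_inv x := Subtype.ext (σ.symm_apply_apply x)
  right_inv x := Subtype.ext (σ.apply_symm_apply x)
  map_mul' x y := Subtype.ext (map_mul σ (x : B) y)
  map_add' x y := Subtype.ext (map_add σ (x : B) y)
  map_star' x := Subtype.ext (map_star σ (x : B))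
  map_smul' c x := Subtype.ext (map_smul σ c (x : B))

variable {D : NonUnitalStarSubalgebra ℂ B} [IsClosed (D : Set B)]

variable (σ) in
/-- An ideal `I` of `D` is semi-invariant if `I σ(D) ⊆ σ(I)`. -/
def IsSemiInvariant (I : ClosedIdeal D) : Prop :=
  ∀ x ∈ I.1, ∀ d : D, (x : B) * σ d ∈ σ '' (I.toSubalgebra : Set B)

variable (σ) in
/-- An ideal `I` of `D` is cancellative if `(a + σ(b)) σ(D) ⊆ σ(I)` implies `a ∈ I`, for all
`a, b ∈ D`. -/
def IsCancellative (I : ClosedIdeal D) : Prop :=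
  ∀ a b : D, (∀ d : D, ((a : B) + σ b) * σ d ∈ σ '' (I.toSubalgebra : Set B)) → a ∈ I.1

variable (σ D) in
/-- The semi-invariant cancellative ideals of `D`, ordered by inclusion. -/
abbrev SICIdeal : Type u :=
  {J : ClosedIdeal D // IsSemiInvariant σ J ∧ IsCancellative σ J}

theorem IsHarnischKirchbergSystem.ideal_mul (hD : IsHarnischKirchbergSystem σ D)
    {J : ClosedIdeal D} (hJ : IsSemiInvariant σ J) (n : ℕ) :
    ∀ x ∈ J.1, ∀ d : D, ∃ z ∈ J.1, (x : B) * (σ ^ n) (d : B) = (σ ^ n) (z : B) := by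
  induction n with
  | zero => exact fun x hx d => ⟨x * d, (J.2.2 d x hx).2, rfl⟩
  | succ n ih =>
    intro x hx d
    have hd : σ (d : B) ∈ (D : Set B) * (σ '' (D : Set B)) := by
      rw [hD.mul_eq]
      exact ⟨d, d.2, rfl⟩
    obtain ⟨e, he, _, ⟨f, hf, rfl⟩, hef⟩ := hd
    obtain ⟨y, hy, hxy⟩ := ih x hx ⟨e, he⟩
    obtain ⟨_, ⟨z, hz, rfl⟩, hyz⟩ := hJ y hy ⟨f, hf⟩
    refine ⟨z, hz, ?_⟩
    simp only at hef hxy hyz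
    rw [pow_succ, StarAlgEquiv.mul_apply, StarAlgEquiv.mul_apply, ← hef, map_mul, ← mul_assoc,
      hxy, ← map_mul, hyz]

theorem IsHarnischKirchbergSystem.absorbsShifts_ideal (hD : IsHarnischKirchbergSystem σ D)
    {J : ClosedIdeal D} (hJ : IsSemiInvariant σ J) : AbsorbsShifts σ J.toSubalgebra := by
  rintro n _ ⟨x, hx, rfl⟩ _ ⟨y, -, rfl⟩
  obtain ⟨z, hz, e⟩ := hD.ideal_mul hJ n x hx y
  exact ⟨z, ⟨z, hz, rfl⟩, e⟩

theorem IsHarnischKirchbergSystem.absorbsShifts (hD : IsHarnischKirchbergSystem σ D) :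
    AbsorbsShifts σ D := by
  let T : ClosedIdeal D := ⟨⊤, isClosed_univ, fun _ _ _ => ⟨trivial, trivial⟩⟩
  have hT : IsSemiInvariant σ T := fun x _ d => by
    have hx : (x : B) * σ d ∈ (D : Set B) * (σ '' (D : Set B)) :=
      Set.mul_mem_mul x.2 ⟨d, d.2, rfl⟩
    rw [hD.mul_eq] at hx
    obtain ⟨z, hz, e⟩ := hx
    exact ⟨z, ⟨⟨z, hz⟩, trivial, rfl⟩, e⟩
  intro n x hx y hy
  obtain ⟨z, -, e⟩ := hD.ideal_mul hT n ⟨x, hx⟩ trivial ⟨y, hy⟩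
  exact ⟨z, z.2, e⟩

namespace IsHarnischKirchbergSystem

/-- The C⋆-algebra `D_σ ⋊_σ ℤ`. -/
abbrev crossedProductAlgebra (hD : IsHarnischKirchbergSystem σ D) : Type (u + 1) :=
  CrossedProduct (sigmaAut D hD.absorbsShifts)

/-- The inclusion `D ⊆ D_σ ⊆ D_σ ⋊_σ ℤ`. -/
def inclusion (hD : IsHarnischKirchbergSystem σ D) (d : D) : hD.crossedProductAlgebra :=
  crossedProductCoe _ ⟨d, le_sigmaAlgebra D hD.absorbsShifts d.2⟩

/-- The natural map `J_σ ⋊_σ ℤ → D_σ ⋊_σ ℤ` for a semi-invariant ideal `J` of `D`, induced by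
the inclusion `J_σ ⊆ D_σ`. -/
def idealMap (hD : IsHarnischKirchbergSystem σ D) (J : ClosedIdeal D) (hJ : IsSemiInvariant σ J) :
    CrossedProduct (sigmaAut J.toSubalgebra (hD.absorbsShifts_ideal hJ)) →⋆ₙₐ[ℂ]
      hD.crossedProductAlgebra :=
  crossedProductMap
    (NonUnitalStarSubalgebra.inclusion
      (sigmaAlgebra_mono (hD.absorbsShifts_ideal hJ) hD.absorbsShifts
        (by rintro _ ⟨x, -, rfl⟩; exact x.2)))
    (fun _ => rfl)

end IsHarnischKirchbergSystem

end Systems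

end

/-! Write `T_m` for the closed sum of the `σⁱ(D)`, `i ≥ m`. From `D σ(D) = σ(D)` and adjoints one
gets `σⁱ(D) σʲ(D) ⊆ σᵏ(D)` with `k = max i j`. So the `T_m` are a decreasing chain of closed ideals
of `D_σ`, and `σⁿ(T_m) ⊆ T_{m+n}`.

Cancellativity means independence of the shifts modulo an ideal: if `K` is an invariant ideal of
`D_σ` with `K ∩ D` cancellative, then a finite sum of `σⁱ(dᵢ)` lies in `K` only if every `dᵢ` does
(`mem_of_sum_mem`). Right multiplication by `σ(e)` merges the two lowest terms into one, which
allows induction on the number of terms. Injective ⋆-homomorphisms are isometric, so small elements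
of a quotient lift to small elements of a subalgebra (`exists_sub_mem_norm_lt`), and the algebraic
statement survives closure: `K ⊆ (K ∩ D)_σ`. Independence modulo `0` also gives `J_σ ∩ D = J`.

`∇ Δ = id`: a representation of `D_σ / J_σ` induces a regular covariant representation which kills
`J_σ ⋊ ℤ`. Hence `J_σ ⋊ ℤ` meets `D_σ` in `J_σ`, and so meets `D` in `J`.

`Δ ∇ = id`: let `I` be an ideal of the crossed product, `K = I ∩ D_σ`, and `E` the conditional
expectation onto `D_σ`. By Fourier analysis of the dual action it suffices that `E(I) ⊆ (K ∩ D)_σ`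
(`le_idealSpan`). For `x ∈ I` and `a, b ∈ T_m`, every nonzero Fourier mode of `a x b` has its
coefficient in `T_{m+1}`, after moving the coefficient across the power of `u` if the mode is
negative. Compressing by `1 - f`, with `f` from an approximate unit of `T_{m+1}`, makes these modes
small, so `a E(x) b` lies in the closure of `K + T_{m+1}` (`mul_coeff_mul_approx`). The elements of
`D_σ` with this property for all `m` form an invariant ideal `Z` (`graded`). Independence gives `Z ∩
D ⊆ K`. As `Z ∩ D` is semi-invariant, it is cancellative by assumption, so `Z ⊆ (Z ∩ D)_σ ⊆ (K ∩
D)_σ`. -/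

noncomputable section

open Filter

/-! ### Approximate units -/

/-- A closed ⋆-subalgebra of a C⋆-algebra has a selfadjoint contractive approximate unit `e` for
which `1 - e` is contractive. -/
theorem NonUnitalStarSubalgebra.exists_approximateUnit {B : Type*} [NonUnitalCStarAlgebra B]
    (N : NonUnitalStarSubalgebra ℂ B) (hN : IsClosed (N : Set B)) :
    ∃ l : Filter B, l.NeBot ∧
      (∀ᶠ e in l, e ∈ N ∧ star e = e ∧ ‖e‖ ≤ 1 ∧ ∀ x : B, ‖x - e * x‖ ≤ ‖x‖) ∧
      (∀ x ∈ N, Tendsto (fun e => e * x) l (𝓝 x)) ∧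
      (∀ x ∈ N, Tendsto (fun e => x * e) l (𝓝 x)) := by
  let _ : NonUnitalCStarAlgebra N :=
    NonUnitalStarSubalgebra.nonUnitalCStarAlgebra N (h_closed := hN)
  let _ : PartialOrder N := CStarAlgebra.spectralOrder N
  have _ : StarOrderedRing N := CStarAlgebra.spectralOrderedRing N
  let _ : PartialOrder B := CStarAlgebra.spectralOrder B
  have _ : StarOrderedRing B := CStarAlgebra.spectralOrderedRing B
  have hau := CStarAlgebra.increasingApproximateUnit N
  refine ⟨(CStarAlgebra.approximateUnit N).map (fun e : N => (e : B)), inferInstance, ?_, ?_, ?_⟩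
  · rw [eventually_map]
    filter_upwards [hau.eventually_norm, hau.eventually_nonneg] with e h1 h2
    obtain ⟨y, hy⟩ := CStarAlgebra.nonneg_iff_eq_star_mul_self.1 h2
    have h3 : (0 : B) ≤ e := by
      rw [hy]
      exact star_mul_self_nonneg (y : B)
    refine ⟨e.2, (IsSelfAdjoint.of_nonneg h3).star_eq, h1, fun x => ?_⟩
    -- With lower element `0` the hypothesis of this comparison reduces to `‖x⋆ x‖ ≤ ‖x‖²`.
    refine CStarAlgebra.norm_sub_mul_self_le_of_inr x le_rfl h3 h1 (norm_nonneg _) ?_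
    rw [Unitization.inr_zero, sub_zero, mul_one, CStarRing.norm_star_mul_self,
      Unitization.norm_inr, sq]
  · intro x hx
    exact (continuous_subtype_val.tendsto _).comp (hau.tendsto_mul_right ⟨x, hx⟩)
  · intro x hx
    exact (continuous_subtype_val.tendsto _).comp (hau.tendsto_mul_left ⟨x, hx⟩)

/-! ### Quotients of C⋆-algebras -/

namespace ClosedIdeal

variable {A : Type u} [NonUnitalCStarAlgebra A] (I : ClosedIdeal A)

/-- A closed ideal as a ⋆-subalgebra. -/
def starSubalgebra : NonUnitalStarSubalgebra ℂ A where
  __ := I.1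
  mul_mem' {a} _ _ hb := (I.2.2 a _ hb).1
  star_mem' ha := I.star_mem ha

/-- The quotient C⋆-algebra. -/
def Quot : Type u := A ⧸ I.1

instance : IsClosed (I.1 : Set A) := I.2.1

instance : NormedAddCommGroup I.Quot := inferInstanceAs (NormedAddCommGroup (A ⧸ I.1))

instance : NormedSpace ℂ I.Quot := inferInstanceAs (NormedSpace ℂ (A ⧸ I.1))

instance : CompleteSpace I.Quot := inferInstanceAs (CompleteSpace (A ⧸ I.1))

/-- The quotient map, as a linear map. -/
def mkₗ : A →ₗ[ℂ] I.Quot := I.1.mkQ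

theorem mkₗ_surjective : Function.Surjective I.mkₗ := I.1.mkQ_surjective

theorem mkₗ_eq_mkₗ {a b : A} : I.mkₗ a = I.mkₗ b ↔ a - b ∈ I.1 := Submodule.Quotient.eq I.1

theorem norm_mkₗ_le (a : A) : ‖I.mkₗ a‖ ≤ ‖a‖ := Submodule.Quotient.norm_mk_le I.1 a

theorem exists_norm_lt (x : I.Quot) {ε : ℝ} (hε : 0 < ε) :
    ∃ a, I.mkₗ a = x ∧ ‖a‖ < ‖x‖ + ε := Submodule.Quotient.norm_mk_lt x hε

instance : Mul I.Quot where
  mul := Quotient.map₂ (· * ·) (by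
    intro a a' ha b b' hb
    replace ha : a - a' ∈ I.1 := (Submodule.quotientRel_def _).1 ha
    replace hb : b - b' ∈ I.1 := (Submodule.quotientRel_def _).1 hb
    refine (Submodule.quotientRel_def _).2 ?_
    have : a * b - a' * b' = (a - a') * b + a' * (b - b') := by noncomm_ring
    rw [this]
    exact I.1.add_mem (I.2.2 _ _ ha).2 (I.2.2 _ _ hb).1)

theorem mkₗ_mul (a b : A) : I.mkₗ (a * b) = I.mkₗ a * I.mkₗ b := rfl

instance : Star I.Quot where
  star := Quotient.map star (by
    intro a a' ha
    replace ha : a - a' ∈ I.1 := (Submodule.quotientRel_def _).1 ha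
    refine (Submodule.quotientRel_def _).2 ?_
    rw [← star_sub]
    exact I.star_mem ha)

theorem mkₗ_star (a : A) : I.mkₗ (star a) = star (I.mkₗ a) := rfl

instance : NonUnitalRing I.Quot where
  __ := (inferInstance : AddCommGroup I.Quot)
  left_distrib x y z := by
    obtain ⟨a, rfl⟩ := I.mkₗ_surjective x
    obtain ⟨b, rfl⟩ := I.mkₗ_surjective y
    obtain ⟨c, rfl⟩ := I.mkₗ_surjective z
    rw [← map_add, ← mkₗ_mul, mul_add, map_add]; rfl
  right_distrib x y z := by
    obtain ⟨a, rfl⟩ := I.mkₗ_surjective x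
    obtain ⟨b, rfl⟩ := I.mkₗ_surjective y
    obtain ⟨c, rfl⟩ := I.mkₗ_surjective z
    rw [← map_add, ← mkₗ_mul, add_mul, map_add]; rfl
  zero_mul x := by
    obtain ⟨a, rfl⟩ := I.mkₗ_surjective x
    rw [← map_zero I.mkₗ, ← mkₗ_mul, zero_mul]
  mul_zero x := by
    obtain ⟨a, rfl⟩ := I.mkₗ_surjective x
    rw [← map_zero I.mkₗ, ← mkₗ_mul, mul_zero]
  mul_assoc x y z := by
    obtain ⟨a, rfl⟩ := I.mkₗ_surjective x
    obtain ⟨b, rfl⟩ := I.mkₗ_surjective y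
    obtain ⟨c, rfl⟩ := I.mkₗ_surjective z
    simp only [← mkₗ_mul, mul_assoc]

theorem norm_mkₗ_mul_le (x y : I.Quot) : ‖x * y‖ ≤ ‖x‖ * ‖y‖ := by
  have h : ∀ ε > 0, ‖x * y‖ ≤ (‖x‖ + ε) * (‖y‖ + ε) := by
    intro ε hε
    obtain ⟨a, rfl, ha⟩ := I.exists_norm_lt x hε
    obtain ⟨b, rfl, hb⟩ := I.exists_norm_lt y hε
    rw [← mkₗ_mul]
    refine (I.norm_mkₗ_le _).trans ((norm_mul_le _ _).trans ?_)
    gcongr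
  have ht : Tendsto (fun ε : ℝ => (‖x‖ + ε) * (‖y‖ + ε)) (𝓝[>] 0) (𝓝 ((‖x‖ + 0) * (‖y‖ + 0))) :=
    (Continuous.tendsto (by fun_prop) 0).mono_left nhdsWithin_le_nhds
  simp only [add_zero] at ht
  exact ge_of_tendsto ht (by filter_upwards [self_mem_nhdsWithin] with ε hε using h ε hε)

instance : NonUnitalNormedRing I.Quot where
  __ := (inferInstance : NormedAddCommGroup I.Quot)
  __ := (inferInstance : NonUnitalRing I.Quot)
  norm_mul_le := I.norm_mkₗ_mul_le

instance : StarRing I.Quot where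
  star_involutive x := by
    obtain ⟨a, rfl⟩ := I.mkₗ_surjective x
    rw [← mkₗ_star, ← mkₗ_star, star_star]
  star_mul x y := by
    obtain ⟨a, rfl⟩ := I.mkₗ_surjective x
    obtain ⟨b, rfl⟩ := I.mkₗ_surjective y
    simp only [← mkₗ_star, ← mkₗ_mul, star_mul]
  star_add x y := by
    obtain ⟨a, rfl⟩ := I.mkₗ_surjective x
    obtain ⟨b, rfl⟩ := I.mkₗ_surjective y
    simp only [← mkₗ_star, ← map_add, star_add]

/-- This is the C⋆-inequality of the quotient; the norm of the class of `a⋆ a` is the infimum of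
`‖y‖` over its representatives `y`. For `e` in an approximate unit of `I`, `a - a e` represents the
class of `a`, and its square is `(1 - e) a⋆ a (1 - e)`. Replacing `a⋆ a` by `y` costs `(1 - e) i`
with `i ∈ I`, which tends to zero. -/
theorem norm_mkₗ_sq_le (a y : A) (h : I.mkₗ (star a * a) = I.mkₗ y) : ‖I.mkₗ a‖ ^ 2 ≤ ‖y‖ := by
  obtain ⟨l, hl, h1, h2, h3⟩ := I.starSubalgebra.exists_approximateUnit I.2.1
  have hi : star a * a - y ∈ I.1 := I.mkₗ_eq_mkₗ.1 h
  set i := star a * a - y with hidef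
  have ht : Tendsto (fun e => ‖y‖ + ‖i - e * i‖) l (𝓝 (‖y‖ + ‖i - i‖)) :=
    tendsto_const_nhds.add (tendsto_const_nhds.sub (h2 i hi)).norm
  rw [sub_self, norm_zero, add_zero] at ht
  refine ge_of_tendsto ht ?_
  filter_upwards [h1] with e ⟨heI, hes, hen, hec⟩
  have hec' (x : A) : ‖x - x * e‖ ≤ ‖x‖ := by
    rw [← norm_star, ← norm_star x]
    simpa [hes] using hec (star x)
  have e1 : I.mkₗ a = I.mkₗ (a - a * e) := by
    rw [mkₗ_eq_mkₗ, sub_sub_cancel]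
    exact (I.2.2 a e heI).1
  have e2 : star (a - a * e) * (a - a * e) = ((star a * a) - e * (star a * a)) -
      ((star a * a) - e * (star a * a)) * e := by
    rw [star_sub, star_mul, hes]
    noncomm_ring
  have e3 : star a * a - e * (star a * a) = (y - e * y) + (i - e * i) := by
    rw [hidef]; noncomm_ring
  calc ‖I.mkₗ a‖ ^ 2 ≤ ‖a - a * e‖ ^ 2 := by
        rw [e1]; gcongr; exact I.norm_mkₗ_le _
    _ ≤ ‖(star a * a) - e * (star a * a)‖ := by
        rw [sq, ← CStarRing.norm_star_mul_self, e2]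
        exact hec' _
    _ ≤ ‖y‖ + ‖i - e * i‖ := by
        rw [e3]
        exact (norm_add_le _ _).trans (by gcongr; exact hec y)

instance : CStarRing I.Quot where
  norm_mul_self_le x := by
    obtain ⟨a, rfl⟩ := I.mkₗ_surjective x
    rw [← mkₗ_star, ← mkₗ_mul, ← sq]
    refine le_of_forall_pos_le_add fun ε hε => ?_
    obtain ⟨y, hy, hy'⟩ := I.exists_norm_lt (I.mkₗ (star a * a)) hε
    exact (I.norm_mkₗ_sq_le a y hy.symm).trans hy'.le

instance : NonUnitalCStarAlgebra I.Quot where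
  __ := (inferInstance : NonUnitalNormedRing I.Quot)
  __ := (inferInstance : StarRing I.Quot)
  __ := (inferInstance : NormedSpace ℂ I.Quot)
  complete := CompleteSpace.complete
  norm_mul_self_le := CStarRing.norm_mul_self_le
  smul_assoc c x y := by
    obtain ⟨a, rfl⟩ := I.mkₗ_surjective x
    obtain ⟨b, rfl⟩ := I.mkₗ_surjective y
    simp only [smul_eq_mul, ← map_smul, ← mkₗ_mul, smul_mul_assoc]
  smul_comm c x y := by
    obtain ⟨a, rfl⟩ := I.mkₗ_surjective x
    obtain ⟨b, rfl⟩ := I.mkₗ_surjective y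
    simp only [smul_eq_mul, ← map_smul, ← mkₗ_mul, mul_smul_comm]
  star_smul c x := by
    obtain ⟨a, rfl⟩ := I.mkₗ_surjective x
    simp only [← mkₗ_star, ← map_smul, star_smul]

/-- The quotient map. -/
def mk : A →⋆ₙₐ[ℂ] I.Quot where
  toFun := I.mkₗ
  map_smul' := map_smul I.mkₗ
  map_zero' := map_zero I.mkₗ
  map_add' := map_add I.mkₗ
  map_mul' := I.mkₗ_mul
  map_star' := I.mkₗ_star

theorem mk_eq_zero {a : A} : I.mk a = 0 ↔ a ∈ I.1 := Submodule.Quotient.mk_eq_zero I.1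

end ClosedIdeal

/-! ### Kernels and ranges of ⋆-homomorphisms -/

section Kernel

variable {S Q : Type*} [NonUnitalCStarAlgebra S] [NonUnitalCStarAlgebra Q]

theorem NonUnitalStarAlgHom.continuous_of_cstar (φ : S →⋆ₙₐ[ℂ] Q) : Continuous φ :=
  AddMonoidHomClass.continuous_of_bound φ 1 fun x => by
    simpa using NonUnitalStarAlgHom.norm_apply_le φ x

/-- The kernel of a ⋆-homomorphism. -/
def NonUnitalStarAlgHom.kerIdeal {S : Type u} [NonUnitalCStarAlgebra S] (φ : S →⋆ₙₐ[ℂ] Q) :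
    ClosedIdeal S :=
  ⟨{ carrier := {s | φ s = 0}
     add_mem' := fun {a b} ha hb => by
       simp only [Set.mem_ofPred_eq] at *
       rw [map_add, ha, hb, add_zero]
     zero_mem' := map_zero φ
     smul_mem' := fun c a ha => by
       simp only [Set.mem_ofPred_eq] at *
       rw [map_smul, ha, smul_zero] },
    isClosed_singleton.preimage φ.continuous_of_cstar, fun a x hx => by
      have hx' : φ x = 0 := hx
      exact ⟨show φ (a * x) = 0 by rw [map_mul, hx', mul_zero],
        show φ (x * a) = 0 by rw [map_mul, hx', zero_mul]⟩⟩

variable {S : Type u} [NonUnitalCStarAlgebra S] (φ : S →⋆ₙₐ[ℂ] Q)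

theorem NonUnitalStarAlgHom.mem_kerIdeal {s : S} : s ∈ φ.kerIdeal.1 ↔ φ s = 0 := Iff.rfl

/-- The injection of the quotient by the kernel, as a linear map. -/
def NonUnitalStarAlgHom.kerLiftₗ : φ.kerIdeal.Quot →ₗ[ℂ] Q :=
  φ.kerIdeal.1.liftQ
    { toFun := φ, map_add' := map_add φ, map_smul' := fun c x => map_smul φ c x } fun _ hs => hs

/-- The injection of the quotient by the kernel. -/
def NonUnitalStarAlgHom.kerLift : φ.kerIdeal.Quot →⋆ₙₐ[ℂ] Q where
  toFun := φ.kerLiftₗ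
  map_smul' := map_smul φ.kerLiftₗ
  map_zero' := map_zero φ.kerLiftₗ
  map_add' := map_add φ.kerLiftₗ
  map_mul' x y := by
    obtain ⟨a, rfl⟩ := φ.kerIdeal.mkₗ_surjective x
    obtain ⟨b, rfl⟩ := φ.kerIdeal.mkₗ_surjective y
    exact map_mul φ a b
  map_star' x := by
    obtain ⟨a, rfl⟩ := φ.kerIdeal.mkₗ_surjective x
    exact map_star φ a

theorem NonUnitalStarAlgHom.kerLift_mkₗ (s : S) : φ.kerLift (φ.kerIdeal.mkₗ s) = φ s := rfl

theorem NonUnitalStarAlgHom.kerLift_injective : Function.Injective φ.kerLift := by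
  intro x y h
  obtain ⟨a, rfl⟩ := φ.kerIdeal.mkₗ_surjective x
  obtain ⟨b, rfl⟩ := φ.kerIdeal.mkₗ_surjective y
  rw [kerLift_mkₗ, kerLift_mkₗ] at h
  rw [ClosedIdeal.mkₗ_eq_mkₗ, mem_kerIdeal, map_sub, h, sub_self]

/-- Elements of the range of a ⋆-homomorphism have preimages of almost the same norm. -/
theorem NonUnitalStarAlgHom.exists_norm_lt (s : S) {ε : ℝ} (hε : 0 < ε) :
    ∃ s', φ s' = φ s ∧ ‖s'‖ < ‖φ s‖ + ε := by
  obtain ⟨s', h1, h2⟩ := φ.kerIdeal.exists_norm_lt (φ.kerIdeal.mkₗ s) hε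
  refine ⟨s', by rw [← kerLift_mkₗ, h1, kerLift_mkₗ], ?_⟩
  rwa [← NonUnitalStarAlgHom.norm_map φ.kerLift φ.kerLift_injective, kerLift_mkₗ] at h2

/-- The range is that of the injective, hence isometric, map from the complete quotient by the
kernel. -/
theorem NonUnitalStarAlgHom.isClosed_range : IsClosed (Set.range φ) := by
  have h : Set.range φ = Set.range φ.kerLift := by
    ext y
    constructor
    · rintro ⟨s, rfl⟩
      exact ⟨φ.kerIdeal.mkₗ s, rfl⟩
    · rintro ⟨x, rfl⟩
      obtain ⟨a, rfl⟩ := φ.kerIdeal.mkₗ_surjective x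
      exact ⟨a, rfl⟩
  rw [h]
  exact (NonUnitalStarAlgHom.isometry φ.kerLift φ.kerLift_injective).isClosedEmbedding.isClosed_range

end Kernel

/-! ### Sums of a subalgebra and an ideal -/

section Sum

variable {B : Type u} [NonUnitalCStarAlgebra B]

/-- The sum of a ⋆-subalgebra and a ⋆-subalgebra absorbing it. -/
def NonUnitalStarSubalgebra.addOfAbsorbs (E N : NonUnitalStarSubalgebra ℂ B)
    (h : ∀ x ∈ E, ∀ y ∈ N, x * y ∈ N) : NonUnitalStarSubalgebra ℂ B where
  carrier := {z | ∃ x ∈ E, ∃ y ∈ N, z = x + y}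
  add_mem' := by
    rintro _ _ ⟨x, hx, y, hy, rfl⟩ ⟨x', hx', y', hy', rfl⟩
    exact ⟨x + x', E.add_mem hx hx', y + y', N.add_mem hy hy', by abel⟩
  zero_mem' := ⟨0, E.zero_mem, 0, N.zero_mem, by simp⟩
  smul_mem' := by
    rintro c _ ⟨x, hx, y, hy, rfl⟩
    exact ⟨c • x, E.smul_mem' c hx, c • y, N.smul_mem' c hy, smul_add _ _ _⟩
  mul_mem' := by
    rintro _ _ ⟨x, hx, y, hy, rfl⟩ ⟨x', hx', y', hy', rfl⟩
    refine ⟨x * x', E.mul_mem hx hx', x * y' + y * x' + y * y',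
      N.add_mem (N.add_mem (h x hx _ hy') ?_) (N.mul_mem hy hy'), by noncomm_ring⟩
    simpa using star_mem (h _ (star_mem hx') _ (star_mem hy))
  star_mem' := by
    rintro _ ⟨x, hx, y, hy, rfl⟩
    exact ⟨star x, star_mem hx, star y, star_mem hy, star_add _ _⟩

instance (S : NonUnitalStarSubalgebra ℂ B) : IsClosed (S.topologicalClosure : Set B) :=
  S.isClosed_topologicalClosure

/-- A closed ⋆-subalgebra absorbed by a ⋆-subalgebra `S` containing it, as an ideal of the closure
of `S`. -/
def ClosedIdeal.ofAbsorbs (S N : NonUnitalStarSubalgebra ℂ B) (hN : IsClosed (N : Set B))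
    (h : ∀ x ∈ S, ∀ y ∈ N, x * y ∈ N) : ClosedIdeal S.topologicalClosure :=
  ⟨{ carrier := {x | (x : B) ∈ N}
     add_mem' := fun ha hb => N.add_mem ha hb
     zero_mem' := N.zero_mem
     smul_mem' := fun c _ ha => N.smul_mem' c ha },
    hN.preimage continuous_subtype_val, by
    have key : ∀ x ∈ S.topologicalClosure, ∀ y ∈ N, x * y ∈ N := fun x hx y hy =>
      closure_minimal (s := (S : Set B)) (t := {x | x * y ∈ N}) (fun x hx => h x hx y hy)
        (hN.preimage (continuous_id.mul continuous_const)) hx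
    rintro ⟨a, ha⟩ ⟨x, hx'⟩ (hx : x ∈ N)
    refine ⟨key a ha x hx, show x * a ∈ N from ?_⟩
    simpa using StarMemClass.star_mem (key _ (StarMemClass.star_mem ha) _ (StarMemClass.star_mem hx))⟩

variable {E N : NonUnitalStarSubalgebra ℂ B}

/-- `N` is an ideal of the closure of `E + N`, and the image of `E` in the quotient is closed as the
range of a ⋆-homomorphism. A limit of elements of `E + N` therefore agrees with some element of `E`
modulo `N`. -/
theorem NonUnitalStarSubalgebra.isClosed_addOfAbsorbs (hE : IsClosed (E : Set B))
    (hN : IsClosed (N : Set B)) (h : ∀ x ∈ E, ∀ y ∈ N, x * y ∈ N) :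
    IsClosed (E.addOfAbsorbs N h : Set B) := by
  set S := E.addOfAbsorbs N h with hS
  have hSN : ∀ x ∈ S, ∀ y ∈ N, x * y ∈ N := by
    rintro _ ⟨x, hx, y, hy, rfl⟩ z hz
    rw [add_mul]
    exact N.add_mem (h x hx z hz) (N.mul_mem hy hz)
  let I := ClosedIdeal.ofAbsorbs S N hN hSN
  have hES : E ≤ S.topologicalClosure := fun x hx =>
    subset_closure ⟨x, hx, 0, N.zero_mem, (add_zero x).symm⟩
  let _ : NonUnitalCStarAlgebra E :=
    NonUnitalStarSubalgebra.nonUnitalCStarAlgebra E (h_closed := hE)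
  let φ : E →⋆ₙₐ[ℂ] I.Quot := I.mk.comp (NonUnitalStarSubalgebra.inclusion hES)
  have hcl := φ.isClosed_range
  refine isClosed_of_closure_subset fun x hx => ?_
  have hx1 : I.mk ⟨x, hx⟩ ∈ closure (Set.range φ) := by
    have h1 : (⟨x, hx⟩ : S.topologicalClosure) ∈ closure (Subtype.val ⁻¹' (S : Set B)) := by
      rw [closure_subtype]
      refine closure_mono ?_ hx
      intro y hy
      exact ⟨⟨y, subset_closure hy⟩, hy, rfl⟩
    refine map_mem_closure I.mk.continuous_of_cstar h1 ?_
    rintro ⟨y, hy'⟩ ⟨e, he, n, hn, (rfl : y = _)⟩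
    refine ⟨⟨e, he⟩, ?_⟩
    refine (I.mkₗ_eq_mkₗ).2 (show e - (e + n) ∈ N from ?_)
    rw [sub_add_cancel_left]
    exact neg_mem hn
  rw [hcl.closure_eq] at hx1
  obtain ⟨⟨e, he⟩, hex⟩ := hx1
  have : e - x ∈ N := (I.mkₗ_eq_mkₗ).1 hex
  refine ⟨e, he, x - e, ?_, by abel⟩
  rw [← neg_sub]
  exact neg_mem this

/-- As `E ∩ N = 0`, the map from `E` to the quotient by `N` is injective, hence isometric, and `x +
y` represents the image of `x`. -/
theorem NonUnitalStarSubalgebra.norm_le_norm_add (hE : IsClosed (E : Set B))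
    (hN : IsClosed (N : Set B)) (h : ∀ x ∈ E, ∀ y ∈ N, x * y ∈ N)
    (h0 : ∀ x ∈ E, x ∈ N → x = 0) {x y : B} (hx : x ∈ E) (hy : y ∈ N) : ‖x‖ ≤ ‖x + y‖ := by
  set S := E.addOfAbsorbs N h with hS
  have hSN : ∀ x ∈ S, ∀ y ∈ N, x * y ∈ N := by
    rintro _ ⟨x, hx, y, hy, rfl⟩ z hz
    rw [add_mul]
    exact N.add_mem (h x hx z hz) (N.mul_mem hy hz)
  let I := ClosedIdeal.ofAbsorbs S N hN hSN
  have hES : E ≤ S.topologicalClosure := fun x hx =>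
    subset_closure ⟨x, hx, 0, N.zero_mem, (add_zero x).symm⟩
  let _ : NonUnitalCStarAlgebra E :=
    NonUnitalStarSubalgebra.nonUnitalCStarAlgebra E (h_closed := hE)
  let φ : E →⋆ₙₐ[ℂ] I.Quot := I.mk.comp (NonUnitalStarSubalgebra.inclusion hES)
  have hφ : Function.Injective φ := by
    rintro ⟨a, ha⟩ ⟨b, hb⟩ hab
    have : a - b ∈ N := (I.mkₗ_eq_mkₗ).1 hab
    exact Subtype.ext (sub_eq_zero.1 (h0 _ (E.sub_mem ha hb) this))
  have h1 : φ ⟨x, hx⟩ = I.mkₗ ⟨x + y, subset_closure ⟨x, hx, y, hy, rfl⟩⟩ := by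
    refine (I.mkₗ_eq_mkₗ).2 (show x - (x + y) ∈ N from ?_)
    rw [sub_add_cancel_left]
    exact neg_mem hy
  have h2 := NonUnitalStarAlgHom.norm_map φ hφ ⟨x, hx⟩
  calc ‖x‖ = ‖φ ⟨x, hx⟩‖ := h2.symm
    _ ≤ _ := by rw [h1]; exact I.norm_mkₗ_le _

end Sum

/-! ### Lifting small elements -/

section Lift

variable {B : Type u} [NonUnitalCStarAlgebra B]

/-- If an element `y` of a C⋆-subalgebra `S ⊆ A` is close to an ideal `K` of `A`, then it is equal to
a small element of `S` modulo `K`. -/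
theorem exists_sub_mem_norm_lt {A S : NonUnitalStarSubalgebra ℂ B} (hA : IsClosed (A : Set B))
    (hS : IsClosed (S : Set B)) (hSA : S ≤ A) {K : Submodule ℂ B} (hK : IsClosed (K : Set B))
    (hmul : ∀ a ∈ A, ∀ x ∈ K, a * x ∈ K ∧ x * a ∈ K) {x y : B} (hy : y ∈ S) (hx : x ∈ K)
    (hxA : x ∈ A) {ε : ℝ} (hε : ‖y - x‖ < ε) : ∃ y' ∈ S, y - y' ∈ K ∧ ‖y'‖ < ε := by
  let _ : NonUnitalCStarAlgebra A :=
    NonUnitalStarSubalgebra.nonUnitalCStarAlgebra A (h_closed := hA)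
  let _ : NonUnitalCStarAlgebra S :=
    NonUnitalStarSubalgebra.nonUnitalCStarAlgebra S (h_closed := hS)
  let I : ClosedIdeal A :=
    ⟨{ carrier := {a | (a : B) ∈ K}
       add_mem' := fun ha hb => K.add_mem ha hb
       zero_mem' := K.zero_mem
       smul_mem' := fun c _ ha => K.smul_mem c ha },
      hK.preimage continuous_subtype_val, fun a x hx => hmul a a.2 x hx⟩
  let φ : S →⋆ₙₐ[ℂ] I.Quot := I.mk.comp (NonUnitalStarSubalgebra.inclusion hSA)
  have h1 : ‖φ ⟨y, hy⟩‖ ≤ ‖y - x‖ := by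
    have : φ ⟨y, hy⟩ = I.mkₗ ⟨y - x, A.sub_mem (hSA hy) hxA⟩ := by
      refine (I.mkₗ_eq_mkₗ).2 (show y - (y - x) ∈ K from ?_)
      rwa [sub_sub_cancel]
    rw [this]
    exact I.norm_mkₗ_le _
  obtain ⟨⟨y', hy'⟩, h2, h3⟩ := φ.exists_norm_lt ⟨y, hy⟩ (sub_pos.2 (h1.trans_lt hε))
  refine ⟨y', hy', (I.mkₗ_eq_mkₗ).1 h2.symm, ?_⟩
  rwa [add_sub_cancel] at h3

end Lift

/-! ### Sums of consecutive shifts -/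

section Segments

variable {B : Type u} [NonUnitalCStarAlgebra B] {σ : B ≃⋆ₐ[ℂ] B}

theorem single_mul_single_zpow {E : NonUnitalStarSubalgebra ℂ B} (h : AbsorbsShifts σ E) {x y : B}
    (hx : x ∈ E) (hy : y ∈ E) (i j : ℤ) :
    ∃ z ∈ E, (σ ^ i) x * (σ ^ j) y = (σ ^ max i j) z := by
  rcases le_total i j with hij | hij
  · rw [max_eq_right hij]
    exact h.single_mul_single_of_le hx hy hij
  · obtain ⟨z, hz, e⟩ := h.single_mul_single_of_le (star_mem hy) (star_mem hx) hij
    rw [max_eq_left hij]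
    refine ⟨star z, star_mem hz, ?_⟩
    rw [map_star, ← e, star_mul, map_star, map_star, star_star, star_star]

variable (σ) in
/-- The linear space `σᵏ(E) + ⋯ + σᵏ⁺ⁿ⁻¹(E)`. -/
def segmentSum (E : NonUnitalStarSubalgebra ℂ B) (k : ℤ) (n : ℕ) : Submodule ℂ B where
  carrier := {x | ∃ d : ℕ → B, (∀ i, d i ∈ E) ∧ x = ∑ i ∈ Finset.range n, (σ ^ (k + i)) (d i)}
  add_mem' := by
    rintro _ _ ⟨d, hd, rfl⟩ ⟨e, he, rfl⟩
    refine ⟨fun i => d i + e i, fun i => E.add_mem (hd i) (he i), ?_⟩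
    rw [← Finset.sum_add_distrib]
    exact Finset.sum_congr rfl fun i _ => (map_add _ _ _).symm
  zero_mem' := ⟨fun _ => 0, fun _ => E.zero_mem, by simp⟩
  smul_mem' := by
    rintro c _ ⟨d, hd, rfl⟩
    refine ⟨fun i => c • d i, fun i => E.smul_mem' c (hd i), ?_⟩
    rw [Finset.smul_sum]
    exact Finset.sum_congr rfl fun i _ => (map_smul _ _ _).symm

theorem single_mem_segmentSum {E : NonUnitalStarSubalgebra ℂ B} {x : B} (hx : x ∈ E) {k i : ℤ}
    {n : ℕ} (h1 : k ≤ i) (h2 : i < k + n) : (σ ^ i) x ∈ segmentSum σ E k n := by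
  classical
  refine ⟨fun j => if k + (j : ℤ) = i then x else 0, fun j => ?_, ?_⟩
  · dsimp only
    split_ifs
    · exact hx
    · exact E.zero_mem
  · rw [Finset.sum_eq_single (i - k).toNat]
    · have : k + ((i - k).toNat : ℤ) = i := by omega
      rw [this]
      dsimp only
      rw [if_pos this]
    · intro j _ hj
      have : k + (j : ℤ) ≠ i := by omega
      simp [this]
    · intro hi
      exact absurd (Finset.mem_range.2 (by omega)) hi

theorem segmentSum_le_of_single {E : NonUnitalStarSubalgebra ℂ B} {k : ℤ} {n : ℕ}
    {W : Submodule ℂ B} (h : ∀ x ∈ E, ∀ i : ℤ, k ≤ i → i < k + n → (σ ^ i) x ∈ W) :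
    segmentSum σ E k n ≤ W := by
  rintro _ ⟨d, hd, rfl⟩
  refine W.sum_mem fun i hi => h _ (hd i) _ (by omega) ?_
  have := Finset.mem_range.1 hi
  omega

theorem segmentSum_mono {E F : NonUnitalStarSubalgebra ℂ B} (hEF : E ≤ F) {k k' : ℤ} {n n' : ℕ}
    (h1 : k' ≤ k) (h2 : k + n ≤ k' + n') : segmentSum σ E k n ≤ segmentSum σ F k' n' :=
  segmentSum_le_of_single fun _ hx _ hi hi' =>
    single_mem_segmentSum (hEF hx) (by omega) (by omega)

theorem zpow_mem_segmentSum {E : NonUnitalStarSubalgebra ℂ B} {k : ℤ} {n : ℕ} {x : B}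
    (hx : x ∈ segmentSum σ E k n) (j : ℤ) : (σ ^ j) x ∈ segmentSum σ E (j + k) n := by
  obtain ⟨d, hd, rfl⟩ := hx
  refine ⟨d, hd, ?_⟩
  rw [map_sum]
  refine Finset.sum_congr rfl fun i _ => ?_
  rw [← StarAlgEquiv.mul_apply, ← zpow_add, add_assoc]

/-- A product of two terms sits at the larger of the two exponents. This is why the starting point
`p` is only required to be at most `max k l`; the segment starting later absorbs the other one. -/
theorem segmentSum_mul_mem {E : NonUnitalStarSubalgebra ℂ B} (h : AbsorbsShifts σ E) {k l : ℤ}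
    {m n : ℕ} {x y : B} (hx : x ∈ segmentSum σ E k m) (hy : y ∈ segmentSum σ E l n) {p : ℤ} {q : ℕ}
    (h1 : p ≤ max k l) (h2 : k + m ≤ p + q) (h3 : l + n ≤ p + q) :
    x * y ∈ segmentSum σ E p q := by
  obtain ⟨d, hd, rfl⟩ := hx
  obtain ⟨e, he, rfl⟩ := hy
  rw [Finset.sum_mul_sum]
  refine Submodule.sum_mem _ fun i hi => Submodule.sum_mem _ fun j hj => ?_
  obtain ⟨z, hz, e⟩ := single_mul_single_zpow h (hd i) (he j) (k + i) (l + j)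
  have := Finset.mem_range.1 hi
  have := Finset.mem_range.1 hj
  rw [e]
  exact single_mem_segmentSum hz (by omega) (by omega)

theorem star_mem_segmentSum {E : NonUnitalStarSubalgebra ℂ B} {k : ℤ} {n : ℕ} {x : B}
    (hx : x ∈ segmentSum σ E k n) : star x ∈ segmentSum σ E k n := by
  obtain ⟨d, hd, rfl⟩ := hx
  refine ⟨fun i => star (d i), fun i => star_mem (hd i), ?_⟩
  rw [star_sum]
  exact Finset.sum_congr rfl fun i _ => (map_star _ _).symm

variable (σ) in
/-- `σᵏ(E) + ⋯ + σᵏ⁺ⁿ⁻¹(E)` as a ⋆-subalgebra. -/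
def segmentAlgebra (E : NonUnitalStarSubalgebra ℂ B) (h : AbsorbsShifts σ E) (k : ℤ) (n : ℕ) :
    NonUnitalStarSubalgebra ℂ B where
  __ := segmentSum σ E k n
  mul_mem' hx hy := segmentSum_mul_mem h hx hy (le_max_left k k) le_rfl le_rfl
  star_mem' hx := star_mem_segmentSum hx

theorem mem_segmentAlgebra {E : NonUnitalStarSubalgebra ℂ B} {h : AbsorbsShifts σ E} {k : ℤ}
    {n : ℕ} {x : B} : x ∈ segmentAlgebra σ E h k n ↔ x ∈ segmentSum σ E k n := Iff.rfl

theorem mem_segmentSum_one {E : NonUnitalStarSubalgebra ℂ B} {k : ℤ} {x : B} :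
    x ∈ segmentSum σ E k 1 ↔ ∃ d ∈ E, x = (σ ^ k) d := by
  constructor
  · rintro ⟨d, hd, rfl⟩
    exact ⟨d 0, hd 0, by simp⟩
  · rintro ⟨d, hd, rfl⟩
    exact single_mem_segmentSum hd le_rfl (by simp)

theorem mem_segmentSum_succ {E : NonUnitalStarSubalgebra ℂ B} {k : ℤ} {n : ℕ} {x : B} :
    x ∈ segmentSum σ E k (n + 1) ↔
      ∃ y ∈ segmentSum σ E k 1, ∃ z ∈ segmentSum σ E (k + 1) n, x = y + z := by
  constructor
  · rintro ⟨d, hd, rfl⟩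
    refine ⟨(σ ^ k) (d 0), mem_segmentSum_one.2 ⟨_, hd 0, rfl⟩, _,
      ⟨fun i => d (i + 1), fun i => hd _, rfl⟩, ?_⟩
    rw [Finset.sum_range_succ', add_comm]
    congr 1
    · simp
    · refine Finset.sum_congr rfl fun i _ => ?_
      push_cast
      rw [add_assoc, add_comm (1 : ℤ)]
  · rintro ⟨y, hy, z, hz, rfl⟩
    exact Submodule.add_mem _ (segmentSum_mono le_rfl le_rfl (by push_cast; omega) hy)
      (segmentSum_mono le_rfl (by omega) (by push_cast; omega) hz)

/-- Induction on `n`: the remaining segment absorbs its lowest term `σᵏ(E)`, so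
`isClosed_addOfAbsorbs` applies. -/
theorem isClosed_segmentAlgebra {E : NonUnitalStarSubalgebra ℂ B} (h : AbsorbsShifts σ E)
    (hE : IsClosed (E : Set B)) (k : ℤ) (n : ℕ) :
    IsClosed (segmentAlgebra σ E h k n : Set B) := by
  have h1 (k : ℤ) : IsClosed (segmentAlgebra σ E h k 1 : Set B) := by
    have : (segmentAlgebra σ E h k 1 : Set B) = (σ ^ k) '' (E : Set B) := by
      ext x
      refine mem_segmentSum_one.trans ?_
      constructor
      · rintro ⟨d, hd, rfl⟩
        exact ⟨d, hd, rfl⟩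
      · rintro ⟨d, hd, rfl⟩
        exact ⟨d, hd, rfl⟩
    rw [this]
    exact (StarAlgEquiv.isometry (σ ^ k)).isClosedEmbedding.isClosedMap _ hE
  induction n generalizing k with
  | zero =>
    have : (segmentAlgebra σ E h k 0 : Set B) = {0} := by
      ext x
      constructor
      · rintro ⟨d, hd, rfl⟩
        simp
      · rintro rfl
        exact Submodule.zero_mem (segmentSum σ E k 0)
    rw [this]
    exact isClosed_singleton
  | succ n ih =>
    have habs : ∀ x ∈ segmentAlgebra σ E h k 1, ∀ y ∈ segmentAlgebra σ E h (k + 1) n,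
        x * y ∈ segmentAlgebra σ E h (k + 1) n := fun x hx y hy =>
      segmentSum_mul_mem h hx hy (le_max_right _ _) (by push_cast; omega) le_rfl
    have := NonUnitalStarSubalgebra.isClosed_addOfAbsorbs (h1 k) (ih (k + 1)) habs
    convert this using 1
    ext x
    exact mem_segmentSum_succ

theorem finiteShiftSums_eq (E : NonUnitalStarSubalgebra ℂ B) {x : B} :
    x ∈ finiteShiftSums σ E ↔ ∃ m : ℕ, x ∈ segmentSum σ E (-m) (2 * m) := by
  constructor
  · intro hx
    obtain ⟨m, d, hd, rfl⟩ := Set.mem_iUnion.1 hx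
    -- The exponents in `shiftSum` run from `-m - 1` to `m - 1`, whereas the segment for `m` starts
    -- at `-m`; hence `m + 1`.
    refine ⟨m + 1, Submodule.sum_mem _ fun i hi => ?_⟩
    have := Finset.mem_Icc.1 hi
    exact single_mem_segmentSum (hd i) (by push_cast; omega) (by push_cast; omega)
  · rintro ⟨m, hx⟩
    exact segmentSum_le_of_single (fun x hx i _ _ => single_mem_finiteShiftSums hx i) hx

theorem finiteShiftSums_le_of_single {E : NonUnitalStarSubalgebra ℂ B} {W : Submodule ℂ B}
    (h : ∀ x ∈ E, ∀ i : ℤ, (σ ^ i) x ∈ W) : finiteShiftSums σ E ≤ W := fun x hx => by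
  obtain ⟨m, hx⟩ := (finiteShiftSums_eq E).1 hx
  exact segmentSum_le_of_single (fun x hx i _ _ => h x hx i) hx

theorem segmentSum_le_sigmaAlgebra {E : NonUnitalStarSubalgebra ℂ B} (h : AbsorbsShifts σ E)
    {k : ℤ} {n : ℕ} {x : B} (hx : x ∈ segmentSum σ E k n) : x ∈ sigmaAlgebra σ E h :=
  subset_closure
    (segmentSum_le_of_single (fun _ hx i _ _ => single_mem_finiteShiftSums hx i) hx)

theorem single_mem_sigmaAlgebra {E : NonUnitalStarSubalgebra ℂ B} (h : AbsorbsShifts σ E)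
    {x : B} (hx : x ∈ E) (i : ℤ) : (σ ^ i) x ∈ sigmaAlgebra σ E h :=
  subset_closure (single_mem_finiteShiftSums hx i)

/-- Elements of `E_σ` are approximated by elements of `σ⁻ᵐ(E) + ⋯ + σᵐ⁻¹(E)`. -/
theorem exists_segmentSum_norm_lt {E : NonUnitalStarSubalgebra ℂ B} (h : AbsorbsShifts σ E)
    {x : B} (hx : x ∈ sigmaAlgebra σ E h) {ε : ℝ} (hε : 0 < ε) :
    ∃ m : ℕ, ∃ y ∈ segmentSum σ E (-m) (2 * m), ‖x - y‖ < ε := by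
  obtain ⟨y, hy, hxy⟩ := Metric.mem_closure_iff.1 hx ε hε
  obtain ⟨m, hm⟩ := (finiteShiftSums_eq E).1 (show y ∈ finiteShiftSums σ E from hy)
  exact ⟨m, y, hm, by rwa [← dist_eq_norm]⟩

variable (σ) in
/-- The linear space `∑_{i ≥ m} σⁱ(E)`. -/
def tailSum (E : NonUnitalStarSubalgebra ℂ B) (m : ℤ) : Submodule ℂ B where
  carrier := {x | ∃ n : ℕ, x ∈ segmentSum σ E m n}
  add_mem' := by
    rintro x y ⟨n, hx⟩ ⟨n', hy⟩
    exact ⟨n + n', Submodule.add_mem _ (segmentSum_mono le_rfl le_rfl (by push_cast; omega) hx)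
      (segmentSum_mono le_rfl le_rfl (by push_cast; omega) hy)⟩
  zero_mem' := ⟨0, Submodule.zero_mem _⟩
  smul_mem' := fun c _ ⟨n, hx⟩ => ⟨n, Submodule.smul_mem _ c hx⟩

variable (σ) in
/-- The closure of `∑_{i ≥ m} σⁱ(E)`. -/
def tailAlgebra (E : NonUnitalStarSubalgebra ℂ B) (h : AbsorbsShifts σ E) (m : ℤ) :
    NonUnitalStarSubalgebra ℂ B :=
  NonUnitalStarSubalgebra.topologicalClosure
    { tailSum σ E m with
      mul_mem' := fun {x y} ⟨n, hx⟩ ⟨n', hy⟩ => ⟨n + n', segmentSum_mul_mem h hx hy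
        (le_max_left _ _) (by push_cast; omega) (by push_cast; omega)⟩
      star_mem' := fun ⟨n, hx⟩ => ⟨n, star_mem_segmentSum hx⟩ }

theorem isClosed_tailAlgebra (E : NonUnitalStarSubalgebra ℂ B) (h : AbsorbsShifts σ E) (m : ℤ) :
    IsClosed (tailAlgebra σ E h m : Set B) := isClosed_closure

variable {E : NonUnitalStarSubalgebra ℂ B} (h : AbsorbsShifts σ E)

theorem tailAlgebra_le_sigmaAlgebra (m : ℤ) : tailAlgebra σ E h m ≤ sigmaAlgebra σ E h :=
  fun _ hx => closure_minimal (s := (tailSum σ E m : Set B)) (fun _ ⟨_, hy⟩ => segmentSum_le_sigmaAlgebra h hy)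
    (sigmaAlgebra_isClosed E h) hx

theorem segmentSum_le_tailAlgebra {m : ℤ} {n : ℕ} {x : B} (hx : x ∈ segmentSum σ E m n) :
    x ∈ tailAlgebra σ E h m := subset_closure ⟨n, hx⟩

theorem zpow_mem_tailAlgebra {m : ℤ} {x : B} (hx : x ∈ tailAlgebra σ E h m) (j : ℤ) :
    (σ ^ j) x ∈ tailAlgebra σ E h (j + m) :=
  map_mem_closure (StarAlgEquiv.isometry (σ ^ j)).continuous hx
    fun _ ⟨n, hy⟩ => ⟨n, zpow_mem_segmentSum hy j⟩

theorem tailAlgebra_anti {m m' : ℤ} (hm : m ≤ m') : tailAlgebra σ E h m' ≤ tailAlgebra σ E h m :=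
  fun _ hx => closure_mono (s := (tailSum σ E m' : Set B)) (t := (tailSum σ E m : Set B)) (fun _ ⟨n, hy⟩ =>
    ⟨n + (m' - m).toNat, segmentSum_mono le_rfl hm (by push_cast; omega) hy⟩) hx

/-- Multiplication never lowers the exponent, so each tail is an ideal of `E_σ`. -/
theorem sigmaAlgebra_mul_tailAlgebra {m : ℤ} {x y : B} (hx : x ∈ sigmaAlgebra σ E h)
    (hy : y ∈ tailAlgebra σ E h m) : x * y ∈ tailAlgebra σ E h m := by
  refine map_mem_closure₂ continuous_mul hx hy fun a ha b hb => ?_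
  obtain ⟨n, hn⟩ := (finiteShiftSums_eq E).1 (show a ∈ finiteShiftSums σ E from ha)
  obtain ⟨n', hn'⟩ := hb
  -- Starting at `m`, the segment must reach both `m + n'` and `n`, the upper ends of the two
  -- factors.
  refine ⟨n' + n + (n - m).toNat, segmentSum_mul_mem h hn hn' (le_max_right _ _) ?_ ?_⟩ <;>
  push_cast <;> omega

theorem tailAlgebra_mul_sigmaAlgebra {m : ℤ} {x y : B} (hx : x ∈ tailAlgebra σ E h m)
    (hy : y ∈ sigmaAlgebra σ E h) : x * y ∈ tailAlgebra σ E h m := by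
  simpa using star_mem (sigmaAlgebra_mul_tailAlgebra h (star_mem hy) (star_mem hx))

end Segments

/-! ### Invariant ideals of `D_σ` and cancellation -/

section InvariantIdeals

variable {B : Type u} [NonUnitalCStarAlgebra B] {σ : B ≃⋆ₐ[ℂ] B}

variable (σ) in
/-- `K` is a `σ`-invariant closed ideal of the subalgebra `A`. -/
structure IsInvariantIdeal (A : NonUnitalStarSubalgebra ℂ B) (K : Submodule ℂ B) : Prop where
  closed : IsClosed (K : Set B)
  mem : ∀ x ∈ K, x ∈ A
  mul : ∀ a ∈ A, ∀ x ∈ K, a * x ∈ K ∧ x * a ∈ K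
  zpow : ∀ x ∈ K, ∀ j : ℤ, (σ ^ j) x ∈ K

set_option linter.unusedSectionVars false

variable {D : NonUnitalStarSubalgebra ℂ B} [hDcl : IsClosed (D : Set B)]

theorem ClosedIdeal.mem_toSubalgebra {J : ClosedIdeal D} {x : D} :
    (x : B) ∈ J.toSubalgebra ↔ x ∈ J.1 :=
  ⟨fun ⟨y, hy, e⟩ => by rwa [← Subtype.ext e], fun hx => ⟨x, hx, rfl⟩⟩

theorem ClosedIdeal.toSubalgebra_le (J : ClosedIdeal D) : J.toSubalgebra ≤ D := by
  rintro _ ⟨x, -, rfl⟩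
  exact x.2

theorem ClosedIdeal.isClosed_toSubalgebra (J : ClosedIdeal D) :
    IsClosed (J.toSubalgebra : Set B) :=
  (‹IsClosed (D : Set B)›.isClosedEmbedding_subtypeVal).isClosedMap _ J.2.1

namespace IsInvariantIdeal

variable {hD : AbsorbsShifts σ D} {K : Submodule ℂ B}

/-- The ideal `K ∩ D` of `D`. -/
def restrict (hK : IsInvariantIdeal σ (sigmaAlgebra σ D hD) K) : ClosedIdeal D :=
  ⟨{ carrier := {x | (x : B) ∈ K}
     add_mem' := fun ha hb => K.add_mem ha hb
     zero_mem' := K.zero_mem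
     smul_mem' := fun c _ ha => K.smul_mem c ha },
    hK.closed.preimage continuous_subtype_val, fun a x hx =>
      hK.mul a (le_sigmaAlgebra D hD a.2) x hx⟩

variable (hK : IsInvariantIdeal σ (sigmaAlgebra σ D hD) K)

theorem mem_restrict_toSubalgebra {x : B} :
    x ∈ hK.restrict.toSubalgebra ↔ x ∈ D ∧ x ∈ K :=
  ⟨fun ⟨y, hy, e⟩ => e ▸ ⟨y.2, hy⟩, fun ⟨h1, h2⟩ => ⟨⟨x, h1⟩, h2, rfl⟩⟩

include hK in
theorem zpow_mem_iff {x : B} (j : ℤ) : (σ ^ j) x ∈ K ↔ x ∈ K := by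
  refine ⟨fun h => ?_, fun h => hK.zpow x h j⟩
  have := hK.zpow _ h (-j)
  rwa [← StarAlgEquiv.mul_apply, ← zpow_add, neg_add_cancel, zpow_zero] at this

/-- `x σ(d)` is `σ(z)` with `z ∈ D`; it lies in `K`, and invariance of `K` under `σ⁻¹` puts `z` in
`K`. -/
theorem restrict_isSemiInvariant : IsSemiInvariant σ hK.restrict := by
  intro x hx d
  obtain ⟨z, hz, e⟩ := hD 1 x x.2 d d.2
  rw [pow_one] at e
  refine ⟨z, hK.mem_restrict_toSubalgebra.2 ⟨hz, ?_⟩, e.symm⟩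
  rw [← hK.zpow_mem_iff 1, zpow_one, ← e]
  have hd : σ (d : B) ∈ sigmaAlgebra σ D hD := by
    simpa using single_mem_sigmaAlgebra hD d.2 1
  exact (hK.mul _ hd _ hx).2

include hK in
/-- The summands of an element of `K` of the form `∑ σⁱ(dᵢ)` lie in `K`. -/
theorem mem_of_sum_mem (hc : IsCancellative σ hK.restrict) (n : ℕ) :
    ∀ (k : ℤ) (d : ℕ → B), (∀ i, d i ∈ D) →
      ∑ i ∈ Finset.range n, (σ ^ (k + i)) (d i) ∈ K → ∀ i < n, d i ∈ K := by
  induction n with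
  | zero => intro k d hd h i hi; omega
  | succ n ih =>
    intro k d hd h
    -- By invariance of `K` the lowest exponent may be taken to be `0`.
    have h' : ∑ i ∈ Finset.range (n + 1), (σ ^ (i : ℤ)) (d i) ∈ K := by
      rw [← hK.zpow_mem_iff k, map_sum]
      simpa only [zpow_add, StarAlgEquiv.mul_apply] using h
    have key : d 0 ∈ K := by
      cases n with
      | zero => simpa using h'
      | succ n =>
        -- Cancellativity reduces `d 0 ∈ K` to a statement about `(d 0 + σ (d 1)) σ(e)`, a single
        -- element of `σ(D)`. Multiplying the whole sum by `σ(e)` keeps the exponents from `2` on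
        -- and merges exponents `0` and `1`, leaving one term fewer.
        refine hc ⟨d 0, hd 0⟩ ⟨d 1, hd 1⟩ fun e => ?_
        obtain ⟨z, hz, hze⟩ := hD 1 _ (hd 0) _ e.2
        rw [pow_one] at hze
        have hstep : ∀ i : ℕ, ∃ c ∈ D, (σ ^ ((i + 2 : ℕ) : ℤ)) (d (i + 2)) * σ e =
            (σ ^ ((i + 2 : ℕ) : ℤ)) c := by
          intro i
          obtain ⟨c, hc, hce⟩ := single_mul_single_zpow hD (hd (i + 2)) e.2 ((i + 2 : ℕ) : ℤ) 1
          rw [zpow_one, max_eq_left (by push_cast; omega)] at hce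
          exact ⟨c, hc, hce⟩
        choose c hc hce using hstep
        let c' : ℕ → B := fun i => Nat.casesOn i (z + d 1 * e) c
        have hc' : ∀ i, c' i ∈ D := by
          intro i
          cases i with
          | zero => exact D.add_mem hz (D.mul_mem (hd 1) e.2)
          | succ i => exact hc i
        have hfirst : (d 0 + σ (d 1)) * σ e = σ (c' 0) := by
          change _ = σ (z + d 1 * e)
          rw [map_add, map_mul, ← hze, add_mul]
        have hσe : σ (e : B) ∈ sigmaAlgebra σ D hD := by
          simpa using single_mem_sigmaAlgebra hD e.2 1
        have hsum : ∑ i ∈ Finset.range (n + 1), (σ ^ (1 + (i : ℤ))) (c' i) ∈ K := by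
          have := (hK.mul _ hσe _ h').2
          convert this using 1
          rw [Finset.sum_range_succ', Finset.sum_range_succ' _ (n + 1), Finset.sum_range_succ',
            add_assoc, add_mul, Finset.sum_mul]
          congr 1
          · refine Finset.sum_congr rfl fun i _ => ?_
            rw [hce]
            congr 2
            push_cast; ring
          · simp only [Nat.cast_zero, add_zero, zpow_one, zero_add, Nat.cast_one, zpow_zero]
            rw [← hfirst, add_comm (d 0)]
            rfl
        have h0 := ih 1 c' hc' hsum 0 (by omega)
        exact ⟨c' 0, hK.mem_restrict_toSubalgebra.2 ⟨hc' 0, h0⟩, hfirst.symm⟩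
    rw [Finset.sum_range_succ'] at h'
    have h2 := K.sub_mem h' (by simpa using key : (σ ^ ((0 : ℕ) : ℤ)) (d 0) ∈ K)
    rw [add_sub_cancel_right] at h2
    intro i hi
    cases i with
    | zero => exact key
    | succ i =>
      refine ih 1 (fun i => d (i + 1)) (fun i => hd _) ?_ i (by omega)
      convert h2 using 4
      push_cast; ring

include hK in
/-- An invariant ideal `K` of `D_σ` with cancellative `K ∩ D` is contained in `(K ∩ D)_σ`. -/
theorem mem_sigmaAlgebra_restrict (hc : IsCancellative σ hK.restrict)
    (hJ : AbsorbsShifts σ hK.restrict.toSubalgebra) {x : B} (hx : x ∈ K) :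
    x ∈ sigmaAlgebra σ hK.restrict.toSubalgebra hJ := by
  refine Metric.mem_closure_iff.2 fun ε hε => ?_
  obtain ⟨m, y, hy, hxy⟩ := exists_segmentSum_norm_lt hD (hK.mem x hx) (half_pos hε)
  have hxy' : ‖y - x‖ < ε / 2 := by rwa [norm_sub_rev]
  -- The approximant `y` is small modulo `K`; subtracting a small lift `y'` inside the same segment
  -- moves it into `K`, where independence of the summands applies.
  obtain ⟨y', hy', hyK, hn⟩ := exists_sub_mem_norm_lt (sigmaAlgebra_isClosed D hD)
    (isClosed_segmentAlgebra hD hDcl (-m) (2 * m))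
    (fun _ h => segmentSum_le_sigmaAlgebra hD h) hK.closed hK.mul
    (mem_segmentAlgebra.2 hy) hx (hK.mem x hx) hxy'
  refine ⟨y - y', ?_, ?_⟩
  · obtain ⟨d, hd, hde⟩ := Submodule.sub_mem _ hy hy'
    rw [hde] at hyK ⊢
    have := hK.mem_of_sum_mem hc _ _ d hd hyK
    refine Submodule.sum_mem (finiteShiftSums σ hK.restrict.toSubalgebra) fun i hi => ?_
    exact single_mem_finiteShiftSums
      (hK.mem_restrict_toSubalgebra.2 ⟨hd i, this i (Finset.mem_range.1 hi)⟩) _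
  · rw [dist_eq_norm]
    calc ‖x - (y - y')‖ = ‖(x - y) + y'‖ := by congr 1; abel
      _ ≤ ‖x - y‖ + ‖y'‖ := norm_add_le _ _
      _ < ε := by linarith

-- The case `K = 0` of `mem_of_sum_mem` says that the subspaces `σⁱ(D)` are linearly independent.
variable (σ D hD) in
theorem bot : IsInvariantIdeal σ (sigmaAlgebra σ D hD) (⊥ : Submodule ℂ B) where
  closed := isClosed_singleton
  mem x hx := by
    rw [Submodule.mem_bot] at hx
    rw [hx]
    exact (sigmaAlgebra σ D hD).zero_mem
  mul a _ x hx := by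
    rw [Submodule.mem_bot] at hx
    simp [hx]
  zpow x hx j := by
    rw [Submodule.mem_bot] at hx
    simp [hx]

/-- The first summand is norm decreasing on `σᵏ(D) + σᵏ⁺¹(D) + ⋯`. -/
theorem norm_le_norm_add_segmentSum (hc : IsCancellative σ (bot σ D hD).restrict) {k : ℤ} {n : ℕ}
    {x y : B} (hx : x ∈ D) (hy : y ∈ segmentSum σ D (k + 1) n) :
    ‖(σ ^ k) x‖ ≤ ‖(σ ^ k) x + y‖ := by
  have habs : ∀ x ∈ segmentAlgebra σ D hD k 1, ∀ y ∈ segmentAlgebra σ D hD (k + 1) n,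
      x * y ∈ segmentAlgebra σ D hD (k + 1) n := fun x hx y hy =>
    segmentSum_mul_mem hD hx hy (le_max_right _ _) (by push_cast; omega) le_rfl
  refine NonUnitalStarSubalgebra.norm_le_norm_add (isClosed_segmentAlgebra hD hDcl k 1)
    (isClosed_segmentAlgebra hD hDcl (k + 1) n) habs ?_ (mem_segmentSum_one.2 ⟨x, hx, rfl⟩) hy
  intro z hz hz'
  obtain ⟨a, ha, rfl⟩ := mem_segmentSum_one.1 hz
  obtain ⟨d, hd, hde⟩ := hz'
  -- An element `σᵏ(a)` of the later segment yields a vanishing sum with lowest coefficient `-a`;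
  -- independence gives `a = 0`.
  let c : ℕ → B := fun i => Nat.casesOn i (-a) d
  have hcD : ∀ i, c i ∈ D := fun i => by
    cases i with
    | zero => exact neg_mem ha
    | succ i => exact hd i
  have := (bot σ D hD).mem_of_sum_mem hc (n + 1) k c hcD (by
    rw [Submodule.mem_bot, Finset.sum_range_succ']
    have : ∑ i ∈ Finset.range n, (σ ^ (k + ((i + 1 : ℕ) : ℤ))) (c (i + 1)) = (σ ^ k) a := by
      rw [hde]
      refine Finset.sum_congr rfl fun i _ => ?_
      push_cast
      rw [add_assoc, add_comm (1 : ℤ)]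
    rw [this]
    simp [c]) 0 (by omega)
  rw [Submodule.mem_bot] at this
  have ha0 : a = 0 := neg_eq_zero.1 this
  rw [ha0, map_zero]

include hK in
/-- An element of `D` which is approximately a sum of elements of `K` and of `∑_{i ≥ 1} σⁱ(D)`
lies in `K`. -/
theorem mem_of_approx (hc : IsCancellative σ hK.restrict)
    (hc0 : IsCancellative σ (bot σ D hD).restrict) {x : B} (hx : x ∈ D)
    (h : ∀ ε > 0, ∃ k ∈ K, ∃ t ∈ tailAlgebra σ D hD 1, ‖x - k - t‖ < ε) : x ∈ K := by
  refine hK.closed.closure_subset (Metric.mem_closure_iff.2 fun ε hε => ?_)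
  obtain ⟨k, hk, t, ht, hkt⟩ := h (ε / 2) (half_pos hε)
  obtain ⟨t', ⟨n, ht'⟩, htt⟩ := Metric.mem_closure_iff.1
    (show t ∈ closure (tailSum σ D 1 : Set B) from ht) (ε / 2) (half_pos hε)
  rw [dist_eq_norm] at htt
  have hx0 : x ∈ segmentSum σ D 0 1 := mem_segmentSum_one.2 ⟨x, hx, by simp⟩
  have ht0 : t' ∈ segmentSum σ D 0 (n + 1) :=
    segmentSum_mono le_rfl (by omega) (by push_cast; omega) ht'
  have hs : x - t' ∈ segmentSum σ D 0 (n + 1) := Submodule.sub_mem _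
    (segmentSum_mono le_rfl le_rfl (by push_cast; omega) hx0) ht0
  -- Now `x - t'` is a finite sum close to `k ∈ K`; it is corrected by a small `y'` so as to lie in
  -- `K`.
  obtain ⟨y', hy', hyK, hn⟩ := exists_sub_mem_norm_lt (sigmaAlgebra_isClosed D hD)
    (isClosed_segmentAlgebra hD hDcl 0 (n + 1))
    (fun _ h => segmentSum_le_sigmaAlgebra hD h) hK.closed hK.mul
    (mem_segmentAlgebra.2 hs) hk (hK.mem k hk) (ε := ε) (by
      calc ‖x - t' - k‖ = ‖(x - k - t) + (t - t')‖ := by congr 1; abel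
        _ ≤ ‖x - k - t‖ + ‖t - t'‖ := norm_add_le _ _
        _ < ε := by linarith)
  obtain ⟨d, hd, hde⟩ : y' ∈ segmentSum σ D 0 (n + 1) := hy'
  -- The coefficient of `x - t' - y'` at exponent `0` is `x - d 0`, so this lies in `K`. It is near
  -- `x` because passing to the lowest coefficient does not increase the norm.
  have hd0 : ‖d 0‖ ≤ ‖y'‖ := by
    rw [Finset.sum_range_succ'] at hde
    have := norm_le_norm_add_segmentSum (hD := hD) hc0 (k := 0) (n := n) (hd 0)
      (y := ∑ i ∈ Finset.range n, (σ ^ (0 + ((i + 1 : ℕ) : ℤ))) (d (i + 1)))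
      ⟨fun i => d (i + 1), fun i => hd _, Finset.sum_congr rfl fun i _ => by
        push_cast; congr 2; ring⟩
    rw [hde]
    simpa [add_comm] using this
  obtain ⟨e, he, hee⟩ := ht'
  let c : ℕ → B := fun i => Nat.casesOn i (x - d 0) fun i => - e i - d (i + 1)
  have hcD : ∀ i, c i ∈ D := fun i => by
    cases i with
    | zero => exact D.sub_mem hx (hd 0)
    | succ i => exact D.sub_mem (neg_mem (he i)) (hd _)
  have := hK.mem_of_sum_mem hc (n + 1) 0 c hcD (by
    convert hyK using 1
    rw [hde, hee, Finset.sum_range_succ', Finset.sum_range_succ']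
    have : ∀ i : ℕ, (σ ^ (0 + ((i + 1 : ℕ) : ℤ))) (c (i + 1)) =
        - (σ ^ (1 + (i : ℤ))) (e i) - (σ ^ (0 + ((i + 1 : ℕ) : ℤ))) (d (i + 1)) := by
      intro i
      change (σ ^ (0 + ((i + 1 : ℕ) : ℤ))) (- e i - d (i + 1)) = _
      rw [map_sub, map_neg]
      congr 4
      push_cast; ring
    simp only [this, Finset.sum_sub_distrib, Finset.sum_neg_distrib, c]
    simp
    abel) 0 (by omega)
  refine ⟨x - d 0, this, ?_⟩
  rw [dist_eq_norm, sub_sub_cancel]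
  exact hd0.trans_lt hn

end IsInvariantIdeal

theorem ClosedIdeal.mem_toSubalgebra_mul {J : ClosedIdeal D} {x y : B} (hx : x ∈ D)
    (hy : y ∈ J.toSubalgebra) : x * y ∈ J.toSubalgebra := by
  obtain ⟨z, hz, rfl⟩ := hy
  exact ⟨⟨x, hx⟩ * z, (J.2.2 _ z hz).1, rfl⟩

/-- Multiplication from the side of the lower exponent preserves any ideal `J`, semi-invariant or
not: with `x` approximated by `e x`, `e ∈ J`, the element `d σⁿ(e)` is some `σⁿ(z)` with `z ∈ D`,
and `z x ∈ J`. The image `σⁿ(J)` is closed. -/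
theorem IsHarnischKirchbergSystem.mul_zpow_ideal (hD : IsHarnischKirchbergSystem σ D)
    {J : ClosedIdeal D} (n : ℕ) {x d : B} (hd : d ∈ D)
    (hx : x ∈ J.toSubalgebra) : ∃ z ∈ J.toSubalgebra, d * (σ ^ n) x = (σ ^ n) z := by
  have hcl : IsClosed ((σ ^ n) '' (J.toSubalgebra : Set B)) :=
    (StarAlgEquiv.isometry (σ ^ n)).isClosedEmbedding.isClosedMap _ J.isClosed_toSubalgebra
  obtain ⟨l, hl, h1, h2, -⟩ := J.toSubalgebra.exists_approximateUnit J.isClosed_toSubalgebra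
  have ht : Tendsto (fun e => d * (σ ^ n) (e * x)) l (𝓝 (d * (σ ^ n) x)) :=
    tendsto_const_nhds.mul (((StarAlgEquiv.isometry (σ ^ n)).continuous.tendsto _).comp (h2 x hx))
  have hmem : d * (σ ^ n) x ∈ (σ ^ n) '' (J.toSubalgebra : Set B) := by
    refine hcl.mem_of_tendsto ht ?_
    filter_upwards [h1] with e ⟨he, _⟩
    obtain ⟨z, hz, hze⟩ := hD.absorbsShifts n d hd e (J.toSubalgebra_le he)
    exact ⟨z * x, ClosedIdeal.mem_toSubalgebra_mul hz hx, by
      rw [map_mul, map_mul, ← hze, mul_assoc]⟩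
  obtain ⟨z, hz, e⟩ := hmem
  exact ⟨z, hz, e.symm⟩

theorem IsHarnischKirchbergSystem.single_mul_single_ideal (hD : IsHarnischKirchbergSystem σ D)
    {J : ClosedIdeal D} (hJ : IsSemiInvariant σ J) {x d : B} (hd : d ∈ D)
    (hx : x ∈ J.toSubalgebra) (i j : ℤ) :
    ∃ z ∈ J.toSubalgebra, (σ ^ i) d * (σ ^ j) x = (σ ^ max i j) z := by
  rcases le_total i j with hij | hij
  · obtain ⟨n, rfl⟩ := Int.le.dest hij
    obtain ⟨z, hz, e⟩ := hD.mul_zpow_ideal n hd hx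
    refine ⟨z, hz, ?_⟩
    rw [max_eq_right hij, zpow_add, zpow_natCast, StarAlgEquiv.mul_apply, StarAlgEquiv.mul_apply,
      ← e, map_mul]
  -- Here the factor from `J` has the lower exponent. Semi-invariance handles multiplication on its
  -- right, so the product is treated through its adjoint.
  · obtain ⟨n, rfl⟩ := Int.le.dest hij
    obtain ⟨y, hy, hyx⟩ := star_mem hx
    obtain ⟨z, hz, e⟩ := hD.ideal_mul hJ n y hy ⟨star d, star_mem hd⟩
    refine ⟨star z, star_mem ⟨z, hz, rfl⟩, ?_⟩
    replace e := congrArg star e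
    change star ((y : B) * (σ ^ n) (star d)) = _ at e
    rw [star_mul, hyx, ← map_star, star_star, star_star, ← map_star] at e
    rw [max_eq_left hij, zpow_add, zpow_natCast, StarAlgEquiv.mul_apply, StarAlgEquiv.mul_apply,
      ← e, map_mul]

/-- By bilinearity and continuity the ideal property reduces to products of single terms, for which
`single_mul_single_ideal` suffices. -/
theorem IsHarnischKirchbergSystem.sigmaAlgebra_ideal (hD : IsHarnischKirchbergSystem σ D)
    {J : ClosedIdeal D} (hJ : IsSemiInvariant σ J) :
    IsInvariantIdeal σ (sigmaAlgebra σ D hD.absorbsShifts)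
      (sigmaAlgebra σ J.toSubalgebra (hD.absorbsShifts_ideal hJ)).toSubmodule := by
  have hmul : ∀ a ∈ sigmaAlgebra σ D hD.absorbsShifts,
      ∀ x ∈ sigmaAlgebra σ J.toSubalgebra (hD.absorbsShifts_ideal hJ),
      a * x ∈ sigmaAlgebra σ J.toSubalgebra (hD.absorbsShifts_ideal hJ) := by
    intro a ha x hx
    refine map_mem_closure₂ continuous_mul ha hx fun b hb y hy => ?_
    refine finiteShiftSums_le_of_single
      (W := (finiteShiftSums σ J.toSubalgebra).comap (LinearMap.mulRight ℂ y))
      (fun d hd i => ?_) (show b ∈ finiteShiftSums σ D from hb)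
    refine finiteShiftSums_le_of_single
      (W := (finiteShiftSums σ J.toSubalgebra).comap (LinearMap.mulLeft ℂ ((σ ^ i) d)))
      (fun z hz j => ?_) (show y ∈ finiteShiftSums σ J.toSubalgebra from hy)
    obtain ⟨c, hc, e⟩ := hD.single_mul_single_ideal hJ hd hz i j
    rw [Submodule.mem_comap, LinearMap.mulLeft_apply, e]
    exact single_mem_finiteShiftSums hc _
  exact
    { closed := sigmaAlgebra_isClosed J.toSubalgebra (hD.absorbsShifts_ideal hJ)
      mem := fun x hx => sigmaAlgebra_mono (hD.absorbsShifts_ideal hJ) hD.absorbsShifts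
        J.toSubalgebra_le hx
      mul := fun a ha x hx => ⟨hmul a ha x hx, by
        simpa using star_mem (hmul _ (star_mem ha) _ (star_mem hx))⟩
      zpow := fun x hx j => zpow_mem_sigmaAlgebra _ (hD.absorbsShifts_ideal hJ) hx j }

/-- `J_σ ∩ D = J`. -/
theorem IsHarnischKirchbergSystem.mem_of_mem_sigmaAlgebra (hD : IsHarnischKirchbergSystem σ D)
    {J : ClosedIdeal D} (hJ : IsSemiInvariant σ J)
    (hc : IsCancellative σ (IsInvariantIdeal.bot σ D hD.absorbsShifts).restrict) {x : B}
    (hx : x ∈ D) (hxJ : x ∈ sigmaAlgebra σ J.toSubalgebra (hD.absorbsShifts_ideal hJ)) :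
    x ∈ J.toSubalgebra := by
  refine J.isClosed_toSubalgebra.closure_subset (Metric.mem_closure_iff.2 fun ε hε => ?_)
  obtain ⟨m, y, hy, hxy⟩ := exists_segmentSum_norm_lt (hD.absorbsShifts_ideal hJ) hxJ hε
  have hJD := J.toSubalgebra_le
  -- The length `2 * m + 1` instead of `2 * m` ensures that exponent `0` occurs also for `m = 0`.
  have hDm : ∀ z ∈ D, z ∈ segmentSum σ D (-m) (2 * m + 1) := fun z hz => by
    simpa using single_mem_segmentSum (σ := σ) hz (k := -m) (n := 2 * m + 1) (i := 0)
      (by omega) (by push_cast; omega)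
  have hmulJ : ∀ a ∈ segmentAlgebra σ D hD.absorbsShifts (-m) (2 * m + 1),
      ∀ z ∈ segmentSum σ J.toSubalgebra (-m) (2 * m + 1),
      a * z ∈ segmentSum σ J.toSubalgebra (-m) (2 * m + 1) := by
    rintro _ ⟨d, hd, rfl⟩ _ ⟨e, he, rfl⟩
    rw [Finset.sum_mul_sum]
    refine Submodule.sum_mem _ fun i hi => Submodule.sum_mem _ fun j hj => ?_
    obtain ⟨z, hz, e⟩ := hD.single_mul_single_ideal hJ (hd i) (he j) (-m + i) (-m + j)
    have := Finset.mem_range.1 hi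
    have := Finset.mem_range.1 hj
    rw [e]
    exact single_mem_segmentSum hz (by omega) (by omega)
  have hy' : y ∈ segmentSum σ J.toSubalgebra (-m) (2 * m + 1) :=
    segmentSum_mono le_rfl le_rfl (by push_cast; omega) hy
  obtain ⟨x', hx', hxK, hn⟩ := exists_sub_mem_norm_lt
    (isClosed_segmentAlgebra hD.absorbsShifts hDcl (-m) (2 * m + 1)) hDcl hDm
    (isClosed_segmentAlgebra (hD.absorbsShifts_ideal hJ) J.isClosed_toSubalgebra (-m) (2 * m + 1))
    (fun a ha z hz => ⟨hmulJ a ha z hz, by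
      simpa using star_mem_segmentSum (hmulJ _ (star_mem ha) _ (star_mem_segmentSum hz))⟩)
    hx hy' (segmentSum_mono hJD le_rfl le_rfl hy') hxy
  refine ⟨x - x', ?_, by rwa [dist_eq_norm, sub_sub_cancel]⟩
  obtain ⟨d, hd, hde⟩ := hxK
  -- Position `m` carries exponent `0`. As `x - x'` is also a one-term sum at that exponent,
  -- independence identifies it with the coefficient `d m ∈ J`.
  let c : ℕ → B := fun i => if i = m then x - x' - d m else - d i
  have hcD : ∀ i, c i ∈ D := fun i => by
    dsimp only [c]
    split_ifs
    · exact D.sub_mem (D.sub_mem hx hx') (hJD (hd m))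
    · exact neg_mem (hJD (hd i))
  have := (IsInvariantIdeal.bot σ D hD.absorbsShifts).mem_of_sum_mem hc (2 * m + 1) (-m) c hcD (by
    rw [Submodule.mem_bot]
    have h1 : ∀ i : ℕ, (σ ^ (-(m : ℤ) + i)) (c i) =
        (if i = m then x - x' else 0) - (σ ^ (-(m : ℤ) + i)) (d i) := by
      intro i
      dsimp only [c]
      split_ifs with him
      · rw [him, neg_add_cancel, zpow_zero, map_sub]
        rfl
      · rw [map_neg, zero_sub]
    simp only [h1, Finset.sum_sub_distrib, ← hde, Finset.sum_ite_eq', Finset.mem_range]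
    rw [if_pos (by omega), sub_self]) m (by omega)
  rw [Submodule.mem_bot] at this
  dsimp only [c] at this
  rw [if_pos rfl, sub_eq_zero] at this
  rw [this]
  exact hd m

end InvariantIdeals

/-! ### Fourier coefficients of vector-valued functions -/

section Fourier

open MeasureTheory AddCircle

/-- A vector-valued continuous function on the circle whose Fourier coefficients lie in a closed
subspace takes values in this subspace. -/
theorem mem_of_fourierCoeff_mem {E : Type*} [NormedAddCommGroup E] [NormedSpace ℂ E]
    [CompleteSpace E] {L : Submodule ℂ E} (hL : IsClosed (L : Set E)) {f : AddCircle (1 : ℝ) → E}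
    (hf : Continuous f) (h : ∀ k, fourierCoeff f k ∈ L) (t : AddCircle (1 : ℝ)) : f t ∈ L := by
  have : IsClosed (L : Set E) := hL
  let q : E →L[ℂ] E ⧸ L := L.mkQ.mkContinuous 1 fun x => by
    simpa using Submodule.Quotient.norm_mk_le L x
  have hq : ∀ x, q x = 0 ↔ x ∈ L := fun x => Submodule.Quotient.mk_eq_zero L
  by_contra hx
  -- Hahn–Banach in the quotient by `L` reduces the claim to a scalar function with vanishing
  -- Fourier coefficients.
  obtain ⟨g, -, hg⟩ := exists_dual_vector ℂ (q (f t)) (norm_ne_zero_iff.2 (mt (hq _).1 hx))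
  let F : C(AddCircle (1 : ℝ), ℂ) := ⟨fun s => g (q (f s)), by fun_prop⟩
  have hF : ∀ k, fourierCoeff F k = 0 := by
    intro k
    have h1 : fourierCoeff F k = g (q (fourierCoeff f k)) := by
      have hint : Integrable (fun s => fourier (-k) s • f s)
          (haarAddCircle : Measure (AddCircle (1 : ℝ))) :=
        Continuous.integrable_of_hasCompactSupport (by fun_prop) (HasCompactSupport.of_compactSpace _)
      change _ = (g.comp q) (∫ s, fourier (-k) s • f s ∂haarAddCircle)
      rw [← ContinuousLinearMap.integral_comp_comm _ hint]
      simp only [map_smul]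
      rfl
    rw [h1, (hq _).2 (h k), map_zero]
  -- A continuous function with summable coefficients is the pointwise sum of its Fourier series,
  -- here zero.
  have hsum : Summable (fourierCoeff F) := by
    have : (fourierCoeff F) = fun _ => 0 := funext hF
    rw [this]
    exact summable_zero
  have h2 := has_pointwise_sum_fourier_series_of_summable hsum t
  simp only [hF, zero_smul] at h2
  have h3 : g (q (f t)) = 0 := h2.unique hasSum_zero
  rw [h3] at hg
  exact hx ((hq _).1 (norm_eq_zero.1 (by simpa using hg.symm)))

end Fourier

/-! ### Monomials in the crossed product -/

section CrossedProductBasics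

variable {A : Type u} [NonUnitalCStarAlgebra A] {α : A ≃⋆ₐ[ℂ] A}

/-- Evaluation at a covariant representation. -/
def CovariantRep.eval (ρ : CovariantRep A α) : CrossedProduct α →⋆ₙₐ[ℂ] (ρ.H →L[ℂ] ρ.H) where
  toFun x := x.1.apply ρ
  map_smul' _ _ := rfl
  map_zero' := rfl
  map_add' _ _ := rfl
  map_mul' _ _ := rfl
  map_star' _ := rfl

namespace CrossedProduct

theorem ext_eval {x y : CrossedProduct α} (h : ∀ ρ : CovariantRep A α, ρ.eval x = ρ.eval y) :
    x = y :=
  Subtype.ext (lp.ext (funext h))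

theorem norm_le_of_eval {x : CrossedProduct α} {M : ℝ} (hM : 0 ≤ M)
    (h : ∀ ρ : CovariantRep A α, ‖ρ.eval x‖ ≤ M) : ‖x‖ ≤ M :=
  lp.norm_le_of_forall_le (E := fun ρ : CovariantRep A α => ρ.H →L[ℂ] ρ.H) hM h

variable (α) in
/-- The element `a uⁿ` of the crossed product. -/
def mono (n : ℤ) : A →ₗ[ℂ] CrossedProduct α where
  toFun a := ⟨universalMonomial α a n, universalMonomial_mem a n⟩
  map_add' a b := ext_eval fun ρ => by
    change ρ.π (a + b) * _ = ρ.π a * _ + ρ.π b * _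
    rw [map_add, add_mul]
  map_smul' c a := ext_eval fun ρ => by
    change ρ.π (c • a) * _ = c • (ρ.π a * _)
    rw [map_smul, smul_mul_assoc]

theorem eval_mono (ρ : CovariantRep A α) (a : A) (n : ℤ) :
    ρ.eval (mono α n a) = ρ.π a * ((ρ.U ^ n : unitary (ρ.H →L[ℂ] ρ.H)) : ρ.H →L[ℂ] ρ.H) := rfl

theorem norm_mono_le (a : A) (n : ℤ) : ‖mono α n a‖ ≤ ‖a‖ :=
  norm_le_of_eval (norm_nonneg _) fun ρ => ρ.norm_monomial_le a n

theorem continuous_mono (n : ℤ) : Continuous (mono α n) :=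
  AddMonoidHomClass.continuous_of_bound (mono α n) 1 fun a => by simpa using norm_mono_le a n

theorem U_mul_π (ρ : CovariantRep A α) (a : A) :
    (ρ.U : ρ.H →L[ℂ] ρ.H) * ρ.π a = ρ.π (α a) * (ρ.U : ρ.H →L[ℂ] ρ.H) := by
  rw [← ρ.covariant, mul_assoc, Unitary.coe_star_mul_self, mul_one]

theorem U_zpow_mul_π (ρ : CovariantRep A α) (n : ℤ) (a : A) :
    ((ρ.U ^ n : unitary (ρ.H →L[ℂ] ρ.H)) : ρ.H →L[ℂ] ρ.H) * ρ.π a =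
      ρ.π ((α ^ n) a) * ((ρ.U ^ n : unitary (ρ.H →L[ℂ] ρ.H)) : ρ.H →L[ℂ] ρ.H) := by
  have hnat : ∀ (k : ℕ) (a : A), ((ρ.U ^ k : unitary (ρ.H →L[ℂ] ρ.H)) : ρ.H →L[ℂ] ρ.H) * ρ.π a =
      ρ.π ((α ^ k) a) * ((ρ.U ^ k : unitary (ρ.H →L[ℂ] ρ.H)) : ρ.H →L[ℂ] ρ.H) := by
    intro k
    induction k with
    | zero => intro a; simp
    | succ k ih =>
      intro a
      rw [pow_succ, Submonoid.coe_mul, mul_assoc, U_mul_π, ← mul_assoc, ih, mul_assoc, pow_succ]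
      rfl
  obtain ⟨k, rfl | rfl⟩ := n.eq_nat_or_neg
  · simpa using hnat k a
  -- For a negative exponent, the positive case at `α⁻ᵏ(a)` is multiplied by `U⁻ᵏ` on both sides.
  · have h := hnat k ((α ^ (-(k : ℤ))) a)
    rw [← zpow_natCast, ← StarAlgEquiv.mul_apply, ← zpow_natCast α, ← zpow_add, add_neg_cancel,
      zpow_zero] at h
    change _ = ρ.π a * _ at h
    have h1 : ((ρ.U ^ (-(k : ℤ)) : unitary (ρ.H →L[ℂ] ρ.H)) : ρ.H →L[ℂ] ρ.H) *
        ((ρ.U ^ (k : ℤ) : unitary (ρ.H →L[ℂ] ρ.H)) : ρ.H →L[ℂ] ρ.H) = 1 := by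
      rw [← Submonoid.coe_mul, ← zpow_add, neg_add_cancel, zpow_zero]; rfl
    have h2 : ((ρ.U ^ (k : ℤ) : unitary (ρ.H →L[ℂ] ρ.H)) : ρ.H →L[ℂ] ρ.H) *
        ((ρ.U ^ (-(k : ℤ)) : unitary (ρ.H →L[ℂ] ρ.H)) : ρ.H →L[ℂ] ρ.H) = 1 := by
      rw [← Submonoid.coe_mul, ← zpow_add, add_neg_cancel, zpow_zero]; rfl
    calc _ = ((ρ.U ^ (-(k : ℤ)) : unitary (ρ.H →L[ℂ] ρ.H)) : ρ.H →L[ℂ] ρ.H) *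
          (ρ.π a * (((ρ.U ^ (k : ℤ) : unitary (ρ.H →L[ℂ] ρ.H)) : ρ.H →L[ℂ] ρ.H) *
            ((ρ.U ^ (-(k : ℤ)) : unitary (ρ.H →L[ℂ] ρ.H)) : ρ.H →L[ℂ] ρ.H))) := by
          rw [h2, mul_one]
      _ = (((ρ.U ^ (-(k : ℤ)) : unitary (ρ.H →L[ℂ] ρ.H)) : ρ.H →L[ℂ] ρ.H) *
          ((ρ.U ^ (k : ℤ) : unitary (ρ.H →L[ℂ] ρ.H)) : ρ.H →L[ℂ] ρ.H)) *
            ρ.π ((α ^ (-(k : ℤ))) a) *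
            ((ρ.U ^ (-(k : ℤ)) : unitary (ρ.H →L[ℂ] ρ.H)) : ρ.H →L[ℂ] ρ.H) := by
          rw [← mul_assoc (ρ.π a), ← h]; simp only [mul_assoc]
      _ = _ := by rw [h1, one_mul]

theorem mono_mul_mono (a b : A) (m n : ℤ) :
    mono α m a * mono α n b = mono α (m + n) (a * (α ^ m) b) := by
  refine ext_eval fun ρ => ?_
  rw [map_mul, eval_mono, eval_mono, eval_mono, map_mul, zpow_add, Submonoid.coe_mul, mul_assoc,
    ← mul_assoc _ (ρ.π b), U_zpow_mul_π]
  simp only [mul_assoc]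

theorem star_mono (a : A) (n : ℤ) :
    star (mono α n a) = mono α (-n) ((α ^ (-n)) (star a)) := by
  refine ext_eval fun ρ => ?_
  rw [map_star, eval_mono, eval_mono, star_mul, ← U_zpow_mul_π, map_star]
  congr 1
  rw [← Unitary.coe_star, Unitary.star_eq_inv, zpow_neg]

variable (α) in
/-- The canonical ⋆-homomorphism `A → A ⋊ ℤ`. -/
def incl : A →⋆ₙₐ[ℂ] CrossedProduct α where
  toFun := mono α 0
  map_smul' := map_smul _
  map_zero' := map_zero _
  map_add' := map_add _
  map_mul' a b := by
    rw [mono_mul_mono]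
    simp
  map_star' a := by
    rw [star_mono]
    simp

theorem incl_apply (a : A) : incl α a = mono α 0 a := rfl

theorem incl_mul_mono (a b : A) (n : ℤ) : incl α a * mono α n b = mono α n (a * b) := by
  rw [incl_apply, mono_mul_mono, zero_add]
  simp

theorem mono_mul_incl (a b : A) (n : ℤ) :
    mono α n a * incl α b = mono α n (a * (α ^ n) b) := by
  rw [incl_apply, mono_mul_mono, add_zero]

/-- A closed subspace containing all `a uⁿ` is everything. -/
theorem mem_of_mono_mem {W : Submodule ℂ (CrossedProduct α)} (hW : IsClosed (W : Set (CrossedProduct α)))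
    (h : ∀ a n, mono α n a ∈ W) (x : CrossedProduct α) : x ∈ W := by
  -- Products and adjoints of monomials are monomials, so the generated ⋆-algebra is just their
  -- linear span.
  have hspan : ∀ y ∈ NonUnitalStarAlgebra.adjoin ℂ
      {x : CovariantFamilies α | ∃ (a : A) (n : ℤ), x = universalMonomial α a n},
      ∃ z ∈ Submodule.span ℂ (Set.range fun p : A × ℤ => mono α p.2 p.1), z.1 = y := by
    intro y hy
    induction hy using NonUnitalStarAlgebra.adjoin_induction with
    | mem y hy =>
      obtain ⟨a, n, rfl⟩ := hy
      exact ⟨mono α n a, Submodule.subset_span ⟨(a, n), rfl⟩, rfl⟩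
    | add y z _ _ hy hz =>
      obtain ⟨y', hy', rfl⟩ := hy
      obtain ⟨z', hz', rfl⟩ := hz
      exact ⟨y' + z', Submodule.add_mem _ hy' hz', rfl⟩
    | zero => exact ⟨0, Submodule.zero_mem _, rfl⟩
    | mul y z _ _ hy hz =>
      obtain ⟨y', hy', rfl⟩ := hy
      obtain ⟨z', hz', rfl⟩ := hz
      refine ⟨y' * z', ?_, rfl⟩
      refine Submodule.span_induction (p := fun y' _ => y' * z' ∈ _) ?_ ?_ ?_ ?_ hy'
      · rintro _ ⟨⟨a, n⟩, rfl⟩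
        refine Submodule.span_induction (p := fun z' _ => mono α n a * z' ∈ _) ?_ ?_ ?_ ?_ hz'
        · rintro _ ⟨⟨b, m⟩, rfl⟩
          exact Submodule.subset_span ⟨(a * (α ^ n) b, n + m), (mono_mul_mono a b n m).symm⟩
        · rw [mul_zero]; exact Submodule.zero_mem _
        · intro x y _ _ hx hy
          rw [mul_add]; exact Submodule.add_mem _ hx hy
        · intro c x _ hx
          rw [mul_smul_comm]; exact Submodule.smul_mem _ c hx
      · rw [zero_mul]; exact Submodule.zero_mem _
      · intro x y _ _ hx hy
        rw [add_mul]; exact Submodule.add_mem _ hx hy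
      · intro c x _ hx
        rw [smul_mul_assoc]; exact Submodule.smul_mem _ c hx
    | smul c y _ hy =>
      obtain ⟨y', hy', rfl⟩ := hy
      exact ⟨c • y', Submodule.smul_mem _ c hy', rfl⟩
    | star y _ hy =>
      obtain ⟨y', hy', rfl⟩ := hy
      refine ⟨star y', ?_, rfl⟩
      refine Submodule.span_induction (p := fun y' _ => star y' ∈ _) ?_ ?_ ?_ ?_ hy'
      · rintro _ ⟨⟨a, n⟩, rfl⟩
        exact Submodule.subset_span ⟨((α ^ (-n)) (star a), -n), (star_mono a n).symm⟩
      · rw [star_zero]; exact Submodule.zero_mem _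
      · intro x y _ _ hx hy
        rw [star_add]; exact Submodule.add_mem _ hx hy
      · intro c x _ hx
        rw [star_smul]; exact Submodule.smul_mem _ _ hx
  have hle : Submodule.span ℂ (Set.range fun p : A × ℤ => mono α p.2 p.1) ≤ W :=
    Submodule.span_le.2 (by rintro _ ⟨p, rfl⟩; exact h _ _)
  refine hW.closure_subset (closure_subtype.2 (closure_mono ?_ x.2))
  intro y hy
  obtain ⟨z, hz, rfl⟩ := hspan y hy
  exact ⟨z, hle hz, rfl⟩

/-- Two continuous linear maps agreeing on all `a uⁿ` are equal. -/
theorem clm_ext {E : Type*} [NormedAddCommGroup E] [NormedSpace ℂ E]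
    {f g : CrossedProduct α →L[ℂ] E} (h : ∀ a n, f (mono α n a) = g (mono α n a)) : f = g :=
  ContinuousLinearMap.ext fun x => sub_eq_zero.1 <| mem_of_mono_mem
    (W := LinearMap.ker (f - g).toLinearMap) (isClosed_singleton.preimage (f - g).continuous)
    (fun a n => sub_eq_zero.2 (h a n)) x

end CrossedProduct

end CrossedProductBasics

/-! ### The dual action and its spectral subspaces -/

section Gauge

open MeasureTheory AddCircle

variable {A : Type u} [NonUnitalCStarAlgebra A] {α : A ≃⋆ₐ[ℂ] A}

/-- The unitary `zU`. -/
def CovariantRep.rotateU (ρ : CovariantRep A α) (z : Circle) : unitary (ρ.H →L[ℂ] ρ.H) :=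
  ⟨(z : ℂ) • (ρ.U : ρ.H →L[ℂ] ρ.H), by
    have hz : star (z : ℂ) * z = 1 := by
      rw [Complex.star_def, ← Circle.coe_inv_eq_conj, ← Circle.coe_mul, inv_mul_cancel,
        Circle.coe_one]
    rw [Unitary.mem_iff]
    constructor
    · rw [star_smul, smul_mul_smul_comm, hz, Unitary.star_mul_self_of_mem ρ.U.2, one_smul]
    · rw [star_smul, smul_mul_smul_comm, mul_comm, hz, Unitary.mul_star_self_of_mem ρ.U.2,
        one_smul]⟩

theorem CovariantRep.coe_rotateU_zpow (ρ : CovariantRep A α) (z : Circle) (n : ℤ) :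
    ((ρ.rotateU z ^ n : unitary (ρ.H →L[ℂ] ρ.H)) : ρ.H →L[ℂ] ρ.H) =
      ((z ^ n : Circle) : ℂ) • ((ρ.U ^ n : unitary (ρ.H →L[ℂ] ρ.H)) : ρ.H →L[ℂ] ρ.H) := by
  have hU : (ρ.rotateU z : ρ.H →L[ℂ] ρ.H) = (z : ℂ) • (ρ.U : ρ.H →L[ℂ] ρ.H) := rfl
  have hnat : ∀ k : ℕ, ((ρ.rotateU z ^ k : unitary (ρ.H →L[ℂ] ρ.H)) : ρ.H →L[ℂ] ρ.H) =
      ((z ^ k : Circle) : ℂ) • ((ρ.U ^ k : unitary (ρ.H →L[ℂ] ρ.H)) : ρ.H →L[ℂ] ρ.H) := by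
    intro k
    rw [SubmonoidClass.coe_pow, SubmonoidClass.coe_pow, hU, smul_pow, Circle.coe_pow]
  obtain ⟨k, rfl | rfl⟩ := n.eq_nat_or_neg
  · simpa using hnat k
  · rw [zpow_neg, zpow_neg, zpow_neg, zpow_natCast, zpow_natCast, zpow_natCast,
      ← Unitary.star_eq_inv, ← Unitary.star_eq_inv, Unitary.coe_star, Unitary.coe_star,
      hnat k, star_smul, Complex.star_def, ← Circle.coe_inv_eq_conj]

/-- The covariant representation `(π, zU)`. -/
def CovariantRep.rotate (ρ : CovariantRep A α) (z : Circle) : CovariantRep A α where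
  H := ρ.H
  π := ρ.π
  U := ρ.rotateU z
  covariant a := by
    have hz : (z : ℂ) * star (z : ℂ) = 1 := by
      rw [Complex.star_def, ← Circle.coe_inv_eq_conj, ← Circle.coe_mul, mul_inv_cancel,
        Circle.coe_one]
    change (z : ℂ) • (ρ.U : ρ.H →L[ℂ] ρ.H) * ρ.π a * star ((z : ℂ) • (ρ.U : ρ.H →L[ℂ] ρ.H)) = _
    rw [star_smul, smul_mul_assoc, smul_mul_smul_comm, hz, one_smul]
    exact ρ.covariant a

namespace CrossedProduct

/-- The action of `z` on families of operators. -/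
def rotateFamily (z : Circle) (x : CovariantFamilies α) : CovariantFamilies α :=
  ⟨fun ρ => x.apply (ρ.rotate z), memℓp_infty ⟨‖x‖, by
    rintro _ ⟨ρ, rfl⟩
    exact lp.norm_apply_le_norm
      (E := fun ρ : CovariantRep A α => ρ.H →L[ℂ] ρ.H) ENNReal.top_ne_zero x (ρ.rotate z)⟩⟩

/-- The action of `z` on families of operators, as a ⋆-homomorphism. -/
def rotateFamilyHom (z : Circle) : CovariantFamilies α →⋆ₙₐ[ℂ] CovariantFamilies α where
  toFun := rotateFamily z
  map_smul' _ _ := rfl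
  map_zero' := rfl
  map_add' _ _ := rfl
  map_mul' _ _ := rfl
  map_star' _ := rfl

theorem rotateFamily_universalMonomial (z : Circle) (a : A) (n : ℤ) :
    rotateFamily z (universalMonomial α a n) = ((z ^ n : Circle) : ℂ) • universalMonomial α a n := by
  refine lp.ext (funext fun ρ => ?_)
  change ρ.π a * ((ρ.rotateU z ^ n : unitary (ρ.H →L[ℂ] ρ.H)) : ρ.H →L[ℂ] ρ.H) =
    ((z ^ n : Circle) : ℂ) •
      (ρ.π a * ((ρ.U ^ n : unitary (ρ.H →L[ℂ] ρ.H)) : ρ.H →L[ℂ] ρ.H))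
  rw [CovariantRep.coe_rotateU_zpow, mul_smul_comm]

theorem rotateFamily_mem (z : Circle) {x : CovariantFamilies α} (hx : x ∈ crossedProduct α) :
    rotateFamily z x ∈ crossedProduct α := by
  have hle : crossedProduct α ≤
      NonUnitalStarSubalgebra.comap (rotateFamilyHom z) (crossedProduct α) := by
    refine NonUnitalStarSubalgebra.topologicalClosure_minimal _ ?_
      (crossedProduct_isClosed.preimage (rotateFamilyHom z).continuous_of_cstar)
    refine NonUnitalStarAlgebra.adjoin_le ?_
    rintro _ ⟨a, n, rfl⟩
    change rotateFamily z _ ∈ crossedProduct α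
    rw [rotateFamily_universalMonomial]
    exact (crossedProduct α).smul_mem' _ (universalMonomial_mem a n)
  exact hle hx

/-- The dual action of the circle on the crossed product, `a uⁿ ↦ zⁿ a uⁿ`. -/
def gauge (z : Circle) : CrossedProduct α →⋆ₙₐ[ℂ] CrossedProduct α where
  toFun x := ⟨rotateFamily z x.1, rotateFamily_mem z x.2⟩
  map_smul' _ _ := rfl
  map_zero' := rfl
  map_add' _ _ := rfl
  map_mul' _ _ := rfl
  map_star' _ := rfl

theorem norm_gauge_le (z : Circle) (x : CrossedProduct α) : ‖gauge z x‖ ≤ ‖x‖ :=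
  NonUnitalStarAlgHom.norm_apply_le (gauge z) x

theorem gauge_mono (z : Circle) (a : A) (n : ℤ) :
    gauge z (mono α n a) = ((z ^ n : Circle) : ℂ) • mono α n a :=
  Subtype.ext (rotateFamily_universalMonomial z a n)

theorem gauge_one (x : CrossedProduct α) : gauge 1 x = x := by
  let W : Submodule ℂ (CrossedProduct α) :=
    { carrier := {x | gauge 1 x = x}
      add_mem' := fun {x y} hx hy => by
        simp only [Set.mem_ofPred_eq, map_add] at *
        rw [hx, hy]
      zero_mem' := map_zero (gauge 1)
      smul_mem' := fun c x hx => by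
        simp only [Set.mem_ofPred_eq, map_smul] at *
        rw [hx] }
  refine mem_of_mono_mem (W := W) ?_ (fun a n => ?_) x
  · exact isClosed_eq (gauge 1).continuous_of_cstar continuous_id
  · change gauge 1 (mono α n a) = mono α n a
    rw [gauge_mono, one_zpow, Circle.coe_one, one_smul]

/-- The elements with continuous orbit form a closed subspace, since the action is contractive and
uniform limits of continuous maps are continuous. Monomials have the orbits `zⁿ a uⁿ`. -/
theorem continuous_gauge (x : CrossedProduct α) : Continuous fun z : Circle => gauge z x := by
  let W : Submodule ℂ (CrossedProduct α) :=
    { carrier := {x | Continuous fun z : Circle => gauge z x}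
      add_mem' := fun {x y} hx hy => by
        simp only [Set.mem_ofPred_eq, map_add] at *
        exact hx.add hy
      zero_mem' := by
        simp only [Set.mem_ofPred_eq, map_zero]
        exact continuous_const
      smul_mem' := fun c x hx => by
        simp only [Set.mem_ofPred_eq, map_smul] at *
        exact hx.const_smul c }
  refine mem_of_mono_mem (W := W) ?_ (fun a n => ?_) x
  · refine isClosed_of_closure_subset fun y hy => ?_
    refine continuous_of_uniform_approx_of_continuous fun u hu => ?_
    obtain ⟨ε, hε, hεu⟩ := Metric.mem_uniformity_dist.1 hu
    obtain ⟨w, hw, hyw⟩ := Metric.mem_closure_iff.1 hy ε hε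
    refine ⟨fun z => gauge z w, hw, fun z => hεu ?_⟩
    rw [dist_eq_norm, ← map_sub]
    exact (norm_gauge_le _ _).trans_lt (by rwa [← dist_eq_norm])
  · change Continuous fun z : Circle => gauge z (mono α n a)
    simp only [gauge_mono]
    exact Continuous.smul (Continuous.comp (g := fun z : Circle => (z : ℂ)) (by fun_prop) (continuous_zpow n)) continuous_const

/-- The orbit map of the dual action, on `ℝ / ℤ`. -/
theorem continuous_gauge_toCircle (x : CrossedProduct α) :
    Continuous fun t : AddCircle (1 : ℝ) => gauge t.toCircle x :=
  (continuous_gauge x).comp AddCircle.continuous_toCircle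

theorem integrable_gauge (x : CrossedProduct α) (k : ℤ) :
    Integrable (fun t : AddCircle (1 : ℝ) => fourier k t • gauge t.toCircle x) haarAddCircle :=
  Continuous.integrable_of_hasCompactSupport
    ((map_continuous (fourier k)).smul (continuous_gauge_toCircle x))
    (HasCompactSupport.of_compactSpace _)

variable (α) in
/-- The projection to the `k`-th spectral subspace of the dual action. -/
def coeff (k : ℤ) : CrossedProduct α →L[ℂ] CrossedProduct α :=
  LinearMap.mkContinuous
    { toFun := fun x => fourierCoeff (fun t : AddCircle (1 : ℝ) => gauge t.toCircle x) k
      map_add' := fun x y => by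
        simp only [fourierCoeff, map_add, smul_add]
        exact integral_add (integrable_gauge x _) (integrable_gauge y _)
      map_smul' := fun c x => by
        simp only [fourierCoeff, map_smul, RingHom.id_apply]
        rw [← integral_smul]
        simp only [smul_comm c] } 1 fun x => by
    rw [one_mul]
    refine (norm_integral_le_of_norm_le_const (C := ‖x‖) (Eventually.of_forall fun t => ?_)).trans ?_
    · rw [norm_smul, fourier_apply, Circle.norm_coe, one_mul]
      exact norm_gauge_le _ x
    · simp

theorem coeff_apply (k : ℤ) (x : CrossedProduct α) :
    coeff α k x = fourierCoeff (fun t : AddCircle (1 : ℝ) => gauge t.toCircle x) k := rfl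

theorem coeff_mono (k n : ℤ) (a : A) :
    coeff α k (mono α n a) = if n = k then mono α n a else 0 := by
  rw [coeff_apply]
  have h1 : ∀ t : AddCircle (1 : ℝ), gauge t.toCircle (mono α n a) =
      fourier n t • mono α n a := by
    intro t
    rw [gauge_mono, fourier_apply, AddCircle.toCircle_zsmul]
  simp only [h1, fourierCoeff, smul_smul]
  rw [integral_smul_const]
  have h2 := congrFun (fourierCoeff_fourier (T := 1) n) k
  rw [fourierCoeff] at h2
  simp only [smul_eq_mul] at h2
  rw [h2, Pi.single_apply]
  simp only [eq_comm (a := k), ite_smul, one_smul, zero_smul]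

/-- A closed subspace containing all Fourier coefficients of `x` contains `x`. -/
theorem mem_of_coeff_mem {L : Submodule ℂ (CrossedProduct α)}
    (hL : IsClosed (L : Set (CrossedProduct α))) {x : CrossedProduct α}
    (h : ∀ k, coeff α k x ∈ L) : x ∈ L := by
  have := mem_of_fourierCoeff_mem hL (continuous_gauge_toCircle x) h 0
  rwa [AddCircle.toCircle_zero, gauge_one] at this

/-- `E_k(x) b u⁻ᵏ = E₀(x b u⁻ᵏ)`. -/
theorem coeff_mul_mono (k : ℤ) (x : CrossedProduct α) (b : A) :
    coeff α k x * mono α (-k) b = coeff α 0 (x * mono α (-k) b) := by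
  let R : CrossedProduct α →L[ℂ] CrossedProduct α :=
    (ContinuousLinearMap.mul ℂ (CrossedProduct α)).flip (mono α (-k) b)
  have : R.comp (coeff α k) = (coeff α 0).comp R := clm_ext fun a n => by
    change coeff α k (mono α n a) * mono α (-k) b = coeff α 0 (mono α n a * mono α (-k) b)
    rw [coeff_mono, mono_mul_mono, coeff_mono]
    by_cases hn : n = k
    · rw [if_pos hn, if_pos (by omega), mono_mul_mono]
    · rw [if_neg hn, if_neg (by omega), zero_mul]
  exact DFunLike.congr_fun this x

/-- `coeff α 0` is the conditional expectation onto `A`: it maps monomials into the image of `A`,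
which is closed. -/
theorem coeff_zero_mem_range (x : CrossedProduct α) : coeff α 0 x ∈ Set.range (incl α) := by
  let W : Submodule ℂ (CrossedProduct α) :=
    (LinearMap.range (mono α 0)).comap (coeff α 0).toLinearMap
  refine mem_of_mono_mem (W := W) ?_ (fun a n => ?_) x
  · exact (incl α).isClosed_range.preimage (coeff α 0).continuous
  · change coeff α 0 (mono α n a) ∈ LinearMap.range (mono α 0)
    rw [coeff_mono]
    split_ifs with hn
    · rw [hn]
      exact ⟨a, rfl⟩
    · exact Submodule.zero_mem _

end CrossedProduct

end Gauge

/-! ### Ideals of the crossed product and the conditional expectation -/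

/-- The vectors on which an eventually equibounded family of linear maps tends to zero. -/
def asymptoticKernel {ι E F : Type*} [NormedAddCommGroup E] [NormedSpace ℂ E] [NormedAddCommGroup F]
    [NormedSpace ℂ F] (P : ι → E →ₗ[ℂ] F) (l : Filter ι) : Submodule ℂ E where
  carrier := {x | Tendsto (fun i => P i x) l (𝓝 0)}
  add_mem' := fun {x y} hx hy => by
    simp only [Set.mem_ofPred_eq, map_add] at *
    simpa using hx.add hy
  zero_mem' := by
    simp only [Set.mem_ofPred_eq, map_zero]
    exact tendsto_const_nhds
  smul_mem' := fun c x hx => by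
    simp only [Set.mem_ofPred_eq, map_smul] at *
    simpa using hx.const_smul c

/-- Equiboundedness lets convergence to zero be checked on the monomials only. -/
theorem isClosed_asymptoticKernel {ι E F : Type*} [NormedAddCommGroup E] [NormedSpace ℂ E]
    [NormedAddCommGroup F] [NormedSpace ℂ F] {P : ι → E →ₗ[ℂ] F} {l : Filter ι} {c : ℝ}
    (hc : 0 < c) (hP : ∀ᶠ i in l, ∀ x, ‖P i x‖ ≤ c * ‖x‖) :
    IsClosed (asymptoticKernel P l : Set E) := by
  refine isClosed_of_closure_subset fun x hx => ?_
  refine Metric.tendsto_nhds.2 fun ε hε => ?_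
  obtain ⟨y, hy, hxy⟩ := Metric.mem_closure_iff.1 hx (ε / (2 * c)) (by positivity)
  filter_upwards [hP, Metric.tendsto_nhds.1 hy (ε / 2) (half_pos hε)] with i h1 h2
  rw [dist_zero_right] at h2 ⊢
  have h3 : ‖P i (x - y)‖ < ε / 2 := by
    refine (h1 _).trans_lt ?_
    rw [dist_eq_norm] at hxy
    calc c * ‖x - y‖ < c * (ε / (2 * c)) := by gcongr
      _ = ε / 2 := by field_simp
  calc ‖P i x‖ = ‖P i (x - y) + P i y‖ := by rw [map_sub, sub_add_cancel]
    _ ≤ ‖P i (x - y)‖ + ‖P i y‖ := norm_add_le _ _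
    _ < ε := by linarith

namespace CrossedProduct

variable {A : Type u} [NonUnitalCStarAlgebra A] {α : A ≃⋆ₐ[ℂ] A}

variable (α) in
/-- The closed span of the elements `a uⁿ`, `a ∈ K`. -/
def idealSpan (K : Submodule ℂ A) : Submodule ℂ (CrossedProduct α) :=
  (Submodule.span ℂ {x | ∃ a ∈ K, ∃ n : ℤ, x = mono α n a}).topologicalClosure

theorem isClosed_idealSpan (K : Submodule ℂ A) :
    IsClosed (idealSpan α K : Set (CrossedProduct α)) :=
  Submodule.isClosed_topologicalClosure _

theorem mono_mem_idealSpan {K : Submodule ℂ A} {a : A} (ha : a ∈ K) (n : ℤ) :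
    mono α n a ∈ idealSpan α K :=
  Submodule.le_topologicalClosure _ (Submodule.subset_span ⟨a, ha, n, rfl⟩)

theorem idealSpan_le {K : Submodule ℂ A} {W : Submodule ℂ (CrossedProduct α)}
    (hW : IsClosed (W : Set (CrossedProduct α))) (h : ∀ a ∈ K, ∀ n, mono α n a ∈ W) :
    idealSpan α K ≤ W :=
  Submodule.topologicalClosure_minimal _
    (Submodule.span_le.2 (by rintro _ ⟨a, ha, n, rfl⟩; exact h a ha n)) hW

/-- If `K` is an invariant ideal of `A`, then the closed span of the `a uⁿ`, `a ∈ K`, is an ideal of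
the crossed product. -/
theorem idealSpan_mul_mem {K : Submodule ℂ A} (hK : ∀ a, ∀ x ∈ K, a * x ∈ K ∧ x * a ∈ K)
    (hinv : ∀ x ∈ K, ∀ n : ℤ, (α ^ n) x ∈ K) (y : CrossedProduct α) {x : CrossedProduct α}
    (hx : x ∈ idealSpan α K) : y * x ∈ idealSpan α K ∧ x * y ∈ idealSpan α K := by
  have hcl := isClosed_idealSpan (α := α) K
  constructor
  · refine idealSpan_le (W := (idealSpan α K).comap (LinearMap.mulLeft ℂ y))
      (hcl.preimage (continuous_const.mul continuous_id)) (fun a ha n => ?_) hx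
    refine mem_of_mono_mem (W := (idealSpan α K).comap (LinearMap.mulRight ℂ (mono α n a)))
      (hcl.preimage (continuous_id.mul continuous_const)) (fun b m => ?_) y
    change mono α m b * mono α n a ∈ idealSpan α K
    rw [mono_mul_mono]
    exact mono_mem_idealSpan (hK _ _ (hinv a ha m)).1 _
  · refine idealSpan_le (W := (idealSpan α K).comap (LinearMap.mulRight ℂ y))
      (hcl.preimage (continuous_id.mul continuous_const)) (fun a ha n => ?_) hx
    refine mem_of_mono_mem (W := (idealSpan α K).comap (LinearMap.mulLeft ℂ (mono α n a)))
      (hcl.preimage (continuous_const.mul continuous_id)) (fun b m => ?_) y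
    change mono α n a * mono α m b ∈ idealSpan α K
    rw [mono_mul_mono]
    exact mono_mem_idealSpan (hK _ _ ha).2 _

theorem exists_approximateUnit (A : Type u) [NonUnitalCStarAlgebra A] :
    ∃ l : Filter A, l.NeBot ∧ (∀ᶠ e in l, ‖e‖ ≤ 1) ∧
      (∀ x : A, Tendsto (fun e => e * x) l (𝓝 x)) ∧ (∀ x : A, Tendsto (fun e => x * e) l (𝓝 x)) := by
  obtain ⟨l, hl, h1, h2, h3⟩ :=
    (⊤ : NonUnitalStarSubalgebra ℂ A).exists_approximateUnit isClosed_univ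
  exact ⟨l, hl, h1.mono fun e he => he.2.2.1, fun x => h2 x trivial, fun x => h3 x trivial⟩

theorem norm_incl_le (a : A) : ‖incl α a‖ ≤ ‖a‖ := norm_mono_le a 0

/-- An approximate unit of `A` is a right approximate unit of the crossed product. -/
theorem tendsto_mul_incl {l : Filter A} (h1 : ∀ᶠ e in l, ‖e‖ ≤ 1)
    (h2 : ∀ x : A, Tendsto (fun e => x * e) l (𝓝 x)) (y : CrossedProduct α) :
    Tendsto (fun e => y * incl α e) l (𝓝 y) := by
  let P : A → CrossedProduct α →ₗ[ℂ] CrossedProduct α := fun e =>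
    LinearMap.mulRight ℂ (incl α e) - LinearMap.id
  have hP : ∀ e x, P e x = x * incl α e - x := fun e x => rfl
  have hcl : IsClosed (asymptoticKernel P l : Set (CrossedProduct α)) := by
    refine isClosed_asymptoticKernel (c := 2) two_pos ?_
    filter_upwards [h1] with e he x
    rw [hP]
    calc ‖x * incl α e - x‖ ≤ ‖x * incl α e‖ + ‖x‖ := norm_sub_le _ _
      _ ≤ ‖x‖ * 1 + ‖x‖ := by
        gcongr
        exact (norm_mul_le _ _).trans (by gcongr; exact (norm_incl_le e).trans he)
      _ = 2 * ‖x‖ := by ring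
  have := mem_of_mono_mem hcl (fun a n => ?_) y
  · have h3 : Tendsto (fun e => P e y) l (𝓝 0) := this
    simpa [hP] using h3.add_const y
  · change Tendsto (fun e => P e (mono α n a)) l (𝓝 0)
    have h3 : ∀ e, P e (mono α n a) = mono α n ((α ^ n) ((α ^ (-n)) a * e) - a) := by
      intro e
      rw [hP, mono_mul_incl, map_mul (α ^ n), ← StarAlgEquiv.mul_apply, ← zpow_add,
        add_neg_cancel, zpow_zero, map_sub]
      rfl
    simp only [h3]
    have h4 := (((StarAlgEquiv.isometry (α ^ n)).continuous.tendsto _).comp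
      (h2 ((α ^ (-n)) a))).sub_const a
    rw [← StarAlgEquiv.mul_apply, ← zpow_add, add_neg_cancel, zpow_zero] at h4
    have h5 := ((continuous_mono (α := α) n).tendsto _).comp h4
    change Tendsto _ _ (𝓝 (mono α n (a - a))) at h5
    rw [sub_self, map_zero] at h5
    exact h5

/-- An ideal of the crossed product whose image under the conditional expectation lies in `K` is
contained in the closed span of the `a uⁿ`, `a ∈ K`. -/
theorem le_idealSpan {K : Submodule ℂ A} (hK : ∀ a, ∀ x ∈ K, a * x ∈ K ∧ x * a ∈ K)
    (I : ClosedIdeal (CrossedProduct α)) (h : ∀ x ∈ I.1, ∃ e ∈ K, coeff α 0 x = incl α e) :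
    I.1 ≤ idealSpan α K := by
  intro x hx
  refine mem_of_coeff_mem (isClosed_idealSpan K) fun k => ?_
  obtain ⟨l, hl, h1, h2, h3⟩ := exists_approximateUnit A
  -- Multiplying by `b u⁻ᵏ` moves the `k`-th coefficient to degree zero while staying in `I`, so the
  -- hypothesis on `coeff α 0` applies; multiplying by `αᵏ(c) uᵏ` moves it back. Approximate units
  -- then remove the factor `b c`.
  have hprod : ∀ b c : A, coeff α k x * incl α (b * c) ∈ idealSpan α K := by
    intro b c
    obtain ⟨e, he, hxe⟩ := h (x * mono α (-k) b) (I.2.2 _ x hx).2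
    have h4 : mono α (-k) b * mono α k ((α ^ k) c) = incl α (b * c) := by
      rw [mono_mul_mono, neg_add_cancel, ← StarAlgEquiv.mul_apply, ← zpow_add, neg_add_cancel,
        zpow_zero]
      rfl
    rw [← h4, ← mul_assoc, coeff_mul_mono, hxe, incl_mul_mono]
    exact mono_mem_idealSpan (hK _ _ he).2 _
  have hall : ∀ w : A, coeff α k x * incl α w ∈ idealSpan α K := fun w => by
    refine (isClosed_idealSpan K).mem_of_tendsto
      (((continuous_const.mul (incl α).continuous_of_cstar).tendsto _).comp (h2 w))
      (Eventually.of_forall fun e => hprod e w)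
  exact (isClosed_idealSpan K).mem_of_tendsto (tendsto_mul_incl h1 h3 _)
    (Eventually.of_forall fun e => hall e)

/-- The compression `y ↦ (1 - f) y (1 - f)`. -/
def compress (f : CrossedProduct α) : CrossedProduct α →ₗ[ℂ] CrossedProduct α :=
  LinearMap.id - LinearMap.mulLeft ℂ f -
    (LinearMap.mulRight ℂ f) ∘ₗ (LinearMap.id - LinearMap.mulLeft ℂ f)

theorem compress_apply (f y : CrossedProduct α) :
    compress f y = (y - f * y) - (y - f * y) * f := rfl

theorem compress_apply' (f y : CrossedProduct α) :
    compress f y = (y - y * f) - f * (y - y * f) := by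
  rw [compress_apply]
  noncomm_ring

theorem norm_sub_mul_le {f : CrossedProduct α} (hf : ‖f‖ ≤ 1) (y : CrossedProduct α) :
    ‖y - f * y‖ ≤ 2 * ‖y‖ ∧ ‖y - y * f‖ ≤ 2 * ‖y‖ := by
  constructor
  · calc ‖y - f * y‖ ≤ ‖y‖ + ‖f‖ * ‖y‖ := (norm_sub_le _ _).trans (by gcongr; exact norm_mul_le _ _)
      _ ≤ ‖y‖ + 1 * ‖y‖ := by gcongr
      _ = 2 * ‖y‖ := by ring
  · calc ‖y - y * f‖ ≤ ‖y‖ + ‖y‖ * ‖f‖ := (norm_sub_le _ _).trans (by gcongr; exact norm_mul_le _ _)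
      _ ≤ ‖y‖ + ‖y‖ * 1 := by gcongr
      _ = 2 * ‖y‖ := by ring

/-- Let `T' ⊆ T` be closed ideals of `A` with `αⁿ(T) ⊆ T'` for all `n ≥ 1`. If `I` is an ideal of
the crossed product and `x ∈ I`, then `a E(x) b`, for `a, b ∈ T`, is approximately a sum of
elements of `I ∩ A` and `T'`. -/
theorem mul_coeff_mul_approx {T : Submodule ℂ A} {T' : NonUnitalStarSubalgebra ℂ A}
    (hT' : IsClosed (T' : Set A)) (hmul : ∀ a, ∀ x ∈ T, a * x ∈ T ∧ x * a ∈ T)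
    (hmul' : ∀ a, ∀ x ∈ T', a * x ∈ T' ∧ x * a ∈ T')
    (hshift : ∀ x ∈ T, ∀ n : ℤ, 0 < n → (α ^ n) x ∈ T')
    (I : ClosedIdeal (CrossedProduct α)) {x : CrossedProduct α} (hx : x ∈ I.1) {e : A}
    (he : coeff α 0 x = incl α e) {a b : A} (ha : a ∈ T) (hb : b ∈ T) {ε : ℝ} (hε : 0 < ε) :
    ∃ k, incl α k ∈ I.1 ∧ ∃ t ∈ T', ‖a * e * b - k - t‖ < ε := by
  obtain ⟨l, hl, h1, h2, h3⟩ := T'.exists_approximateUnit hT'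
  let P : A → CrossedProduct α →ₗ[ℂ] CrossedProduct α := fun f => compress (incl α f)
  have hcl : IsClosed (asymptoticKernel P l : Set (CrossedProduct α)) := by
    refine isClosed_asymptoticKernel (c := 4) (by norm_num) ?_
    filter_upwards [h1] with f hf y
    have hf1 : ‖incl α f‖ ≤ 1 := (norm_incl_le f).trans hf.2.2.1
    have := (norm_sub_mul_le hf1 (y - incl α f * y)).2
    have := (norm_sub_mul_le hf1 y).1
    change ‖compress (incl α f) y‖ ≤ _
    rw [compress_apply]
    linarith
  have hleft : ∀ d ∈ T', ∀ n : ℤ, mono α n d ∈ asymptoticKernel P l := by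
    intro d hd n
    have h4 : Tendsto (fun f => 2 * ‖mono α n (d - f * d)‖) l (𝓝 0) := by
      have h5 := ((continuous_mono (α := α) n).tendsto _).comp
        ((tendsto_const_nhds (x := d)).sub (h2 d hd))
      rw [sub_self, map_zero] at h5
      simpa using h5.norm.const_mul 2
    refine squeeze_zero_norm' ?_ h4
    filter_upwards [h1] with f hf
    have hf1 : ‖incl α f‖ ≤ 1 := (norm_incl_le f).trans hf.2.2.1
    change ‖compress (incl α f) (mono α n d)‖ ≤ _
    rw [compress_apply, incl_mul_mono, ← map_sub]
    exact (norm_sub_mul_le hf1 _).2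
  have hright : ∀ d, ∀ n : ℤ, (α ^ (-n)) d ∈ T' → mono α n d ∈ asymptoticKernel P l := by
    intro d n hd
    have h4 : Tendsto (fun f => 2 * ‖mono α n (d - d * (α ^ n) f)‖) l (𝓝 0) := by
      have h5 := ((StarAlgEquiv.isometry (α ^ n)).continuous.tendsto _).comp (h3 _ hd)
      simp only [Function.comp_def, map_mul] at h5
      rw [← StarAlgEquiv.mul_apply, ← zpow_add, add_neg_cancel, zpow_zero] at h5
      have h6 := ((continuous_mono (α := α) n).tendsto _).comp
        ((tendsto_const_nhds (x := d)).sub h5)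
      change Tendsto _ _ (𝓝 (mono α n (d - d))) at h6
      rw [sub_self, map_zero] at h6
      simpa using h6.norm.const_mul 2
    refine squeeze_zero_norm' ?_ h4
    filter_upwards [h1] with f hf
    have hf1 : ‖incl α f‖ ≤ 1 := (norm_incl_le f).trans hf.2.2.1
    change ‖compress (incl α f) (mono α n d)‖ ≤ _
    rw [compress_apply', mono_mul_incl, ← map_sub]
    exact (norm_sub_mul_le hf1 _).1
  have hW : ∀ x : CrossedProduct α,
      incl α a * (x - coeff α 0 x) * incl α b ∈ asymptoticKernel P l := by
    intro x
    let F : CrossedProduct α →ₗ[ℂ] CrossedProduct α := LinearMap.mulRight ℂ (incl α b) ∘ₗ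
      LinearMap.mulLeft ℂ (incl α a) ∘ₗ (LinearMap.id - (coeff α 0).toLinearMap)
    have hF : Continuous F := by
      change Continuous fun x => incl α a * (x - coeff α 0 x) * incl α b
      fun_prop
    refine mem_of_mono_mem (W := (asymptoticKernel P l).comap F) (hcl.preimage hF) (fun c n => ?_) x
    change incl α a * (mono α n c - coeff α 0 (mono α n c)) * incl α b ∈ asymptoticKernel P l
    rw [coeff_mono]
    split_ifs with hn
    · rw [sub_self, mul_zero, zero_mul]
      exact Submodule.zero_mem _
    · rw [sub_zero, incl_mul_mono, mono_mul_incl]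
      -- The term is `a c αⁿ(b) uⁿ`. For `n > 0` its coefficient lies in `T'` because of `αⁿ(b)`.
      -- For `n < 0` it equals `uⁿ α⁻ⁿ(a c) b`, and now `α⁻ⁿ(a c)` lies in `T'`.
      rcases lt_or_gt_of_ne hn with hn | hn
      · refine hright _ _ ?_
        rw [map_mul, ← StarAlgEquiv.mul_apply, ← zpow_add, neg_add_cancel, zpow_zero]
        exact (hmul' _ _ (hshift _ (hmul _ _ ha).2 _ (by omega))).2
      · exact hleft _ (hmul' _ _ (hshift _ hb _ hn)).1 _
  obtain ⟨f, hf, hfε⟩ := (h1.and ((Metric.tendsto_nhds.1 (hW x)) ε hε)).exists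
  rw [dist_zero_right] at hfε
  set w := incl α a * (x - coeff α 0 x) * incl α b with hw
  set z := incl α a * x * incl α b with hz
  have hzI : z ∈ I.1 := (I.2.2 _ _ (I.2.2 _ _ hx).1).2
  have hPz : compress (incl α f) z ∈ I.1 := by
    rw [compress_apply]
    have h4 := I.1.sub_mem hzI (I.2.2 (incl α f) _ hzI).1
    exact I.1.sub_mem h4 (I.2.2 _ _ h4).2
  set y := a * e * b with hy
  -- This is the difference between `y` and its compression `(1 - f) y (1 - f)`.
  let t := f * y + y * f - f * y * f
  have ht : t ∈ T' := T'.sub_mem (T'.add_mem (hmul' _ _ hf.1).2 (hmul' _ _ hf.1).1) (hmul' _ _ hf.1).1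
  have hyt : incl α (y - t) = compress (incl α f) z - compress (incl α f) w := by
    have h4 : z - w = incl α y := by
      rw [hz, hw, hy, he, map_mul, map_mul]
      noncomm_ring
    rw [← map_sub, h4, compress_apply, ← map_mul, ← map_sub, ← map_mul, ← map_sub]
    congr 1
    simp only [t]
    noncomm_ring
  let φ : A →⋆ₙₐ[ℂ] I.Quot := I.mk.comp (incl α)
  have hφ : ‖φ (y - t)‖ < ε := by
    have : φ (y - t) = I.mkₗ (- compress (incl α f) w) := by
      refine (I.mkₗ_eq_mkₗ).2 ?_
      change incl α (y - t) - _ ∈ I.1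
      rw [hyt, sub_neg_eq_add, sub_add_cancel]
      exact hPz
    rw [this]
    refine (I.norm_mkₗ_le _).trans_lt ?_
    rw [norm_neg]
    exact hfε
  -- Modulo `I` the element `y - t` of `A` is small, so it agrees with a small `k' ∈ A`; the
  -- difference lies in `I ∩ A`.
  obtain ⟨k', hk', hn⟩ := φ.exists_norm_lt (y - t) (sub_pos.2 hφ)
  refine ⟨y - t - k', ?_, t, ht, ?_⟩
  · rw [map_sub]
    exact (I.mkₗ_eq_mkₗ).1 hk'.symm
  · rw [add_sub_cancel] at hn
    convert hn using 2
    abel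

end CrossedProduct

/-! ### Separating representations -/

section GNS

open scoped ComplexOrder

/-- A nonzero element of a C⋆-algebra is nonzero in some representation on a Hilbert space. -/
theorem exists_representation {Q : Type u} [NonUnitalCStarAlgebra Q] {q : Q} (hq : q ≠ 0) :
    ∃ (H : Type u) (_ : NormedAddCommGroup H) (_ : InnerProductSpace ℂ H) (_ : CompleteSpace H)
      (π : Q →⋆ₙₐ[ℂ] (H →L[ℂ] H)), π q ≠ 0 := by
  let _ : PartialOrder Q := CStarAlgebra.spectralOrder Q
  have _ : StarOrderedRing Q := CStarAlgebra.spectralOrderedRing Q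
  let p := star q * q
  -- In the absence of a unit the class of `p = q⋆ q` serves as the test vector; `π q` maps it to
  -- the class of `r = q q⋆ q`.
  let r := q * p
  have hr : r ≠ 0 := by
    intro h
    have h1 : star p * p = 0 := by
      have : star p * p = star q * r := by simp only [p, r, star_mul, star_star, mul_assoc]
      rw [this, h, mul_zero]
    exact hq ((CStarRing.star_mul_self_eq_zero_iff q).1
      ((CStarRing.star_mul_self_eq_zero_iff p).1 h1))
  have hc : ¬ (0 : Q) ≤ - (star r * r) := by
    intro h
    exact hr ((CStarRing.star_mul_self_eq_zero_iff r).1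
      (le_antisymm (neg_nonneg.1 h) (star_mul_self_nonneg r)))
  -- Separating `-r⋆ r` from the closed positive cone gives a positive real functional with `f (r⋆
  -- r) > 0`.
  obtain ⟨f, hf, hfc⟩ := (ProperCone.positive ℝ Q).hyperplane_separation_point
    (x₀ := - (star r * r)) hc
  -- Symmetrizing makes `g (i x)` vanish for selfadjoint `x`, so the complex-linear extension takes
  -- the real value `2 f x` on positive `x`.
  let g : Module.Dual ℝ Q :=
    { toFun := fun x => f x + f (star x)
      map_add' := fun x y => by rw [star_add, map_add, map_add]; abel
      map_smul' := fun c x => by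
        rw [star_smul, map_smul, map_smul, star_trivial, RingHom.id_apply, smul_add] }
  have hg : ∀ x, 0 ≤ x → (g.extendRCLike (𝕜 := ℂ) : Q →ₗ[ℂ] ℂ) x = ((2 * f x : ℝ) : ℂ) := by
    intro x hx
    have hx' : star x = x := (IsSelfAdjoint.of_nonneg hx).star_eq
    rw [Module.Dual.extendRCLike_apply]
    have h1 : g x = 2 * f x := by
      change f x + f (star x) = _
      rw [hx', two_mul]
    have h2 : g ((RCLike.I : ℂ) • x) = 0 := by
      change f _ + f (star _) = 0
      rw [star_smul, hx']
      simp
    rw [h1, h2]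
    simp
  let F : Q →ₚ[ℂ] ℂ := PositiveLinearMap.mk₀ (g.extendRCLike (𝕜 := ℂ) : Q →ₗ[ℂ] ℂ) (by
    intro x hx
    rw [hg x hx]
    exact_mod_cast mul_nonneg zero_le_two (hf x hx))
  refine ⟨F.GNS, inferInstance, inferInstance, inferInstance, F.gnsNonUnitalStarAlgHom, ?_⟩
  intro h0
  have h1 : F.gnsNonUnitalStarAlgHom q (F.toPreGNS p : F.GNS) = 0 := by
    rw [h0]; rfl
  rw [PositiveLinearMap.gnsNonUnitalStarAlgHom_apply_coe] at h1
  have h2 : ‖F.leftMulMapPreGNS q (F.toPreGNS p)‖ = 0 := by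
    rw [← UniformSpace.Completion.norm_coe, h1, norm_zero]
  have h3 : F.leftMulMapPreGNS q (F.toPreGNS p) = F.toPreGNS r := rfl
  have h4 := PositiveLinearMap.preGNS_norm_sq F (F.toPreGNS r)
  rw [← h3, h2, h3] at h4
  have h5 : F (star r * r) = ((2 * f (star r * r) : ℝ) : ℂ) := hg _ (star_mul_self_nonneg r)
  change _ = F (star r * r) at h4
  rw [h5] at h4
  rw [map_neg] at hfc
  have h6 : (2 * f (star r * r) : ℝ) = 0 := by
    have : ((2 * f (star r * r) : ℝ) : ℂ) = 0 := by rw [← h4]; simp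
    exact_mod_cast this
  linarith

end GNS

/-! ### Regular covariant representations -/

section Regular

variable {H : Type u} [NormedAddCommGroup H] [InnerProductSpace ℂ H]

/-- The diagonal operator on `ℓ²(ℤ, H)` given by a bounded family of operators. -/
def diagonalOperator (T : ℤ → H →L[ℂ] H) (M : ℝ) (hT : ∀ n, ‖T n‖ ≤ M) :
    lp (fun _ : ℤ => H) 2 →L[ℂ] lp (fun _ : ℤ => H) 2 :=
  have hM : 0 ≤ M := (norm_nonneg _).trans (hT 0)
  have hle : ∀ (x : lp (fun _ : ℤ => H) 2) n, ‖T n (x n)‖ ≤ ‖((M : ℂ) • x) n‖ := fun x n => by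
    rw [lp.coeFn_smul, Pi.smul_apply, norm_smul, Complex.norm_real, Real.norm_of_nonneg hM]
    exact ((T n).le_opNorm _).trans (by gcongr; exact hT n)
  LinearMap.mkContinuous
    { toFun := fun x => ⟨fun n => T n (x n), (lp.memℓp ((M : ℂ) • x)).mono' (hle x)⟩
      map_add' := fun x y => lp.ext (funext fun n => map_add (T n) _ _)
      map_smul' := fun c x => lp.ext (funext fun n => map_smul (T n) _ _) } M fun x => by
    have h1 := lp.norm_mono (E := fun _ : ℤ => H) (p := 2) two_ne_zero
      (x := ⟨fun n => T n (x n), (lp.memℓp ((M : ℂ) • x)).mono' (hle x)⟩) (hle x)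
    refine h1.trans ?_
    rw [norm_smul, Complex.norm_real, Real.norm_of_nonneg hM]

theorem diagonalOperator_apply (T : ℤ → H →L[ℂ] H) (M : ℝ) (hT : ∀ n, ‖T n‖ ≤ M)
    (x : lp (fun _ : ℤ => H) 2) (n : ℤ) : diagonalOperator T M hT x n = T n (x n) := rfl

/-- The shift on `ℓ²(ℤ, H)`. -/
def shiftOperator (k : ℤ) : lp (fun _ : ℤ => H) 2 →L[ℂ] lp (fun _ : ℤ => H) 2 :=
  have h2 : (0 : ℝ) < (2 : ℝ≥0∞).toReal := by norm_num
  have hmem : ∀ x : lp (fun _ : ℤ => H) 2, Memℓp (fun n => x (n - k)) 2 := fun x =>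
    memℓp_gen (((Equiv.subRight k).summable_iff
      (f := fun n => ‖x n‖ ^ (2 : ℝ≥0∞).toReal)).2 ((lp.memℓp x).summable h2))
  LinearMap.mkContinuous
    { toFun := fun x => ⟨fun n => x (n - k), hmem x⟩
      map_add' := fun x y => rfl
      map_smul' := fun c x => rfl } 1 fun x => by
    rw [one_mul]
    refine lp.norm_le_of_tsum_le h2 (norm_nonneg _) ?_
    rw [lp.norm_rpow_eq_tsum h2 x]
    exact ((Equiv.subRight k).tsum_eq (fun n => ‖x n‖ ^ (2 : ℝ≥0∞).toReal)).le

theorem shiftOperator_apply (k : ℤ) (x : lp (fun _ : ℤ => H) 2) (n : ℤ) :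
    shiftOperator k x n = x (n - k) := rfl

variable [CompleteSpace H]

theorem star_shiftOperator (k : ℤ) :
    star (shiftOperator k : lp (fun _ : ℤ => H) 2 →L[ℂ] lp (fun _ : ℤ => H) 2) =
      shiftOperator (-k) := by
  symm
  refine (ContinuousLinearMap.eq_adjoint_iff _ _).2 fun x y => ?_
  rw [lp.inner_eq_tsum, lp.inner_eq_tsum, ← (Equiv.subRight k).tsum_eq]
  refine tsum_congr fun n => ?_
  rw [shiftOperator_apply, shiftOperator_apply]
  simp

/-- The shift on `ℓ²(ℤ, H)` as a unitary. -/
def shiftUnitary : unitary (lp (fun _ : ℤ => H) 2 →L[ℂ] lp (fun _ : ℤ => H) 2) :=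
  ⟨shiftOperator 1, by
    rw [Unitary.mem_iff, star_shiftOperator]
    constructor
    · exact ContinuousLinearMap.ext fun x => lp.ext (funext fun n =>
        congrArg (fun m => x m) (show n - -1 - 1 = n by ring))
    · exact ContinuousLinearMap.ext fun x => lp.ext (funext fun n =>
        congrArg (fun m => x m) (show n - 1 - -1 = n by ring))⟩

variable {A : Type u} [NonUnitalCStarAlgebra A]

/-- The representation of `A` on `ℓ²(ℤ, H)` induced by a representation of `A` on `H`. -/
def regularRep (α : A ≃⋆ₐ[ℂ] A) (π : A →⋆ₙₐ[ℂ] (H →L[ℂ] H)) :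
    A →⋆ₙₐ[ℂ] (lp (fun _ : ℤ => H) 2 →L[ℂ] lp (fun _ : ℤ => H) 2) where
  toFun := fun a => diagonalOperator (fun n => π ((α ^ (-n)) a)) ‖a‖ fun n =>
    (NonUnitalStarAlgHom.norm_apply_le π _).trans
      (NonUnitalStarAlgHom.norm_apply_le (α ^ (-n)) a)
  map_smul' := fun c a => ContinuousLinearMap.ext fun x => lp.ext (funext fun n => by
    change π ((α ^ (-n)) (c • a)) (x n) = c • π ((α ^ (-n)) a) (x n)
    rw [map_smul, map_smul]; rfl)
  map_zero' := ContinuousLinearMap.ext fun x => lp.ext (funext fun n => by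
    change π ((α ^ (-n)) 0) (x n) = 0
    rw [map_zero, map_zero]; rfl)
  map_add' := fun a b => ContinuousLinearMap.ext fun x => lp.ext (funext fun n => by
    change π ((α ^ (-n)) (a + b)) (x n) = π ((α ^ (-n)) a) (x n) + π ((α ^ (-n)) b) (x n)
    rw [map_add, map_add]; rfl)
  map_mul' := fun a b => ContinuousLinearMap.ext fun x => lp.ext (funext fun n => by
    change π ((α ^ (-n)) (a * b)) (x n) = π ((α ^ (-n)) a) (π ((α ^ (-n)) b) (x n))
    rw [map_mul, map_mul]; rfl)
  map_star' := fun a => by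
    refine (ContinuousLinearMap.eq_adjoint_iff _ _).2 fun x y => ?_
    rw [lp.inner_eq_tsum, lp.inner_eq_tsum]
    refine tsum_congr fun n => ?_
    rw [diagonalOperator_apply, diagonalOperator_apply, map_star, map_star,
      ContinuousLinearMap.star_eq_adjoint, ContinuousLinearMap.adjoint_inner_left]

/-- The regular covariant representation induced by a representation of `A`. -/
def CovariantRep.regular (α : A ≃⋆ₐ[ℂ] A) (π : A →⋆ₙₐ[ℂ] (H →L[ℂ] H)) : CovariantRep A α where
  H := lp (fun _ : ℤ => H) 2
  π := regularRep α π
  U := shiftUnitary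
  covariant a := by
    change shiftOperator 1 * regularRep α π a * star (shiftOperator 1 : lp (fun _ : ℤ => H) 2 →L[ℂ] lp (fun _ : ℤ => H) 2) = regularRep α π (α a)
    rw [star_shiftOperator]
    refine ContinuousLinearMap.ext fun x => lp.ext (funext fun n => ?_)
    change π ((α ^ (-(n - 1))) a) (x (n - 1 - -1)) = π ((α ^ (-n)) (α a)) (x n)
    have h1 : (α ^ (-(n - 1))) a = (α ^ (-n)) (α a) := by
      have h2 : -(n - 1) = -n + 1 := by ring
      rw [h2, zpow_add, zpow_one]
      rfl
    rw [h1]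
    exact congrArg (fun m => π ((α ^ (-n)) (α a)) (x m)) (show n - 1 - -1 = n by ring)

end Regular

namespace CrossedProduct

variable {A : Type u} [NonUnitalCStarAlgebra A] {α : A ≃⋆ₐ[ℂ] A}

/-- The ideal of the crossed product generated by an invariant ideal `K` intersects `A` in `K`. -/
theorem mem_of_incl_mem_idealSpan (K : ClosedIdeal A) (hinv : ∀ x ∈ K.1, ∀ n : ℤ, (α ^ n) x ∈ K.1)
    {a : A} (ha : incl α a ∈ idealSpan α K.1) : a ∈ K.1 := by
  by_contra hcon
  obtain ⟨H, _, _, _, π, hπ⟩ := exists_representation (mt K.mk_eq_zero.1 hcon)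
  let ρ := CovariantRep.regular α (π.comp K.mk)
  -- Invariance of `K` is needed here: coordinate `n` of the regular representation sees `α⁻ⁿ(x)`.
  have hker : ∀ x ∈ K.1, regularRep α (π.comp K.mk) x = 0 := by
    intro x hx
    refine ContinuousLinearMap.ext fun y => lp.ext (funext fun n => ?_)
    change π (K.mk ((α ^ (-n)) x)) (y n) = 0
    rw [K.mk_eq_zero.2 (hinv x hx _), map_zero]
    rfl
  have h1 : incl α a ∈ ρ.eval.kerIdeal.1 :=
    idealSpan_le ρ.eval.kerIdeal.2.1 (fun x hx n => by
      rw [NonUnitalStarAlgHom.mem_kerIdeal, eval_mono, show ρ.π x = 0 from hker x hx, zero_mul]) ha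
  rw [NonUnitalStarAlgHom.mem_kerIdeal, incl_apply, eval_mono, zpow_zero, Submonoid.coe_one,
    mul_one] at h1
  replace h1 : regularRep α (π.comp K.mk) a = 0 := h1
  refine hπ (ContinuousLinearMap.ext fun v => ?_)
  -- On vectors supported at coordinate `0`, the regular representation is the original one.
  have h2 : regularRep α (π.comp K.mk) a (lp.single 2 0 v : lp (fun _ : ℤ => H) 2) 0 =
      π (K.mk a) v := by
    change π (K.mk ((α ^ (-(0 : ℤ))) a)) ((lp.single 2 0 v : lp (fun _ : ℤ => H) 2) 0) = _
    rw [lp.single_apply_self, neg_zero, zpow_zero]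
    rfl
  rw [← h2, h1]
  rfl

end CrossedProduct

/-! ### Intersecting ideals with the coefficient algebra -/

namespace CrossedProduct

variable {A : Type u} [NonUnitalCStarAlgebra A] {α : A ≃⋆ₐ[ℂ] A}

/-- A closed left ideal contains `x` as soon as it contains all `c x`. -/
theorem mem_of_mul_mem {W : Submodule ℂ A} (hW : IsClosed (W : Set A)) {x : A}
    (h : ∀ c, c * x ∈ W) : x ∈ W := by
  obtain ⟨l, hl, -, h2, -⟩ := exists_approximateUnit A
  exact hW.mem_of_tendsto (h2 x) (Eventually.of_forall h)

theorem mem_of_mul_mem_right {W : Submodule ℂ A} (hW : IsClosed (W : Set A)) {x : A}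
    (h : ∀ c, x * c ∈ W) : x ∈ W := by
  obtain ⟨l, hl, -, -, h2⟩ := exists_approximateUnit A
  exact hW.mem_of_tendsto (h2 x) (Eventually.of_forall h)

variable (I : ClosedIdeal (CrossedProduct α))

theorem isClosed_comap_mono (n : ℤ) : IsClosed ((I.1.comap (mono α n) : Submodule ℂ A) : Set A) :=
  I.2.1.preimage (continuous_mono n)

theorem mono_mem_of_incl_mem {a : A} (ha : incl α a ∈ I.1) (n : ℤ) : mono α n a ∈ I.1 :=
  mem_of_mul_mem_right (isClosed_comap_mono I n) fun c => by
    rw [Submodule.mem_comap, ← incl_mul_mono]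
    exact (I.2.2 _ _ ha).2

/-- The unitary `u` need not belong to the crossed product, so `uⁿ a u⁻ⁿ` is replaced by `(c uⁿ) a
(α⁻ⁿ(c') u⁻ⁿ) = c αⁿ(a) c'`, and `c`, `c'` are removed by approximate units. -/
theorem incl_zpow_mem {a : A} (ha : incl α a ∈ I.1) (n : ℤ) : incl α ((α ^ n) a) ∈ I.1 := by
  refine mem_of_mul_mem (W := I.1.comap (mono α 0)) (isClosed_comap_mono I 0) fun c => ?_
  refine mem_of_mul_mem_right (isClosed_comap_mono I 0) fun c' => ?_
  have h := (I.2.2 (mono α (-n) ((α ^ (-n)) c')) _ (I.2.2 (mono α n c) _ ha).1).2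
  rwa [mono_mul_incl, mono_mul_mono, ← StarAlgEquiv.mul_apply (α ^ n), ← zpow_add, add_neg_cancel,
    zpow_zero] at h

end CrossedProduct

/-! ### The ideal defined by the tail filtration -/

namespace IsInvariantIdeal

variable {B : Type u} [NonUnitalCStarAlgebra B] {σ : B ≃⋆ₐ[ℂ] B} {D : NonUnitalStarSubalgebra ℂ B}
  {hD : AbsorbsShifts σ D} {K : Submodule ℂ B}

variable (σ D hD K) in
/-- The closure of the sum of `K` and of `∑_{i ≥ m} σⁱ(D)`. -/
def addTail (m : ℤ) : Submodule ℂ B :=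
  (K ⊔ (tailAlgebra σ D hD m).toSubmodule).topologicalClosure

theorem isClosed_addTail (m : ℤ) : IsClosed (addTail σ D hD K m : Set B) :=
  Submodule.isClosed_topologicalClosure _

theorem mem_addTail {m : ℤ} {x : B} : x ∈ addTail σ D hD K m ↔
    ∀ ε > 0, ∃ k ∈ K, ∃ t ∈ tailAlgebra σ D hD m, ‖x - k - t‖ < ε := by
  refine Metric.mem_closure_iff.trans (forall₂_congr fun ε _ => ?_)
  constructor
  · rintro ⟨y, hy, hxy⟩
    obtain ⟨k, hk, t, ht, rfl⟩ := Submodule.mem_sup.1 hy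
    exact ⟨k, hk, t, ht, by rwa [sub_sub, ← dist_eq_norm]⟩
  · rintro ⟨k, hk, t, ht, h⟩
    exact ⟨k + t, Submodule.add_mem_sup hk ht, by rwa [dist_eq_norm, ← sub_sub]⟩

theorem zpow_mem_addTail (hK : IsInvariantIdeal σ (sigmaAlgebra σ D hD) K) {m : ℤ} {x : B}
    (hx : x ∈ addTail σ D hD K m) (j : ℤ) : (σ ^ j) x ∈ addTail σ D hD K (j + m) := by
  refine map_mem_closure (StarAlgEquiv.isometry (σ ^ j)).continuous hx fun y hy => ?_
  obtain ⟨k, hk, t, ht, rfl⟩ := Submodule.mem_sup.1 hy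
  rw [map_add]
  exact Submodule.add_mem_sup (hK.zpow k hk j) (zpow_mem_tailAlgebra hD ht j)

variable (σ D hD K) in
/-- The elements `z` of `D_σ` such that `a z b` lies in `K` modulo `∑_{i > m} σⁱ(D)` for all `m` and
all `a, b` in the closure of `∑_{i ≥ m} σⁱ(D)`. -/
def graded : Submodule ℂ B where
  carrier := {z | z ∈ sigmaAlgebra σ D hD ∧ ∀ m : ℤ, ∀ a ∈ tailAlgebra σ D hD m,
    ∀ b ∈ tailAlgebra σ D hD m, a * z * b ∈ addTail σ D hD K (m + 1)}
  add_mem' := fun hx hy => ⟨add_mem hx.1 hy.1, fun m a ha b hb => by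
    rw [mul_add, add_mul]
    exact Submodule.add_mem _ (hx.2 m a ha b hb) (hy.2 m a ha b hb)⟩
  zero_mem' := ⟨zero_mem _, fun m a ha b hb => by
    rw [mul_zero, zero_mul]
    exact Submodule.zero_mem _⟩
  smul_mem' := fun c x hx => ⟨SMulMemClass.smul_mem c hx.1, fun m a ha b hb => by
    rw [mul_smul_comm, smul_mul_assoc]
    exact Submodule.smul_mem _ c (hx.2 m a ha b hb)⟩

/-- A multiplier from `D_σ` is absorbed into `a` or `b`, the tails being ideals. Invariance holds
because `σʲ` shifts all tails by `j` and the condition is imposed for every `m`. -/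
theorem graded_isInvariantIdeal (hK : IsInvariantIdeal σ (sigmaAlgebra σ D hD) K) :
    IsInvariantIdeal σ (sigmaAlgebra σ D hD) (graded σ D hD K) where
  closed := by
    have : (graded σ D hD K : Set B) = (sigmaAlgebra σ D hD : Set B) ∩
        ⋂ m : ℤ, ⋂ a ∈ tailAlgebra σ D hD m, ⋂ b ∈ tailAlgebra σ D hD m,
          (fun z => a * z * b) ⁻¹' (addTail σ D hD K (m + 1) : Set B) := by
      ext z
      simp only [Set.mem_inter_iff, Set.mem_iInter, Set.mem_preimage]
      rfl
    rw [this]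
    refine (sigmaAlgebra_isClosed D hD).inter (isClosed_iInter fun m => isClosed_iInter fun a =>
      isClosed_iInter fun _ => isClosed_iInter fun b => isClosed_iInter fun _ =>
        (isClosed_addTail _).preimage (by fun_prop))
  mem _ hx := hx.1
  mul c hc x hx := by
    refine ⟨⟨mul_mem hc hx.1, fun m a ha b hb => ?_⟩, ⟨mul_mem hx.1 hc, fun m a ha b hb => ?_⟩⟩
    · rw [← mul_assoc]
      exact hx.2 m _ (tailAlgebra_mul_sigmaAlgebra hD ha hc) b hb
    · rw [← mul_assoc, mul_assoc]
      exact hx.2 m a ha _ (sigmaAlgebra_mul_tailAlgebra hD hc hb)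
  zpow x hx j := by
    refine ⟨zpow_mem_sigmaAlgebra D hD hx.1 j, fun m a ha b hb => ?_⟩
    have h := hK.zpow_mem_addTail (hx.2 _ _ (zpow_mem_tailAlgebra hD ha (-j)) _
      (zpow_mem_tailAlgebra hD hb (-j))) j
    rw [map_mul, map_mul, ← StarAlgEquiv.mul_apply, ← StarAlgEquiv.mul_apply, ← zpow_add,
      add_neg_cancel, zpow_zero] at h
    rwa [← add_assoc, ← add_assoc, add_neg_cancel, zero_add] at h

variable [hDcl : IsClosed (D : Set B)]

/-- For `a, b ∈ D` the product `a x b` is in `D` and in the closure of `K + T_1`, hence in `K` by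
`mem_of_approx`. An approximate unit of `D` removes `a` and `b`. -/
theorem mem_of_mem_graded (hK : IsInvariantIdeal σ (sigmaAlgebra σ D hD) K)
    (hc : IsCancellative σ hK.restrict) (hc0 : IsCancellative σ (bot σ D hD).restrict) {x : B}
    (hx : x ∈ D) (hxK : x ∈ graded σ D hD K) : x ∈ K := by
  have hD0 : ∀ a ∈ D, a ∈ tailAlgebra σ D hD 0 := fun a ha =>
    segmentSum_le_tailAlgebra hD (n := 1) (mem_segmentSum_one.2 ⟨a, ha, by simp⟩)
  have h : ∀ a ∈ D, ∀ b ∈ D, a * x * b ∈ K := fun a ha b hb =>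
    hK.mem_of_approx hc hc0 (mul_mem (mul_mem ha hx) hb)
      (mem_addTail.1 (hxK.2 0 a (hD0 a ha) b (hD0 b hb)))
  obtain ⟨l, hl, h1, h2, h3⟩ := D.exists_approximateUnit hDcl
  have h4 : ∀ b ∈ D, x * b ∈ K := fun b hb =>
    hK.closed.mem_of_tendsto (h2 _ (mul_mem hx hb)) (h1.mono fun e he => by
      rw [← mul_assoc]
      exact h e he.1 b hb)
  exact hK.closed.mem_of_tendsto (h3 x hx) (h1.mono fun e he => h4 e he.1)

end IsInvariantIdeal

/-! ### The correspondence of ideals -/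

namespace IsHarnischKirchbergSystem

open CrossedProduct

variable {B : Type u} [NonUnitalCStarAlgebra B] {σ : B ≃⋆ₐ[ℂ] B} {D : NonUnitalStarSubalgebra ℂ B}
  [hDcl : IsClosed (D : Set B)] (hD : IsHarnischKirchbergSystem σ D) {K : Submodule ℂ B}

/-- If all semi-invariant ideals of `D` are cancellative, then `graded K ⊆ (K ∩ D)_σ`. -/
theorem graded_le (hcanc : ∀ J : ClosedIdeal D, IsSemiInvariant σ J → IsCancellative σ J)
    (hK : IsInvariantIdeal σ (sigmaAlgebra σ D hD.absorbsShifts) K) {x : B}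
    (hx : x ∈ IsInvariantIdeal.graded σ D hD.absorbsShifts K) :
    x ∈ sigmaAlgebra σ hK.restrict.toSubalgebra
      (hD.absorbsShifts_ideal hK.restrict_isSemiInvariant) := by
  have hZ := hK.graded_isInvariantIdeal
  have hle : hZ.restrict.toSubalgebra ≤ hK.restrict.toSubalgebra := fun z hz => by
    obtain ⟨h1, h2⟩ := hZ.mem_restrict_toSubalgebra.1 hz
    exact hK.mem_restrict_toSubalgebra.2 ⟨h1, hK.mem_of_mem_graded
      (hcanc _ hK.restrict_isSemiInvariant)
      (hcanc _ (IsInvariantIdeal.bot σ D _).restrict_isSemiInvariant) h1 h2⟩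
  have hZs := hD.absorbsShifts_ideal hZ.restrict_isSemiInvariant
  -- The assumption is applied to the auxiliary ideal `graded ∩ D`: its cancellativity lets `graded`
  -- be recovered from its intersection with `D`.
  exact sigmaAlgebra_mono hZs _ hle
    (hZ.mem_sigmaAlgebra_restrict (hcanc _ hZ.restrict_isSemiInvariant) hZs hx)

theorem sigmaAut_zpow_apply (n : ℤ) (x : sigmaAlgebra σ D hD.absorbsShifts) :
    (((sigmaAut D hD.absorbsShifts ^ n) x : sigmaAlgebra σ D hD.absorbsShifts) : B) =
      (σ ^ n) (x : B) := by
  induction n generalizing x with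
  | zero => rfl
  | succ n ih =>
    rw [zpow_add_one, zpow_add_one, StarAlgEquiv.mul_apply, StarAlgEquiv.mul_apply, ih]
    rfl
  | pred n ih =>
    rw [zpow_sub_one, zpow_sub_one, StarAlgEquiv.mul_apply, StarAlgEquiv.mul_apply, ih]
    rfl

/-- The ideal `I ∩ D_σ` of `D_σ`, as a subspace of `B`. -/
def contract (I : ClosedIdeal hD.crossedProductAlgebra) : Submodule ℂ B where
  carrier := (↑) '' {x : sigmaAlgebra σ D hD.absorbsShifts | incl (sigmaAut D hD.absorbsShifts) x ∈ I.1}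
  add_mem' := by
    rintro _ _ ⟨x, hx, rfl⟩ ⟨y, hy, rfl⟩
    exact ⟨x + y, by simpa using I.1.add_mem hx hy, rfl⟩
  zero_mem' := ⟨0, by simp, rfl⟩
  smul_mem' := by
    rintro c _ ⟨x, hx, rfl⟩
    exact ⟨c • x, by simpa using I.1.smul_mem c hx, rfl⟩

variable (I : ClosedIdeal hD.crossedProductAlgebra)

theorem coe_mem_contract {x : sigmaAlgebra σ D hD.absorbsShifts} :
    (x : B) ∈ hD.contract I ↔ incl (sigmaAut D hD.absorbsShifts) x ∈ I.1 :=
  ⟨fun ⟨_, hy, e⟩ => Subtype.ext e ▸ hy, fun hx => ⟨x, hx, rfl⟩⟩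

theorem contract_isInvariantIdeal :
    IsInvariantIdeal σ (sigmaAlgebra σ D hD.absorbsShifts) (hD.contract I) where
  closed := (sigmaAlgebra_isClosed D hD.absorbsShifts).isClosedEmbedding_subtypeVal.isClosedMap _
    (I.2.1.preimage (incl _).continuous_of_cstar)
  mem := by
    rintro _ ⟨x, -, rfl⟩
    exact x.2
  mul := by
    rintro a ha _ ⟨x, hx, rfl⟩
    have h := I.2.2 (incl _ ⟨a, ha⟩) _ hx
    rw [← map_mul, ← map_mul] at h
    exact ⟨⟨_, h.1, rfl⟩, ⟨_, h.2, rfl⟩⟩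
  zpow := by
    rintro _ ⟨x, hx, rfl⟩ n
    exact ⟨_, incl_zpow_mem I hx n, hD.sigmaAut_zpow_apply n x⟩

/-- The image of an ideal under the conditional expectation lies in `graded (I ∩ D_σ)`. -/
theorem mem_graded_contract {x : hD.crossedProductAlgebra} (hx : x ∈ I.1)
    {e : sigmaAlgebra σ D hD.absorbsShifts}
    (he : coeff (sigmaAut D hD.absorbsShifts) 0 x = incl _ e) :
    (e : B) ∈ IsInvariantIdeal.graded σ D hD.absorbsShifts (hD.contract I) := by
  have h := hD.absorbsShifts
  refine ⟨e.2, fun m a ha b hb => IsInvariantIdeal.mem_addTail.2 fun ε hε => ?_⟩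
  let A := sigmaAlgebra σ D hD.absorbsShifts
  let T : ℤ → NonUnitalStarSubalgebra ℂ A := fun m =>
    NonUnitalStarSubalgebra.comap (NonUnitalStarSubalgebraClass.subtype A) (tailAlgebra σ D h m)
  have hT : ∀ m (a x : A), x ∈ T m → a * x ∈ T m ∧ x * a ∈ T m := fun m a x hx =>
    ⟨sigmaAlgebra_mul_tailAlgebra h a.2 hx, tailAlgebra_mul_sigmaAlgebra h hx a.2⟩
  obtain ⟨k, hk, t, ht, hlt⟩ := mul_coeff_mul_approx (T := (T m).toSubmodule) (T' := T (m + 1))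
    ((isClosed_tailAlgebra D h (m + 1)).preimage continuous_subtype_val) (hT m) (hT (m + 1))
    -- `σⁿ` maps the tail from `m` into the tail from `m + n`, which is contained in the tail from
    -- `m + 1` because `n ≥ 1`.
    (fun x hx n hn => by
      change (((sigmaAut D hD.absorbsShifts ^ n) x : A) : B) ∈ tailAlgebra σ D h (m + 1)
      rw [hD.sigmaAut_zpow_apply]
      exact tailAlgebra_anti h (by omega) (zpow_mem_tailAlgebra h hx n))
    I hx he (a := ⟨a, tailAlgebra_le_sigmaAlgebra h m ha⟩)
    (b := ⟨b, tailAlgebra_le_sigmaAlgebra h m hb⟩) ha hb hε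
  exact ⟨k, ⟨k, hk, rfl⟩, t, ht, hlt⟩

variable (J : ClosedIdeal D) (hJ : IsSemiInvariant σ J)

/-- `J_σ` as an ideal of `D_σ`. -/
def sigmaIdeal : ClosedIdeal (sigmaAlgebra σ D hD.absorbsShifts) :=
  let S := (sigmaAlgebra σ J.toSubalgebra (hD.absorbsShifts_ideal hJ)).toSubmodule
  ⟨{ carrier := {x | (x : B) ∈ S}
     add_mem' := fun ha hb => S.add_mem ha hb
     zero_mem' := S.zero_mem
     smul_mem' := fun c _ ha => S.smul_mem c ha },
    (hD.sigmaAlgebra_ideal hJ).closed.preimage continuous_subtype_val, fun a x hx =>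
      (hD.sigmaAlgebra_ideal hJ).mul a a.2 x hx⟩

theorem mem_sigmaIdeal {x : sigmaAlgebra σ D hD.absorbsShifts} :
    x ∈ (hD.sigmaIdeal J hJ).1 ↔
      (x : B) ∈ sigmaAlgebra σ J.toSubalgebra (hD.absorbsShifts_ideal hJ) := Iff.rfl

theorem zpow_mem_sigmaIdeal {x : sigmaAlgebra σ D hD.absorbsShifts}
    (hx : x ∈ (hD.sigmaIdeal J hJ).1) (n : ℤ) :
    (sigmaAut D hD.absorbsShifts ^ n) x ∈ (hD.sigmaIdeal J hJ).1 := by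
  rw [mem_sigmaIdeal, hD.sigmaAut_zpow_apply]
  exact zpow_mem_sigmaAlgebra _ _ hx n

/-- The ideal `J_σ ⋊ ℤ` of `D_σ ⋊ ℤ`. -/
def crossedIdeal : ClosedIdeal hD.crossedProductAlgebra :=
  ⟨idealSpan _ (hD.sigmaIdeal J hJ).1, isClosed_idealSpan _, fun y _ hx =>
    idealSpan_mul_mem (hD.sigmaIdeal J hJ).2.2 (fun _ hx n => hD.zpow_mem_sigmaIdeal J hJ hx n) y hx⟩

/-- The range of the natural map is closed and consists of limits of sums of the same monomials that
generate `crossedIdeal`. -/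
theorem coe_crossedIdeal : ((hD.crossedIdeal J hJ).1 : Set hD.crossedProductAlgebra) =
    Set.range (hD.idealMap J hJ) := by
  let F : CrossedProduct (sigmaAut J.toSubalgebra (hD.absorbsShifts_ideal hJ)) →ₗ[ℂ]
      hD.crossedProductAlgebra := (hD.idealMap J hJ : _ →ₗ[ℂ] _)
  have hmono : ∀ (a : sigmaAlgebra σ J.toSubalgebra (hD.absorbsShifts_ideal hJ)) (n : ℤ),
      hD.idealMap J hJ (mono _ n a) = mono _ n (NonUnitalStarSubalgebra.inclusion
        (sigmaAlgebra_mono (hD.absorbsShifts_ideal hJ) hD.absorbsShifts J.toSubalgebra_le) a) :=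
    fun a n => rfl
  refine subset_antisymm (fun x hx => ?_) ?_
  · refine idealSpan_le (W := LinearMap.range F)
      (hD.idealMap J hJ).isClosed_range (fun a ha n => ?_) hx
    exact ⟨mono _ n ⟨a, ha⟩, hmono _ n⟩
  · rintro _ ⟨x, rfl⟩
    refine mem_of_mono_mem (W := (hD.crossedIdeal J hJ).1.comap F)
      ((isClosed_idealSpan _).preimage (hD.idealMap J hJ).continuous_of_cstar) (fun a n => ?_) x
    change hD.idealMap J hJ (mono _ n a) ∈ (hD.crossedIdeal J hJ).1
    rw [hmono]
    exact mono_mem_idealSpan a.2 n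

theorem crossedIdeal_mono {J J' : ClosedIdeal D} (hJ : IsSemiInvariant σ J)
    (hJ' : IsSemiInvariant σ J') (h : J ≤ J') : hD.crossedIdeal J hJ ≤ hD.crossedIdeal J' hJ' := by
  have hle : J.toSubalgebra ≤ J'.toSubalgebra := by
    rintro _ ⟨x, hx, rfl⟩
    exact ⟨x, h hx, rfl⟩
  exact idealSpan_le (isClosed_idealSpan _) fun a ha n => mono_mem_idealSpan
    (sigmaAlgebra_mono (hD.absorbsShifts_ideal hJ) (hD.absorbsShifts_ideal hJ') hle ha) n

/-- The semi-invariant ideal `I ∩ D` of `D`. -/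
def restrictIdeal : ClosedIdeal D := (hD.contract_isInvariantIdeal I).restrict

theorem mem_restrictIdeal {d : D} : d ∈ (hD.restrictIdeal I).1 ↔ hD.inclusion d ∈ I.1 :=
  hD.coe_mem_contract I (x := ⟨d, le_sigmaAlgebra D hD.absorbsShifts d.2⟩)

theorem restrictIdeal_isSemiInvariant : IsSemiInvariant σ (hD.restrictIdeal I) :=
  (hD.contract_isInvariantIdeal I).restrict_isSemiInvariant

/-- The intersection with `D` is taken in two stages: `J_σ ⋊ ℤ` meets `D_σ` in `J_σ` by the regular
representation, and `J_σ` meets `D` in `J` by independence of the shifts. -/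
theorem restrictIdeal_crossedIdeal
    (hc : IsCancellative σ (IsInvariantIdeal.bot σ D hD.absorbsShifts).restrict) :
    hD.restrictIdeal (hD.crossedIdeal J hJ) = J := by
  refine Subtype.ext (Submodule.ext fun d => (hD.mem_restrictIdeal _).trans ⟨fun h => ?_, fun h =>
    mono_mem_idealSpan (le_sigmaAlgebra _ (hD.absorbsShifts_ideal hJ)
      (ClosedIdeal.mem_toSubalgebra.2 h)) 0⟩)
  have := mem_of_incl_mem_idealSpan (hD.sigmaIdeal J hJ)
    (fun _ hx n => hD.zpow_mem_sigmaIdeal J hJ hx n) h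
  exact ClosedIdeal.mem_toSubalgebra.1 (hD.mem_of_mem_sigmaAlgebra hJ hc d.2 this)

/-- The generators `a uⁿ`, `a ∈ (I ∩ D)_σ`, lie in `I` because `I ∩ D_σ` is closed and invariant.
Conversely the expectation maps `I` into `graded`, hence into `(I ∩ D)_σ`, and `le_idealSpan`
applies. -/
theorem crossedIdeal_restrictIdeal
    (hcanc : ∀ J : ClosedIdeal D, IsSemiInvariant σ J → IsCancellative σ J) :
    hD.crossedIdeal (hD.restrictIdeal I) (hD.restrictIdeal_isSemiInvariant I) = I := by
  have hK := hD.contract_isInvariantIdeal I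
  refine le_antisymm (idealSpan_le I.2.1 fun a ha n => mono_mem_of_incl_mem I ?_ n) ?_
  · refine (hD.coe_mem_contract I).1 (closure_minimal (fun y hy => ?_) hK.closed ha)
    refine finiteShiftSums_le_of_single (W := hD.contract I) (fun d hd i => ?_)
      (show y ∈ finiteShiftSums σ _ from hy)
    exact hK.zpow d (hK.mem_restrict_toSubalgebra.1 hd).2 i
  · refine le_idealSpan (hD.sigmaIdeal _ _).2.2 I fun x hx => ?_
    obtain ⟨e, he⟩ := coeff_zero_mem_range x
    exact ⟨e, hD.graded_le hcanc hK (hD.mem_graded_contract I hx he.symm), he.symm⟩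

end IsHarnischKirchbergSystem

end

theorem mainTheorem3 {B : Type u} [NonUnitalCStarAlgebra B] (σ : B ≃⋆ₐ[ℂ] B)
    (D : NonUnitalStarSubalgebra ℂ B) [IsClosed (D : Set B)]
    (hD : IsHarnischKirchbergSystem σ D)
    (hcanc : ∀ J : ClosedIdeal D, IsSemiInvariant σ J → IsCancellative σ J) :
    ∃ Δ : SICIdeal σ D ≃o ClosedIdeal hD.crossedProductAlgebra,
      (∀ J : SICIdeal σ D,
        ((Δ J).1 : Set hD.crossedProductAlgebra) = Set.range (hD.idealMap J.1 J.2.1)) ∧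
      (∀ I : ClosedIdeal hD.crossedProductAlgebra,
        ((Δ.symm I).1.1 : Set D) = {d : D | hD.inclusion d ∈ I.1}) := by
  -- The zero ideal is semi-invariant, hence cancellative, which makes the shifts of `D`
  -- independent.
  have hc := hcanc _ (IsInvariantIdeal.bot σ D hD.absorbsShifts).restrict_isSemiInvariant
  have hΔ : ∀ J : SICIdeal σ D, hD.restrictIdeal (hD.crossedIdeal J.1 J.2.1) = J.1 :=
    fun J => hD.restrictIdeal_crossedIdeal J.1 J.2.1 hc
  have hmono : ∀ I I' : ClosedIdeal hD.crossedProductAlgebra, I ≤ I' →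
      hD.restrictIdeal I ≤ hD.restrictIdeal I' := fun I I' h d hd =>
    (hD.mem_restrictIdeal I').2 (h ((hD.mem_restrictIdeal I).1 hd))
  exact
    ⟨{  toFun := fun J => hD.crossedIdeal J.1 J.2.1
        invFun := fun I => ⟨hD.restrictIdeal I, hD.restrictIdeal_isSemiInvariant I,
          hcanc _ (hD.restrictIdeal_isSemiInvariant I)⟩
        left_inv := fun J => Subtype.ext (hΔ J)
        right_inv := fun I => hD.crossedIdeal_restrictIdeal I hcanc
        map_rel_iff' := fun {J J'} => ⟨fun h => by
          -- The order is reflected because the inverse map is monotone as well.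
          have h' := hmono (hD.crossedIdeal J.1 J.2.1) (hD.crossedIdeal J'.1 J'.2.1) h
          rwa [hΔ, hΔ] at h', fun h => hD.crossedIdeal_mono J.2.1 J'.2.1 h⟩ },
      fun J => hD.coe_crossedIdeal J.1 J.2.1,
      fun I => Set.ext fun _ => hD.mem_restrictIdeal I⟩
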